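/- Let $d \ge 1$. For odd $n \ge 3$ let $\mathbb{T}_n^d = (\mathbb{Z}/n\mathbb{Z})^d$, with $\mathbf{i}\sim\mathbf{j}$ if $\mathbf{i},\mathbf{j}$ differ by $\pm 1$ in exactly one coordinate, and let $\gamma_n = 1-\cos(2\pi/n)$. For $\mathbf{i}\in\mathbb{T}_n^d$ the smoothing process $\mathbf{Y}^{(\mathbf{i})}(t) = (Y^{(\mathbf{i})}_{\mathbf{j}}(t))_{\mathbf{j}\in\mathbb{T}_n^d}$, $t\ge 0$, starts from $Y^{(\mathbf{i})}_{\mathbf{j}}(0)=\delta_{\mathbf{i}}(\mathbf{j})$; the sites carry independent unit-rate Poisson clocks, and whenever the clock at $\mathbf{k}$ rings, the value at $\mathbf{k}$ is replaced by the average $\frac1{2d}\sum_{\mathbf{j}\sim\mathbf{k}}Y^{(\mathbf{i})}_{\mathbf{j}}(t-)$ of the values at its neighbors, the other values being unchanged. Almost surely the spatial average $n^{-d}\sum_{\mathbf{j}} Y^{(\mathbf{i})}_{\mathbf{j}}(t)$ has a limit $Y^{(\mathbf{i})}(\infty)$ as $t\to\infty$, and the value at every site converges to it. With $\overline{Y}(t)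 = n^{-d}\sum_{\mathbf{j}} Y^{(\mathbf{0})}_{\mathbf{j}}(t)$, put $$\mathcal{V}(t) = n^{-d}\sum_{\mathbf{j}}\bigl(Y^{(\mathbf{0})}_{\mathbf{j}}(t)-\overline{Y}(t)\bigr)^2,\qquad \mathcal{E}(t) = \frac1{4dn^d}\sum_{\mathbf{j}\sim\mathbf{k}}\bigl(Y^{(\mathbf{0})}_{\mathbf{j}}(t)-Y^{(\mathbf{0})}_{\mathbf{k}}(t)\bigr)^2$$ (sum over ordered pairs of neighbors). There exist constants $\alpha_1,\alpha_2,\alpha_3>0$, depending only on $d$, such that the following hold, all thresholds $n_0\ge 3$, $t_0>0$, $n_0'\ge 3$, $t_0'>0$ depending only on $d$. (0) There exist $n_0, t_0$ such that for all odd $n\ge n_0$ and $t\ge t_0$, $$\frac{\alpha_1 n^{-d}}{t^{d/2+1}\wedge n^{d+2}}e^{-2\gamma_n d^{-1}t}\le \mathbb{E}\,\mathcal{E}(t)\le \frac{\alpha_2 n^{-d}}{t^{d/2+1}\wedge n^{d+2}}e^{-\left(2\gamma_n d^{-1}-\alpha_3 n^{-(d+4)}\right)t},$$ $$\frac{\alpha_1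 n^{-d}}{t^{d/2}\wedge n^{d}}e^{-\left(2\gamma_n d^{-1}+\alpha_3 n^{-(d+4)}\right)t}\le \mathbb{E}\,\mathcal{V}(t)\le \frac{\alpha_2 n^{-d}}{t^{d/2}\wedge n^{d}}e^{-\left(2\gamma_n d^{-1}-\alpha_3 n^{-(d+4)}\right)t}.$$ (i) There exist $n_0, t_0$ such that for all odd $n\ge n_0$, all $t\ge t_0$ and all $\mathbf{i}\in\mathbb{T}_n^d$, $$\frac{\alpha_1}{t^{d/2+1}\wedge n^{d+2}}e^{-2\gamma_n d^{-1}t}\le \mathbb{E}\Bigl[\Bigl(\sum_{\mathbf{j}\in\mathbb{T}_n^d}Y^{(\mathbf{i})}_{\mathbf{j}}(t)-n^d\,Y^{(\mathbf{i})}(\infty)\Bigr)^2\Bigr]\le \frac{\alpha_2}{t^{d/2+1}\wedge n^{d+2}}e^{-\left(2\gamma_n d^{-1}-\alpha_3 n^{-(d+4)}\right)t}.$$ (ii) There exist $n_0', t_0'$ such that for all $\mu\in\mathbb{R}$ and $\sigma>0$ there exist $\eta_1,\eta_2>0$ (depending only on $\mu,\sigma,d$) for which the following holds. For all odd $n\ge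 n_0'$, all $t\ge t_0'$, all $\mathbf{i}\in\mathbb{T}_n^d$ and every family $\{X_{\mathbf{j}}:\mathbf{j}\in\mathbb{Z}^d\}$ of non-negative square-integrable random variables, independent of $\mathbf{Y}^{(\mathbf{i})}$, with $\operatorname{Cov}(X_{\mathbf{j}},X_{\mathbf{k}})=0$ for $\mathbf{j}\ne\mathbf{k}$, $\mathbb{E}X_{\mathbf{j}}=\mu$ and $\operatorname{Var}(X_{\mathbf{j}})=\sigma^2$ for all $\mathbf{j}$, $$\frac{\eta_1}{t^{d/2}\wedge n^{d}}e^{-\left(2\gamma_n d^{-1}+\alpha_3 n^{-(d+4)}\right)t}\le \mathbb{E}\Bigl[\Bigl(\sum_{\mathbf{j}\in\mathbb{T}_n^d}X_{\mathbf{j}}Y^{(\mathbf{i})}_{\mathbf{j}}(t)-Y^{(\mathbf{i})}(\infty)\sum_{\mathbf{j}\in\mathbb{T}_n^d}X_{\mathbf{j}}\Bigr)^2\Bigr]\le \frac{\eta_2}{t^{d/2}\wedge n^{d}}e^{-\left(2\gamma_n d^{-1}-\alpha_3 n^{-(d+4)}\right)t},$$ where $\mathbb{T}_n^d$ is identified with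 $\{-(n-1)/2,\dots,(n-1)/2\}^d\subset\mathbb{Z}^d$. -/

import Mathlib

open MeasureTheory ProbabilityTheory Filter
open scoped NNReal Topology

universe u

noncomputable section

/-- A Poisson process of unit intensity (the ringing times of one clock), as its counting process:
`N t ω` is the number of rings in the time interval `(0, t]`. -/
structure IsUnitPoissonProcess {Ω : Type*} [MeasurableSpace Ω] (N : ℝ≥0 → Ω → ℕ)
    (P : Measure Ω) : Prop where
  measurable : ∀ t, Measurable (N t)
  zero : ∀ᵐ ω ∂P, N 0 ω = 0
  mono : ∀ᵐ ω ∂P, Monotone fun t => N t ω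
  rightCont : ∀ᵐ ω ∂P, ∀ t, ContinuousWithinAt (fun s => N s ω) (Set.Ici t) t
  indepIncrements : HasIndepIncrements N P
  increments : ∀ s t, s ≤ t → HasLaw (fun ω => N t ω - N s ω) (poissonMeasure (t - s)) P

/-- The smoothing dynamics along one realization `N` of the clocks, for the transition matrix `p`.
Nothing changes on an interval `(s, t]` on which no clock rings. If exactly one ring, that of the
clock at `k`, occurs in `(s, t]`, then the value at `k` becomes the average `∑ j, p k j * y s j`
of the values before the ring and the values at the other sites are unchanged.
(If `k` rings at time `t`, taking `s` just before `t` this reads `y_k(t) = ∑ j, p k j * y_j(t-)`.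
For independent Poisson clocks, almost surely no two of them ring simultaneously, so that these
two rules determine the whole path from its initial value.) -/
structure IsSmoothingPath {I : Type*} [Fintype I] [DecidableEq I] (p : Matrix I I ℝ)
    (N : I → ℝ≥0 → ℕ) (y : ℝ≥0 → I → ℝ) : Prop where
  const : ∀ s t, s ≤ t → (∀ k, N k t = N k s) → y t = y s
  ring : ∀ s t k, s ≤ t → N k t = N k s + 1 → (∀ j, j ≠ k → N j t = N j s) →
    y t = Function.update (y s) k (∑ j, p k j * y s j)

/-- `Y` is a smoothing process on the finite set of sites `I`, with transition matrix `p` and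
deterministic initial configuration `y₀`, driven by independent unit-rate Poisson clocks. -/
structure IsSmoothingProcess {I : Type*} [Fintype I] [DecidableEq I] {Ω : Type*}
    [MeasurableSpace Ω] (p : Matrix I I ℝ) (y₀ : I → ℝ) (P : Measure Ω)
    (Y : ℝ≥0 → Ω → I → ℝ) : Prop where
  measurable : ∀ t, Measurable (Y t)
  initial : ∀ᵐ ω ∂P, Y 0 ω = y₀
  dynamics : ∃ N : I → ℝ≥0 → Ω → ℕ,
    (∀ k, IsUnitPoissonProcess (N k) P) ∧
    iIndepFun (fun k ω => fun t => N k t ω) P ∧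
    ∀ᵐ ω ∂P, IsSmoothingPath p (fun k t => N k t ω) (fun t => Y t ω)

/-- The discrete torus `(ℤ/nℤ)^d`. -/
abbrev Torus (d n : ℕ) : Type := Fin d → ZMod n

/-- Neighbouring vertices of the torus: they differ by `±1` in exactly one coordinate. -/
abbrev TorusAdj {d n : ℕ} (i j : Torus d n) : Prop :=
  ∃ k : Fin d, j = i + Pi.single k 1 ∨ j = i - Pi.single k 1

/-- Transition matrix of the simple random walk on the torus (for `n ≥ 3` each vertex has `2d`
distinct neighbours). -/
def srwMatrix (d n : ℕ) : Matrix (Torus d n) (Torus d n) ℝ :=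
  fun i j => if TorusAdj i j then 1 / (2 * (d : ℝ)) else 0

/-- `Y` is the smoothing process on the torus for simple random walk, started from unit mass at `i`
and zero mass elsewhere. -/
def IsTorusSmoothing {d n : ℕ} [NeZero n] {Ω : Type*} [MeasurableSpace Ω] (i : Torus d n)
    (P : Measure Ω) (Y : ℝ≥0 → Ω → Torus d n → ℝ) : Prop :=
  IsSmoothingProcess (srwMatrix d n) (Pi.single i 1) P Y

/-- Spatial average `n^{-d} ∑ y_i`. -/
def spatialMean {d n : ℕ} [NeZero n] (y : Torus d n → ℝ) : ℝ :=
  ((n : ℝ) ^ d)⁻¹ * ∑ i, y i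

/-- Variance functional `n^{-d} ∑ (y_i - ȳ)²`. -/
def spatialVariance {d n : ℕ} [NeZero n] (y : Torus d n → ℝ) : ℝ :=
  ((n : ℝ) ^ d)⁻¹ * ∑ i, (y i - spatialMean y) ^ 2

/-- Energy functional `(4 d n^d)⁻¹ ∑_{i ∼ j} (y_i - y_j)²`, over ordered pairs of neighbours. -/
def spatialEnergy {d n : ℕ} [NeZero n] (y : Torus d n → ℝ) : ℝ :=
  (4 * (d : ℝ) * (n : ℝ) ^ d)⁻¹ *
    ∑ i, ∑ j, if TorusAdj i j then (y i - y j) ^ 2 else 0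

/-- The equilibrium mass `Y(∞)`: the limit of the spatial average as time goes to infinity. -/
def limitMass {d n : ℕ} [NeZero n] {Ω : Type*} (Y : ℝ≥0 → Ω → Torus d n → ℝ) (ω : Ω) : ℝ :=
  limUnder atTop fun t : ℝ≥0 => spatialMean (Y t ω)

/-- Spectral gap `1 - cos (2π/n)` of simple random walk on the one-dimensional torus. -/
def gapOne (n : ℕ) : ℝ := 1 - Real.cos (2 * Real.pi / n)

/-- The representative in `{-(n-1)/2, …, (n-1)/2}^d ⊆ ℤ^d` (for odd `n`) of a torus vertex. -/
def torusRep {d n : ℕ} (j : Torus d n) : Fin d → ℤ := fun k => (j k).valMinAbs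

end

/-! Everything reduces to the mean power spectrum `a ξ t`, the expected squared modulus of the
Fourier coefficient at frequency `ξ`. A ring at `k` subtracts `(1 - p) y` at `k`, times a point
mass, from the configuration. Summing the resulting change of the squared modulus over `k` gives a
multiple `-2 λ_ξ` of the power plus the squared norm of `(1 - p) y`; by Plancherel the latter is
again a combination of powers (`sum_torusPower_ringUpdate_sub`). Hence `a' = -2 λ_ξ a + S`, `a(0) =
1`, with one source `S = n^{-d} ∑ λ² a` common to all modes: this is `IsPowerFlow`. The starting
site has disappeared, because a point mass has flat power spectrum.

Write `E = n^{-d} ∑ λ a` and `V` for the same sum of `a` over nonzero modes. The eigenvalues average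
to one, so `E' = -S`, while `a 0` has derivative `S`. The total mass is a martingale, so its squared
distance to its limit has mean exactly `E` (`integral_sum_sub_limitMass_sq`). With uncorrelated
weights of mean `m` and variance `σ²` the second moment is `σ² (V + n^{-d} E) + m² E`
(`integral_weighted_sq`), and `E ≤ 2 V`. All claims thus become bounds on `E` and `V`.

Lower bounds: discarding the source leaves `a ≥ exp(-2 λ t)`, and one counts frequencies with `λ` of
order `1/t`, or keeps a single gap frequency when `t ≥ n²` (`exists_le_spectral_sum`).

Upper bounds: variation of constants turns the system into a scalar renewal equation for `S`
(`IsPowerFlow.renewal`). Tilted by `exp(θ t)`, with `θ` below twice the gap by an amount of order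
`n^{-(d+4)}`, its kernel still has mass at most `3/4` (`tilted_kernel_mass_le`): at most `2 d`
frequencies lie near the gap, and this is where the correction to the rate comes from. The kernel is
bounded by `decayProfile`, which is comparable with itself on comparable time scales, so the
solution of the renewal equation inherits the same profile (`IsPowerFlow.tilted_source_le`). Two
integrations from infinity (`le_of_neg_deriv_le`) yield `E` and then `V`.

The probabilistic input is the forward equation `IsDrivenSmoothing.hasDerivWithinAt_integral`, which
rests on the independence of present and past values from future rings (`indepFun_ringCount`).
Almost sure convergence follows from `V → 0` and the preservation of intervals under averaging
(`ae_mem_Icc_mono`). -/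

/-! ### Ring counts of independent Poisson clocks. -/

section Clocks

variable {I Ω : Type*}

/-- The numbers of rings of all clocks during the interval `(s, t]`. -/
def ringCount (N : I → ℝ≥0 → Ω → ℕ) (s t : ℝ≥0) (ω : Ω) : I → ℕ :=
  fun k => N k t ω - N k s ω

/-- The events up to the `L`-th point of a partition. -/
@[reducible]
def ringPast (N : I → ℝ≥0 → Ω → ℕ) (τ : ℕ → ℝ≥0) (L : ℕ) : MeasurableSpace Ω :=
  ⨆ p ∈ {p : I × ℕ | p.2 < L},
    MeasurableSpace.comap (fun ω => ringCount N (τ p.2) (τ (p.2 + 1)) ω p.1) inferInstance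

lemma ringPast_mono (N : I → ℝ≥0 → Ω → ℕ) (τ : ℕ → ℝ≥0) : Monotone (ringPast N τ) :=
  fun _ _ h => biSup_mono fun _ hp => lt_of_lt_of_le hp h

lemma measurable_ringCount_ringPast (N : I → ℝ≥0 → Ω → ℕ) (τ : ℕ → ℝ≥0) (j : ℕ) :
    Measurable[ringPast N τ (j + 1)] (ringCount N (τ j) (τ (j + 1))) := by
  refine @measurable_pi_lambda _ _ _ (ringPast N τ (j + 1)) _ _ fun k => ?_
  refine Measurable.mono (comap_measurable _) ?_ le_rfl
  exact le_biSup (fun p : I × ℕ =>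
    MeasurableSpace.comap (fun ω => ringCount N (τ p.2) (τ (p.2 + 1)) ω p.1) inferInstance)
    (show (k, j) ∈ {p : I × ℕ | p.2 < j + 1} from Nat.lt_succ_self j)

variable [MeasurableSpace Ω] {P : Measure Ω} {N : I → ℝ≥0 → Ω → ℕ}

lemma measurable_ringCount (hN : ∀ k, IsUnitPoissonProcess (N k) P) (s t : ℝ≥0) :
    Measurable (ringCount N s t) :=
  measurable_pi_lambda _ fun k => ((hN k).measurable t).sub ((hN k).measurable s)

lemma iIndepFun_ringCount_partition (hN : ∀ k, IsUnitPoissonProcess (N k) P)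
    (hI : iIndepFun (fun k ω => fun t => N k t ω) P) {τ : ℕ → ℝ≥0} (hτ : Monotone τ) :
    iIndepFun (fun (p : I × ℕ) ω => ringCount N (τ p.2) (τ (p.2 + 1)) ω p.1) P := by
  refine iIndepFun_uncurry' (X := fun k j ω => N k (τ (j + 1)) ω - N k (τ j) ω)
    (fun k j => ((hN k).measurable _).sub ((hN k).measurable _)) ?_
    fun k => (hN k).indepIncrements.nat hτ
  exact hI.comp (fun _ path j => path (τ (j + 1)) - path (τ j)) fun _ => by fun_prop

lemma iIndepFun_ringCount (hI : iIndepFun (fun k ω => fun t => N k t ω) P) (s t : ℝ≥0) :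
    iIndepFun (fun k ω => ringCount N s t ω k) P :=
  hI.comp (fun _ path => path t - path s) fun _ => by fun_prop

/-- The array of counts, indexed by clock and cell, is jointly independent; the past and the next
cell use disjoint sets of indices. -/
lemma indep_ringPast (hN : ∀ k, IsUnitPoissonProcess (N k) P)
    (hI : iIndepFun (fun k ω => fun t => N k t ω) P) {τ : ℕ → ℝ≥0} (hτ : Monotone τ) (L : ℕ) :
    Indep (ringPast N τ L)
      (MeasurableSpace.comap (ringCount N (τ L) (τ (L + 1))) inferInstance) P := by
  have h := indep_iSup_of_disjoint (S := {p : I × ℕ | p.2 < L}) (T := {p : I × ℕ | p.2 = L})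
    (fun p => Measurable.comap_le (measurable_pi_iff.1 (measurable_ringCount hN _ _) p.1))
    (iIndepFun_ringCount_partition hN hI hτ).iIndep
    (Set.disjoint_left.2 fun p (h1 : p.2 < L) (h2 : p.2 = L) => by omega)
  refine indep_of_indep_of_le_right h ?_
  rw [← measurable_iff_comap_le]
  refine @measurable_pi_lambda _ _ _ (_) _ _ fun k => ?_
  refine Measurable.mono (comap_measurable _) ?_ le_rfl
  exact le_biSup (fun p : I × ℕ =>
    MeasurableSpace.comap (fun ω => ringCount N (τ p.2) (τ (p.2 + 1)) ω p.1) inferInstance)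
    (show (k, L) ∈ {p : I × ℕ | p.2 = L} from rfl)

variable [Fintype I]

lemma measureReal_ringCount_eq (hN : ∀ k, IsUnitPoissonProcess (N k) P)
    (hI : iIndepFun (fun k ω => fun t => N k t ω) P) {s t : ℝ≥0} (hst : s ≤ t) (x : I → ℕ) :
    P.real {ω | ringCount N s t ω = x} =
      ∏ k, (Real.exp (-(t - s : ℝ≥0)) * ((t - s : ℝ≥0) : ℝ) ^ x k / (x k).factorial) := by
  have h1 : {ω | ringCount N s t ω = x} = ⋂ k, {ω | ringCount N s t ω k = x k} := by
    ext ω; simp [funext_iff]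
  have h2 : P (⋂ k, {ω | ringCount N s t ω k = x k})
      = ∏ k, P {ω | ringCount N s t ω k = x k} :=
    (iIndepFun_ringCount hI s t).meas_iInter fun k => ⟨{x k}, by simp, rfl⟩
  rw [h1, measureReal_def, h2, ENNReal.toReal_prod]
  refine Finset.prod_congr rfl fun k _ => ?_
  rw [← measureReal_def]
  have h3 := ((hN k).increments s t hst).measureReal_eq (p := fun m => m = x k) (by measurability)
  have h4 : {m | m = x k} = {x k} := rfl
  rw [h4, poissonMeasure_real_singleton] at h3
  exact h3

lemma measureReal_ringCount_eq_zero (hN : ∀ k, IsUnitPoissonProcess (N k) P)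
    (hI : iIndepFun (fun k ω => fun t => N k t ω) P) {s t : ℝ≥0} (hst : s ≤ t) :
    P.real {ω | ringCount N s t ω = 0} = Real.exp (-(Fintype.card I * (t - s : ℝ≥0))) := by
  rw [measureReal_ringCount_eq hN hI hst, ← mul_neg, Real.exp_nat_mul]
  simp

lemma measureReal_ringCount_eq_single [DecidableEq I] (hN : ∀ k, IsUnitPoissonProcess (N k) P)
    (hI : iIndepFun (fun k ω => fun t => N k t ω) P) {s t : ℝ≥0} (hst : s ≤ t) (k : I) :
    P.real {ω | ringCount N s t ω = Pi.single k 1} =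
      (t - s : ℝ≥0) * Real.exp (-(Fintype.card I * (t - s : ℝ≥0))) := by
  rw [measureReal_ringCount_eq hN hI hst, ← mul_neg, Real.exp_nat_mul]
  have h : ∀ j, Real.exp (-(t - s : ℝ≥0)) * ((t - s : ℝ≥0) : ℝ) ^ (Pi.single k 1 : I → ℕ) j /
      ((Pi.single k 1 : I → ℕ) j).factorial =
      Real.exp (-(t - s : ℝ≥0)) * if j = k then ((t - s : ℝ≥0) : ℝ) else 1 := by
    intro j
    by_cases hj : j = k
    · subst hj; simp
    · simp [hj]
  simp_rw [h, Finset.prod_mul_distrib]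
  simp [mul_comm]

lemma sum_le_one_iff [DecidableEq I] (x : I → ℕ) :
    ∑ k, x k ≤ 1 ↔ x = 0 ∨ ∃ k, x = Pi.single k 1 := by
  constructor
  · intro h
    by_cases h0 : x = 0
    · exact Or.inl h0
    · right
      obtain ⟨k, hk⟩ := Function.ne_iff.1 h0
      simp only [Pi.zero_apply] at hk
      refine ⟨k, funext fun j => ?_⟩
      rw [← Finset.add_sum_erase _ _ (Finset.mem_univ k)] at h
      by_cases hj : j = k
      · subst hj; simp; omega
      · have := Finset.single_le_sum (f := x) (fun _ _ => Nat.zero_le _)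
          (Finset.mem_erase.2 ⟨hj, Finset.mem_univ j⟩)
        simp [hj]; omega
  · rintro (rfl | ⟨k, rfl⟩) <;> simp

lemma measurableSet_ringCount_mem (hN : ∀ k, IsUnitPoissonProcess (N k) P) (s t : ℝ≥0)
    (S : Set (I → ℕ)) : MeasurableSet {ω | ringCount N s t ω ∈ S} :=
  measurable_ringCount hN s t (Set.to_countable S).measurableSet

/-- Two or more rings in a short interval are unlikely. -/
lemma measureReal_one_lt_sum_ringCount_le [IsProbabilityMeasure P]
    (hN : ∀ k, IsUnitPoissonProcess (N k) P)
    (hI : iIndepFun (fun k ω => fun t => N k t ω) P) {s t : ℝ≥0} (hst : s ≤ t) :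
    P.real {ω | 1 < ∑ k, ringCount N s t ω k} ≤ (Fintype.card I * (t - s : ℝ≥0)) ^ 2 := by
  classical
  set x : ℝ := Fintype.card I * (t - s : ℝ≥0) with hx
  have hx0 : 0 ≤ x := by positivity
  have hmeas : MeasurableSet {ω | 1 < ∑ k, ringCount N s t ω k} :=
    measurableSet_ringCount_mem hN s t {y | 1 < ∑ k, y k}
  have hcompl : P.real {ω | 1 < ∑ k, ringCount N s t ω k}ᶜ = Real.exp (-x) + x * Real.exp (-x) := by
    have hset : {ω | 1 < ∑ k, ringCount N s t ω k}ᶜ =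
        {ω | ringCount N s t ω = 0} ∪ ⋃ k, {ω | ringCount N s t ω = Pi.single k 1} := by
      ext ω; simp [sum_le_one_iff]
    rw [hset, measureReal_union, measureReal_iUnion_fintype, measureReal_ringCount_eq_zero hN hI hst]
    · simp_rw [measureReal_ringCount_eq_single hN hI hst]
      simp [hx, mul_assoc]
    · intro k l hkl
      refine Set.disjoint_left.2 fun ω h1 h2 => hkl ?_
      simp only [Set.mem_ofPred_eq] at h1 h2
      have := congrFun (h1.symm.trans h2) k
      by_contra hne
      simp [hne] at this
    · exact fun k => measurableSet_ringCount_mem hN s t {Pi.single k 1}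
    · refine Set.disjoint_left.2 fun ω h1 h2 => ?_
      obtain ⟨k, hk⟩ := Set.mem_iUnion.1 h2
      simp only [Set.mem_ofPred_eq] at h1 hk
      have := congrFun (h1.symm.trans hk) k
      simp at this
    · exact MeasurableSet.iUnion fun k => measurableSet_ringCount_mem hN s t {Pi.single k 1}
  have h1 := probReal_compl_eq_one_sub (μ := P) hmeas
  -- The probability is `1 - (1 + x) exp (-x)`, and `exp (-x) ≥ 1 - x` bounds it by `1 - (1 + x)(1 -
  -- x) = x²`.
  have h2 := Real.add_one_le_exp (-x)
  nlinarith

end Clocks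

/-! ### The dynamics as a function of the ring counts of a partition. -/

section Discretization

variable {I : Type*} [Fintype I] [DecidableEq I]

/-- The configuration after a ring at `k`. -/
def ringUpdate (p : Matrix I I ℝ) (k : I) (y : I → ℝ) : I → ℝ :=
  Function.update y k (∑ j, p k j * y j)

lemma measurable_ringUpdate (p : Matrix I I ℝ) (k : I) : Measurable (ringUpdate p k) := by
  refine measurable_pi_lambda _ fun j => ?_
  by_cases h : j = k
  · subst h; simp only [ringUpdate, Function.update_self]; fun_prop
  · simp only [ringUpdate, Function.update_of_ne h]; fun_prop

open Classical in
/-- The configuration after an interval with ring counts `x`, provided that at most one clock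
rang. -/
noncomputable def ringStep (p : Matrix I I ℝ) (x : I → ℕ) (y : I → ℝ) : I → ℝ :=
  if h : ∃ k, x = Pi.single k 1 then ringUpdate p h.choose y else y

lemma ringStep_zero (p : Matrix I I ℝ) (y : I → ℝ) : ringStep p 0 y = y := by
  refine dif_neg ?_
  rintro ⟨k, hk⟩
  simpa using congrFun hk k

lemma ringStep_single (p : Matrix I I ℝ) (k : I) (y : I → ℝ) :
    ringStep p (Pi.single k 1) y = ringUpdate p k y := by
  have h : ∃ l, (Pi.single k 1 : I → ℕ) = Pi.single l 1 := ⟨k, rfl⟩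
  have hk : h.choose = k := by
    by_contra hne
    have := congrFun h.choose_spec k
    simp [Ne.symm hne] at this
  rw [ringStep, dif_pos h, hk]

lemma measurable_ringStep (p : Matrix I I ℝ) :
    Measurable fun z : (I → ℕ) × (I → ℝ) => ringStep p z.1 z.2 := by
  refine measurable_from_prod_countable_right fun x => ?_
  by_cases h : ∃ k, x = Pi.single k 1
  · obtain ⟨k, rfl⟩ := h
    simpa only [ringStep_single] using measurable_ringUpdate p k
  · simpa only [ringStep, dif_neg h] using measurable_id'

variable {Ω : Type*}

/-- The smoothing dynamics along a partition, ignoring intervals with several rings. -/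
noncomputable def discretePath (p : Matrix I I ℝ) (y₀ : I → ℝ) (N : I → ℝ≥0 → Ω → ℕ) (τ : ℕ → ℝ≥0) :
    ℕ → Ω → I → ℝ
  | 0, _ => y₀
  | j + 1, ω => ringStep p (ringCount N (τ j) (τ (j + 1)) ω) (discretePath p y₀ N τ j ω)

/-- Adaptedness. The process itself is only specified by rules on its paths, so independence from
later rings is first obtained for this substitute. -/
lemma measurable_discretePath (p : Matrix I I ℝ) (y₀ : I → ℝ) (N : I → ℝ≥0 → Ω → ℕ)
    (τ : ℕ → ℝ≥0) (j : ℕ) : Measurable[ringPast N τ j] (discretePath p y₀ N τ j) := by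
  induction j with
  | zero => exact @measurable_const _ _ _ (_) _
  | succ j ih =>
    let : MeasurableSpace Ω := ringPast N τ (j + 1)
    exact (measurable_ringStep p).comp ((measurable_ringCount_ringPast N τ j).prodMk
      (ih.mono (ringPast_mono N τ (Nat.le_succ j)) le_rfl))

lemma IsSmoothingPath.eq_ringStep {p : Matrix I I ℝ} {N : I → ℝ≥0 → Ω → ℕ} {ω : Ω}
    {y : ℝ≥0 → I → ℝ} (hy : IsSmoothingPath p (fun k t => N k t ω) y)
    (hmono : ∀ k, Monotone fun t => N k t ω) {s t : ℝ≥0} (hst : s ≤ t)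
    (hgood : ∑ k, ringCount N s t ω k ≤ 1) :
    y t = ringStep p (ringCount N s t ω) (y s) := by
  rcases (sum_le_one_iff _).1 hgood with h | ⟨k, hk⟩
  · rw [h, ringStep_zero]
    refine hy.const s t hst fun k => ?_
    have h1 : N k t ω - N k s ω = 0 := congrFun h k
    have h2 : N k s ω ≤ N k t ω := hmono k hst
    show N k t ω = N k s ω
    omega
  · rw [hk, ringStep_single]
    refine hy.ring s t k hst ?_ fun j hj => ?_
    · have h1 : N k t ω - N k s ω = (Pi.single k 1 : I → ℕ) k := congrFun hk k
      have h2 : N k s ω ≤ N k t ω := hmono k hst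
      simp only [Pi.single_eq_same] at h1
      show N k t ω = N k s ω + 1
      omega
    · have h1 : N j t ω - N j s ω = (Pi.single k 1 : I → ℕ) j := congrFun hk j
      have h2 : N j s ω ≤ N j t ω := hmono j hst
      simp only [Pi.single_eq_of_ne hj] at h1
      show N j t ω = N j s ω
      omega

/-- When no cell contains several rings, the two path rules apply cell by cell and the
discretization makes no error. -/
lemma IsSmoothingPath.eq_discretePath {p : Matrix I I ℝ} {N : I → ℝ≥0 → Ω → ℕ} {ω : Ω}
    {y : ℝ≥0 → I → ℝ} (hy : IsSmoothingPath p (fun k t => N k t ω) y)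
    (hmono : ∀ k, Monotone fun t => N k t ω) {y₀ : I → ℝ} (h0 : y 0 = y₀) {τ : ℕ → ℝ≥0}
    (hτ : Monotone τ) (hτ0 : τ 0 = 0) {j : ℕ}
    (hgood : ∀ i < j, ∑ k, ringCount N (τ i) (τ (i + 1)) ω k ≤ 1) :
    y (τ j) = discretePath p y₀ N τ j ω := by
  induction j with
  | zero => rw [hτ0, h0, discretePath]
  | succ j ih =>
    rw [discretePath, ← ih fun i hi => hgood i (by omega)]
    exact hy.eq_ringStep hmono (hτ (Nat.le_succ j)) (hgood j (Nat.lt_succ_self j))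

end Discretization

/-! ### Independence in the limit of vanishing error probability. -/

section ApproximateIndependence

variable {Ω β γ : Type*} [MeasurableSpace Ω] [MeasurableSpace β] [MeasurableSpace γ]
  {P : Measure Ω} [IsProbabilityMeasure P]

/-- Independence passes to random variables that can be approximated, up to events of small
probability, by independent ones. -/
lemma indepFun_of_approx {W : Ω → β} {X : Ω → γ}
    (h : ∀ ε : ℝ, 0 < ε → ∃ Z : Ω → β, IndepFun Z X P ∧ P.real {ω | W ω ≠ Z ω} ≤ ε) :
    IndepFun W X P := by
  rw [indepFun_iff_measure_inter_preimage_eq_mul]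
  intro A B hA hB
  have key : P.real (W ⁻¹' A ∩ X ⁻¹' B) = P.real (W ⁻¹' A) * P.real (X ⁻¹' B) := by
    refine eq_of_abs_sub_le_all fun ε hε => ?_
    -- One half of `ε` pays for the joint event, the other for the product: there only the first
    -- factor changes, and the second is at most one.
    obtain ⟨Z, hZ, hε'⟩ := h (ε / 2) (by positivity)
    have hprod : P.real (Z ⁻¹' A ∩ X ⁻¹' B) = P.real (Z ⁻¹' A) * P.real (X ⁻¹' B) := by
      rw [measureReal_def, indepFun_iff_measure_inter_preimage_eq_mul.1 hZ A B hA hB,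
        ENNReal.toReal_mul]; rfl
    have hle : ∀ {S T : Set Ω}, S ⊆ T ∪ {ω | W ω ≠ Z ω} → P.real S ≤ P.real T + ε / 2 :=
      fun hST => (measureReal_mono hST).trans ((measureReal_union_le _ _).trans (by linarith))
    have h1 : P.real (W ⁻¹' A ∩ X ⁻¹' B) ≤ P.real (Z ⁻¹' A ∩ X ⁻¹' B) + ε / 2 := hle fun ω hω => by
      by_cases hWZ : W ω = Z ω
      · exact Or.inl ⟨by simpa [← hWZ] using hω.1, hω.2⟩
      · exact Or.inr hWZ
    have h2 : P.real (Z ⁻¹' A ∩ X ⁻¹' B) ≤ P.real (W ⁻¹' A ∩ X ⁻¹' B) + ε / 2 := hle fun ω hω => by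
      by_cases hWZ : W ω = Z ω
      · exact Or.inl ⟨by simpa [hWZ] using hω.1, hω.2⟩
      · exact Or.inr hWZ
    have h3 : P.real (W ⁻¹' A) ≤ P.real (Z ⁻¹' A) + ε / 2 := hle fun ω hω => by
      by_cases hWZ : W ω = Z ω
      · exact Or.inl (by simpa [← hWZ] using hω)
      · exact Or.inr hWZ
    have h4 : P.real (Z ⁻¹' A) ≤ P.real (W ⁻¹' A) + ε / 2 := hle fun ω hω => by
      by_cases hWZ : W ω = Z ω
      · exact Or.inl (by simpa [hWZ] using hω)
      · exact Or.inr hWZ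
    have h5 : 0 ≤ P.real (X ⁻¹' B) := measureReal_nonneg
    have h6 : P.real (X ⁻¹' B) ≤ 1 := measureReal_le_one
    rw [abs_le]
    constructor <;> nlinarith
  rw [measureReal_def, measureReal_def, measureReal_def, ← ENNReal.toReal_mul] at key
  exact (ENNReal.toReal_eq_toReal_iff' (by finiteness) (by finiteness)).1 key

end ApproximateIndependence

/-! ### The driven process: independence of future rings and preservation of intervals. -/

section Driven

variable {I Ω : Type*} [Fintype I] [DecidableEq I] [MeasurableSpace Ω]

/-- A process with smoothing dynamics driven by the independent Poisson clocks `N`. -/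
structure IsDrivenSmoothing (p : Matrix I I ℝ) (y₀ : I → ℝ) (P : Measure Ω)
    (N : I → ℝ≥0 → Ω → ℕ) (Y : ℝ≥0 → Ω → I → ℝ) : Prop where
  measurable : ∀ t, Measurable (Y t)
  initial : ∀ᵐ ω ∂P, Y 0 ω = y₀
  clocks : ∀ k, IsUnitPoissonProcess (N k) P
  indep : iIndepFun (fun k ω => fun t => N k t ω) P
  path : ∀ᵐ ω ∂P, IsSmoothingPath p (fun k t => N k t ω) (fun t => Y t ω)

variable {p : Matrix I I ℝ} {y₀ : I → ℝ} {P : Measure Ω} {N : I → ℝ≥0 → Ω → ℕ}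
  {Y : ℝ≥0 → Ω → I → ℝ}

lemma IsSmoothingProcess.exists_driven (h : IsSmoothingProcess p y₀ P Y) :
    ∃ N, IsDrivenSmoothing p y₀ P N Y := by
  obtain ⟨N, h1, h2, h3⟩ := h.dynamics
  exact ⟨N, h.measurable, h.initial, h1, h2, h3⟩

namespace IsDrivenSmoothing

lemma clock_mono (h : IsDrivenSmoothing p y₀ P N Y) :
    ∀ᵐ ω ∂P, ∀ k, Monotone fun t => N k t ω :=
  ae_all_iff.2 fun k => (h.clocks k).mono

variable [IsProbabilityMeasure P]

lemma measureReal_exists_multiple_le (h : IsDrivenSmoothing p y₀ P N Y) {τ : ℕ → ℝ≥0}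
    (hτ : Monotone τ) (L : ℕ) :
    P.real {ω | ∃ j < L, 1 < ∑ k, ringCount N (τ j) (τ (j + 1)) ω k} ≤
      ∑ j ∈ Finset.range L, ((Fintype.card I : ℝ) * (τ (j + 1) - τ j : ℝ≥0)) ^ 2 := by
  have hset : {ω | ∃ j < L, 1 < ∑ k, ringCount N (τ j) (τ (j + 1)) ω k} =
      ⋃ j ∈ Finset.range L, {ω | 1 < ∑ k, ringCount N (τ j) (τ (j + 1)) ω k} := by
    ext ω; simp
  rw [hset]
  exact (measureReal_biUnion_finset_le _ _).trans (Finset.sum_le_sum fun j _ =>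
    measureReal_one_lt_sum_ringCount_le h.clocks h.indep (hτ (Nat.le_succ j)))

/-- A partition through `0`, `s` (at index `m`), `t` (at index `2m`) and `u` (at index `2m+1`). -/
noncomputable def partition (s t u : ℝ≥0) (m j : ℕ) : ℝ≥0 :=
  -- Truncated subtraction keeps the second summand at zero up to index `m`. The last cell, from
  -- index `2m` to `2m + 1`, is all of `(t, u]`, left unrefined.
  (s * (min j m : ℕ) + (t - s) * (min (j - m) m : ℕ)) / m + if j ≤ 2 * m then 0 else u - t

omit [Fintype I] [DecidableEq I] [MeasurableSpace Ω] [IsProbabilityMeasure P] in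
lemma partition_mono (s t u : ℝ≥0) (m : ℕ) : Monotone (partition s t u m) := by
  intro i j hij
  unfold partition
  have h1 : ((min i m : ℕ) : ℝ≥0) ≤ (min j m : ℕ) := by exact_mod_cast min_le_min_right m hij
  have h2 : ((min (i - m) m : ℕ) : ℝ≥0) ≤ (min (j - m) m : ℕ) := by
    exact_mod_cast min_le_min_right m (by omega)
  have h3 : (if i ≤ 2 * m then 0 else u - t) ≤ if j ≤ 2 * m then 0 else u - t := by
    split_ifs
    · rfl
    · exact zero_le
    · omega
    · rfl
  gcongr

omit [Fintype I] [DecidableEq I] [MeasurableSpace Ω] [IsProbabilityMeasure P] in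
lemma partition_left {s t u : ℝ≥0} {m : ℕ} (hm : 0 < m) : partition s t u m m = s := by
  have : m ≤ 2 * m := by omega
  simp [partition, this, hm.ne']

omit [Fintype I] [DecidableEq I] [MeasurableSpace Ω] [IsProbabilityMeasure P] in
lemma partition_middle {s t u : ℝ≥0} (hst : s ≤ t) {m : ℕ} (hm : 0 < m) :
    partition s t u m (2 * m) = t := by
  have h1 : min (2 * m) m = m := by omega
  have h2 : min (2 * m - m) m = m := by omega
  have hm' : (m : ℝ≥0) ≠ 0 := by exact_mod_cast hm.ne'
  rw [partition, h1, h2, ← add_mul, mul_div_assoc, div_self hm', if_pos le_rfl]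
  simp [add_tsub_cancel_of_le hst]

omit [Fintype I] [DecidableEq I] [MeasurableSpace Ω] [IsProbabilityMeasure P] in
lemma partition_right {s t u : ℝ≥0} (hst : s ≤ t) (htu : t ≤ u) {m : ℕ} (hm : 0 < m) :
    partition s t u m (2 * m + 1) = u := by
  have h1 : min (2 * m + 1) m = m := by omega
  have h2 : min (2 * m + 1 - m) m = m := by omega
  have hm' : (m : ℝ≥0) ≠ 0 := by exact_mod_cast hm.ne'
  rw [partition, h1, h2, ← add_mul, mul_div_assoc, div_self hm', if_neg (by omega)]
  simp [add_tsub_cancel_of_le hst, add_tsub_cancel_of_le htu]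

omit [Fintype I] [DecidableEq I] [MeasurableSpace Ω] [IsProbabilityMeasure P] in
-- Both minima are allowed to grow by one in the same step, which costs at most `s + (t - s) = t`
-- before division by `m`.
lemma partition_sub_le {s t u : ℝ≥0} (hst : s ≤ t) {m j : ℕ} (hj : j < 2 * m) :
    ((partition s t u m (j + 1) - partition s t u m j : ℝ≥0) : ℝ) ≤ t / m := by
  have hm : (0 : ℝ) < m := by exact_mod_cast (by omega : 0 < m)
  have h1 : ((min (j + 1) m : ℕ) : ℝ) ≤ (min j m : ℕ) + 1 := by
    exact_mod_cast (by omega : min (j + 1) m ≤ min j m + 1)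
  have h2 : ((min (j + 1 - m) m : ℕ) : ℝ) ≤ (min (j - m) m : ℕ) + 1 := by
    exact_mod_cast (by omega : min (j + 1 - m) m ≤ min (j - m) m + 1)
  rw [NNReal.coe_sub (partition_mono s t u m (Nat.le_succ j)), partition, partition,
    if_pos (by omega), if_pos (by omega)]
  have hst' : (s : ℝ) ≤ t := hst
  have hs0 : (0 : ℝ) ≤ s := s.2
  rw [NNReal.coe_add, NNReal.coe_add, NNReal.coe_div, NNReal.coe_div, NNReal.coe_add,
    NNReal.coe_add, NNReal.coe_mul, NNReal.coe_mul, NNReal.coe_mul, NNReal.coe_mul,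
    NNReal.coe_sub hst]
  simp only [NNReal.coe_natCast, NNReal.coe_zero, add_zero]
  rw [← sub_div]
  gcongr
  nlinarith

/-- The present and past values are independent of the future rings. -/
theorem indepFun_ringCount (h : IsDrivenSmoothing p y₀ P N Y) {s t u : ℝ≥0} (hst : s ≤ t)
    (htu : t ≤ u) : IndepFun (fun ω => (Y s ω, Y t ω)) (ringCount N t u) P := by
  refine indepFun_of_approx fun ε hε => ?_
  -- Each of the `2m` cells up to time `t` has several rings with probability at most `(card I * t /
  -- m)²`; this choice of `m` makes the sum at most `ε`.
  obtain ⟨m, hm⟩ := exists_nat_gt (max 1 (2 * ((Fintype.card I : ℝ) * t) ^ 2 / ε))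
  have hm1 : (1 : ℝ) < m := lt_of_le_of_lt (le_max_left _ _) hm
  have hm2 : 2 * ((Fintype.card I : ℝ) * t) ^ 2 / ε < m := lt_of_le_of_lt (le_max_right _ _) hm
  have hm0 : 0 < m := by exact_mod_cast one_pos.trans hm1
  have hm0' : (0 : ℝ) < m := by exact_mod_cast hm0
  set τ := partition s t u m with hτdef
  have hτ : Monotone τ := partition_mono s t u m
  have hτ0 : τ 0 = 0 := by simp [hτdef, partition]
  have hτs : τ m = s := partition_left hm0
  have hτt : τ (2 * m) = t := partition_middle hst hm0
  have hτu : τ (2 * m + 1) = u := partition_right hst htu hm0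
  refine ⟨fun ω => (discretePath p y₀ N τ m ω, discretePath p y₀ N τ (2 * m) ω), ?_, ?_⟩
  · have hind := indep_ringPast h.clocks h.indep hτ (2 * m)
    rw [hτt, hτu] at hind
    refine indep_of_indep_of_le_left hind ?_
    rw [← measurable_iff_comap_le]
    exact Measurable.prodMk ((measurable_discretePath p y₀ N τ m).mono
      (ringPast_mono N τ (show m ≤ 2 * m by omega)) le_rfl)
      (measurable_discretePath p y₀ N τ (2 * m))
  · have hle : P.real {ω | (Y s ω, Y t ω) ≠
        (discretePath p y₀ N τ m ω, discretePath p y₀ N τ (2 * m) ω)} ≤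
        P.real {ω | ∃ j < 2 * m, 1 < ∑ k, ringCount N (τ j) (τ (j + 1)) ω k} := by
      refine ENNReal.toReal_mono (by finiteness) (measure_mono_ae ?_)
      filter_upwards [h.path, h.clock_mono, h.initial] with ω hp hmono h0 hne
      by_contra hgood
      have hgood' : ∀ j < 2 * m, ∑ k, ringCount N (τ j) (τ (j + 1)) ω k ≤ 1 := by
        intro j hj
        by_contra hlt
        exact hgood ⟨j, hj, not_le.1 hlt⟩
      refine hne ?_
      have h1 := hp.eq_discretePath hmono h0 hτ hτ0 (j := m) fun i hi => hgood' i (by omega)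
      have h2 := hp.eq_discretePath hmono h0 hτ hτ0 (j := 2 * m) hgood'
      rw [hτs] at h1
      rw [hτt] at h2
      rw [h1, h2]
    refine hle.trans ((h.measureReal_exists_multiple_le hτ (2 * m)).trans ?_)
    have hterm : ∀ j ∈ Finset.range (2 * m),
        ((Fintype.card I : ℝ) * (τ (j + 1) - τ j : ℝ≥0)) ^ 2 ≤
          ((Fintype.card I : ℝ) * (t / m)) ^ 2 := fun j hj => by
      have := partition_sub_le (u := u) hst (Finset.mem_range.1 hj)
      gcongr
    refine (Finset.sum_le_sum hterm).trans ?_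
    rw [Finset.sum_const, Finset.card_range, nsmul_eq_mul]
    rw [div_lt_iff₀ hε] at hm2
    have : ((2 * m : ℕ) : ℝ) * ((Fintype.card I : ℝ) * (t / m)) ^ 2 =
        2 * ((Fintype.card I : ℝ) * t) ^ 2 / m := by
      push_cast; field_simp
    rw [this, div_le_iff₀ hm0']
    linarith

/-- For fixed `T` the exceptional event forces the uniform partition into `m` cells to fail for
every positive `m`, and that failure has probability at most `(card I * T)² / m`. -/
lemma ae_exists_fine_partition (h : IsDrivenSmoothing p y₀ P N Y) :
    ∀ᵐ ω ∂P, ∀ T : ℕ, ∃ m : ℕ, 0 < m ∧ ∀ j < m, ∑ k, ringCount N ((T : ℝ≥0) * j / m)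
      ((T : ℝ≥0) * (j + 1 : ℕ) / m) ω k ≤ 1 := by
  refine ae_all_iff.2 fun T => ?_
  rw [ae_iff]
  have hreal : P.real {ω | ¬ ∃ m : ℕ, 0 < m ∧ ∀ j < m, ∑ k, ringCount N ((T : ℝ≥0) * j / m)
      ((T : ℝ≥0) * (j + 1 : ℕ) / m) ω k ≤ 1} ≤ 0 := by
    refine le_of_forall_pos_le_add fun ε hε => ?_
    rw [zero_add]
    obtain ⟨m, hm⟩ := exists_nat_gt (max 1 (((Fintype.card I : ℝ) * T) ^ 2 / ε))
    have hm1 : (1 : ℝ) < m := lt_of_le_of_lt (le_max_left _ _) hm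
    have hm2 : ((Fintype.card I : ℝ) * T) ^ 2 / ε < m := lt_of_le_of_lt (le_max_right _ _) hm
    have hm0' : (0 : ℝ) < m := one_pos.trans hm1
    have hm0 : 0 < m := by exact_mod_cast hm0'
    have hτ : Monotone fun j : ℕ => (T : ℝ≥0) * j / m := fun i j hij => by
      have : (i : ℝ≥0) ≤ j := by exact_mod_cast hij
      show (T : ℝ≥0) * i / m ≤ (T : ℝ≥0) * j / m
      gcongr
    refine le_trans (measureReal_mono ?_) ((h.measureReal_exists_multiple_le hτ m).trans ?_)
    · intro ω hω
      by_contra hgood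
      refine hω ⟨m, hm0, fun j hj => ?_⟩
      by_contra hlt
      exact hgood ⟨j, hj, not_le.1 hlt⟩
    · have hterm : ∀ j ∈ Finset.range m, ((Fintype.card I : ℝ) *
          ((T : ℝ≥0) * (j + 1 : ℕ) / m - (T : ℝ≥0) * j / m : ℝ≥0)) ^ 2 =
          ((Fintype.card I : ℝ) * (T / m)) ^ 2 := fun j _ => by
        rw [NNReal.coe_sub (hτ (Nat.le_succ j))]
        push_cast
        ring
      rw [Finset.sum_congr rfl hterm, Finset.sum_const, Finset.card_range, nsmul_eq_mul]
      rw [div_lt_iff₀ hε] at hm2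
      have : (m : ℝ) * ((Fintype.card I : ℝ) * (T / m)) ^ 2 =
          ((Fintype.card I : ℝ) * T) ^ 2 / m := by
        field_simp
      rw [this, div_le_iff₀ hm0']
      linarith
  exact (measureReal_eq_zero_iff (by finiteness)).1 (le_antisymm hreal measureReal_nonneg)

omit [MeasurableSpace Ω] [IsProbabilityMeasure P] in
lemma ringUpdate_mem_Icc (hp0 : ∀ i j, 0 ≤ p i j) (hp1 : ∀ i, ∑ j, p i j = 1) {c₁ c₂ : ℝ}
    {y : I → ℝ} (hy : ∀ j, y j ∈ Set.Icc c₁ c₂) (k j : I) :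
    ringUpdate p k y j ∈ Set.Icc c₁ c₂ := by
  by_cases hj : j = k
  · subst hj
    rw [ringUpdate, Function.update_self]
    constructor
    · calc c₁ = ∑ i, p j i * c₁ := by rw [← Finset.sum_mul, hp1, one_mul]
        _ ≤ _ := Finset.sum_le_sum fun i _ => mul_le_mul_of_nonneg_left (hy i).1 (hp0 j i)
    · calc ∑ i, p j i * y i ≤ ∑ i, p j i * c₂ :=
            Finset.sum_le_sum fun i _ => mul_le_mul_of_nonneg_left (hy i).2 (hp0 j i)
        _ = c₂ := by rw [← Finset.sum_mul, hp1, one_mul]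
  · rw [ringUpdate, Function.update_of_ne hj]
    exact hy j

omit [MeasurableSpace Ω] [IsProbabilityMeasure P] in
lemma ringStep_mem_Icc (hp0 : ∀ i j, 0 ≤ p i j) (hp1 : ∀ i, ∑ j, p i j = 1) {c₁ c₂ : ℝ}
    {y : I → ℝ} (hy : ∀ j, y j ∈ Set.Icc c₁ c₂) (x : I → ℕ) (j : I) :
    ringStep p x y j ∈ Set.Icc c₁ c₂ := by
  unfold ringStep
  split_ifs
  · exact ringUpdate_mem_Icc hp0 hp1 hy _ _
  · exact hy j

/-- Almost surely, intervals containing all values are preserved by the dynamics. -/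
theorem ae_mem_Icc_mono (h : IsDrivenSmoothing p y₀ P N Y) (hp0 : ∀ i j, 0 ≤ p i j)
    (hp1 : ∀ i, ∑ j, p i j = 1) :
    ∀ᵐ ω ∂P, ∀ s t, s ≤ t → ∀ c₁ c₂, (∀ j, Y s ω j ∈ Set.Icc c₁ c₂) →
      ∀ j, Y t ω j ∈ Set.Icc c₁ c₂ := by
  filter_upwards [h.path, h.clock_mono, h.ae_exists_fine_partition] with ω hp hmono hfine s t hst
  -- Subintervals of a cell inherit the bound on the number of rings, so `s` and `t` need not be
  -- partition points. One null set therefore serves all pairs of times.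
  have hstep : ∀ a b s t, a ≤ s → s ≤ t → t ≤ b → ∑ k, ringCount N a b ω k ≤ 1 →
      ∀ c₁ c₂, (∀ j, Y s ω j ∈ Set.Icc c₁ c₂) → ∀ j, Y t ω j ∈ Set.Icc c₁ c₂ := by
    intro a b s t has hst htb hgood c₁ c₂ hc j
    have hgood' : ∑ k, ringCount N s t ω k ≤ 1 :=
      (Finset.sum_le_sum fun k _ => tsub_le_tsub (hmono k htb) (hmono k has)).trans hgood
    have heq := hp.eq_ringStep hmono hst hgood'
    rw [heq]
    exact ringStep_mem_Icc hp0 hp1 hc _ j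
  obtain ⟨T, hT⟩ := exists_nat_ge t
  obtain ⟨m, hm0, hm⟩ := hfine T
  have hm0' : (m : ℝ≥0) ≠ 0 := by exact_mod_cast hm0.ne'
  have hind : ∀ i ≤ m, ∀ s t, s ≤ t → t ≤ (T : ℝ≥0) * i / m → ∀ c₁ c₂,
      (∀ j, Y s ω j ∈ Set.Icc c₁ c₂) → ∀ j, Y t ω j ∈ Set.Icc c₁ c₂ := by
    intro i
    induction i with
    | zero =>
      intro _ s t hst ht c₁ c₂ hc
      have ht0 : t = 0 := by simpa using ht
      have hs0 : s = 0 := le_antisymm (ht0 ▸ hst) zero_le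
      rw [ht0, ← hs0]; exact hc
    | succ i ih =>
      intro hi s t hst ht c₁ c₂ hc
      rcases le_total t ((T : ℝ≥0) * i / m) with h1 | h1
      · exact ih (by omega) s t hst h1 c₁ c₂ hc
      · rcases le_total s ((T : ℝ≥0) * i / m) with h2 | h2
        · exact hstep _ _ _ _ le_rfl h1 ht (hm i (by omega)) c₁ c₂
            (ih (by omega) s _ h2 le_rfl c₁ c₂ hc)
        · exact hstep _ _ _ _ h2 hst ht (hm i (by omega)) c₁ c₂ hc
  exact hind m le_rfl s t hst (by rwa [mul_div_assoc, div_self hm0', mul_one])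

end IsDrivenSmoothing

end Driven

/-! ### The forward equation for one- and two-time expectations. -/

/-- A function with a Lipschitz candidate derivative and quadratic forward error is
differentiable. -/
lemma hasDerivWithinAt_of_quadratic_error {f f' : ℝ → ℝ} {K L a : ℝ}
    (h : ∀ t u, a ≤ t → t ≤ u → |f u - f t - (u - t) * f' t| ≤ K * (u - t) ^ 2)
    (h' : ∀ t u, a ≤ t → t ≤ u → |f' u - f' t| ≤ L * (u - t)) {t : ℝ} (ht : a ≤ t) :
    HasDerivWithinAt f (f' t) (Set.Ici a) t := by
  rw [hasDerivWithinAt_iff_isLittleO]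
  refine Asymptotics.IsBigO.trans_isLittleO (g := fun u => ‖u - t‖ ^ 2) ?_
    ((Asymptotics.isLittleO_pow_sub_sub t one_lt_two).mono nhdsWithin_le_nhds)
  refine Asymptotics.IsBigO.of_bound (|K| + |L|) ?_
  filter_upwards [self_mem_nhdsWithin] with u hu
  rw [smul_eq_mul, Real.norm_eq_abs, Real.norm_eq_abs, Real.norm_eq_abs, sq_abs,
    abs_of_nonneg (sq_nonneg (u - t))]
  have hK := le_abs_self K
  have hL := le_abs_self L
  have hL0 := abs_nonneg L
  have hsq := sq_nonneg (u - t)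
  rcases le_total t u with htu | hut
  · refine (h t u ht htu).trans ?_
    nlinarith
  -- To the left of `t` the forward estimate is based at `u`, and the Lipschitz bound carries the
  -- derivative from `u` to `t`.
  · have h1 := abs_le.1 (h u t hu hut)
    have h2 := abs_le.1 (h' u t hu hut)
    have h3 : 0 ≤ t - u := by linarith
    rw [abs_le]
    constructor <;> nlinarith

section Generator

variable {I Ω : Type*} [Fintype I] [DecidableEq I] [MeasurableSpace Ω]
  {p : Matrix I I ℝ} {y₀ : I → ℝ} {P : Measure Ω} {N : I → ℝ≥0 → Ω → ℕ}
  {Y : ℝ≥0 → Ω → I → ℝ} [IsProbabilityMeasure P]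

/-- The unit cube of configurations. -/
def unitCube (I : Type*) : Set (I → ℝ) := {y | ∀ j, y j ∈ Set.Icc (0 : ℝ) 1}

/-- Increments of `ψ x` under the rings, summed over the sites. -/
def ringGenerator (p : Matrix I I ℝ) (ψ : (I → ℝ) → (I → ℝ) → ℝ) (x y : I → ℝ) : ℝ :=
  ∑ k, (ψ x (ringUpdate p k y) - ψ x y)

namespace IsDrivenSmoothing

omit [MeasurableSpace Ω] [IsProbabilityMeasure P] in
lemma ringUpdate_mem_unitCube (hp0 : ∀ i j, 0 ≤ p i j) (hp1 : ∀ i, ∑ j, p i j = 1) {y : I → ℝ}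
    (hy : y ∈ unitCube I) (k : I) : ringUpdate p k y ∈ unitCube I :=
  ringUpdate_mem_Icc hp0 hp1 hy k

lemma ae_mem_unitCube (h : IsDrivenSmoothing p y₀ P N Y) (hp0 : ∀ i j, 0 ≤ p i j)
    (hp1 : ∀ i, ∑ j, p i j = 1) (hy₀ : y₀ ∈ unitCube I) :
    ∀ᵐ ω ∂P, ∀ t, Y t ω ∈ unitCube I := by
  filter_upwards [h.ae_mem_Icc_mono hp0 hp1, h.initial] with ω h1 h2 t
  exact h1 0 t zero_le 0 1 (by rw [h2]; exact hy₀)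

variable {ψ : (I → ℝ) → (I → ℝ) → ℝ} {B : ℝ}

lemma integrable_pair (h : IsDrivenSmoothing p y₀ P N Y) (hp0 : ∀ i j, 0 ≤ p i j)
    (hp1 : ∀ i, ∑ j, p i j = 1) (hy₀ : y₀ ∈ unitCube I)
    (hψ : Measurable fun z : (I → ℝ) × (I → ℝ) => ψ z.1 z.2)
    (hB : ∀ x ∈ unitCube I, ∀ y ∈ unitCube I, |ψ x y| ≤ B) (s t : ℝ≥0) :
    Integrable (fun ω => ψ (Y s ω) (Y t ω)) P := by
  refine Integrable.of_bound
    (hψ.comp ((h.measurable s).prodMk (h.measurable t))).aestronglyMeasurable B ?_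
  filter_upwards [h.ae_mem_unitCube hp0 hp1 hy₀] with ω hω
  exact hB _ (hω s) _ (hω t)

omit [IsProbabilityMeasure P] in
lemma ae_eq_ringStep (h : IsDrivenSmoothing p y₀ P N Y) {t u : ℝ≥0} (htu : t ≤ u) :
    ∀ᵐ ω ∂P, ∑ k, ringCount N t u ω k ≤ 1 → Y u ω = ringStep p (ringCount N t u ω) (Y t ω) := by
  filter_upwards [h.path, h.clock_mono] with ω hp hmono hgood
  exact hp.eq_ringStep hmono htu hgood

lemma measureReal_ringCount_ne_zero_le (h : IsDrivenSmoothing p y₀ P N Y) {t u : ℝ≥0}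
    (htu : t ≤ u) : P.real {ω | ringCount N t u ω ≠ 0} ≤ Fintype.card I * (u - t : ℝ≥0) := by
  have h1 := probReal_compl_eq_one_sub (μ := P) (measurableSet_ringCount_mem h.clocks t u {0})
  have h2 : P.real {ω | ringCount N t u ω ∈ ({0} : Set (I → ℕ))} =
      Real.exp (-(Fintype.card I * (u - t : ℝ≥0))) :=
    measureReal_ringCount_eq_zero h.clocks h.indep htu
  have h3 : {ω | ringCount N t u ω ∈ ({0} : Set (I → ℕ))}ᶜ = {ω | ringCount N t u ω ≠ 0} := rfl
  rw [h3, h2] at h1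
  rw [h1]
  have := Real.add_one_le_exp (-((Fintype.card I : ℝ) * (u - t : ℝ≥0)))
  linarith

/-- Integrals of bounded functions that vanish off an unlikely event are small. -/
lemma abs_integral_le_of_eq_zero {f : Ω → ℝ} {S : Set Ω} (hS : MeasurableSet S) {C ε : ℝ}
    (hC : 0 ≤ C) (hf : ∀ᵐ ω ∂P, |f ω| ≤ C) (hf0 : ∀ᵐ ω ∂P, ω ∉ S → f ω = 0) (hε : P.real S ≤ ε) :
    |∫ ω, f ω ∂P| ≤ C * ε := by
  have h1 : ∀ᵐ ω ∂P, ‖f ω‖ ≤ S.indicator (fun _ => C) ω := by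
    filter_upwards [hf, hf0] with ω h1 h2
    by_cases h : ω ∈ S
    · rw [Set.indicator_of_mem h]; exact h1
    · rw [Set.indicator_of_notMem h, h2 h, norm_zero]
  refine (norm_integral_le_of_norm_le ((integrable_const C).indicator hS) h1).trans ?_
  rw [integral_indicator_const C hS, smul_eq_mul, mul_comm]
  gcongr

lemma abs_integral_sub_le (h : IsDrivenSmoothing p y₀ P N Y) (hp0 : ∀ i j, 0 ≤ p i j)
    (hp1 : ∀ i, ∑ j, p i j = 1) (hy₀ : y₀ ∈ unitCube I)
    (hψ : Measurable fun z : (I → ℝ) × (I → ℝ) => ψ z.1 z.2)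
    (hB : ∀ x ∈ unitCube I, ∀ y ∈ unitCube I, |ψ x y| ≤ B) (s : ℝ≥0) {t u : ℝ≥0} (htu : t ≤ u) :
    |∫ ω, ψ (Y s ω) (Y u ω) ∂P - ∫ ω, ψ (Y s ω) (Y t ω) ∂P| ≤
      2 * B * (Fintype.card I * (u - t : ℝ≥0)) := by
  have hB0 : 0 ≤ B := (abs_nonneg _).trans (hB _ hy₀ _ hy₀)
  rw [← integral_sub (h.integrable_pair hp0 hp1 hy₀ hψ hB s u)
    (h.integrable_pair hp0 hp1 hy₀ hψ hB s t)]
  refine abs_integral_le_of_eq_zero (S := {ω | ringCount N t u ω ≠ 0})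
    (measurableSet_ringCount_mem h.clocks t u {0}ᶜ) (by positivity) ?_ ?_
    (h.measureReal_ringCount_ne_zero_le htu)
  · filter_upwards [h.ae_mem_unitCube hp0 hp1 hy₀] with ω hω
    have h1 := abs_le.1 (hB _ (hω s) _ (hω u))
    have h2 := abs_le.1 (hB _ (hω s) _ (hω t))
    rw [abs_le]; constructor <;> linarith
  · filter_upwards [h.ae_eq_ringStep htu] with ω hω hS
    have h0 : ringCount N t u ω = 0 := not_not.1 hS
    rw [hω (by simp [h0]), h0, ringStep_zero, sub_self]

omit [MeasurableSpace Ω] [IsProbabilityMeasure P] in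
lemma abs_ringGenerator_le (hp0 : ∀ i j, 0 ≤ p i j)
    (hp1 : ∀ i, ∑ j, p i j = 1) (hB : ∀ x ∈ unitCube I, ∀ y ∈ unitCube I, |ψ x y| ≤ B) :
    ∀ x ∈ unitCube I, ∀ y ∈ unitCube I, |ringGenerator p ψ x y| ≤ Fintype.card I * (2 * B) := by
  intro x hx y hy
  refine (Finset.abs_sum_le_sum_abs _ _).trans ?_
  rw [← nsmul_eq_mul, ← Finset.card_univ]
  refine Finset.sum_le_card_nsmul _ _ _ fun k _ => ?_
  have h1 := abs_le.1 (hB x hx _ (ringUpdate_mem_unitCube hp0 hp1 hy k))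
  have h2 := abs_le.1 (hB x hx y hy)
  rw [abs_le]; constructor <;> linarith

omit [MeasurableSpace Ω] [IsProbabilityMeasure P] in
lemma measurable_ringGenerator (hψ : Measurable fun z : (I → ℝ) × (I → ℝ) => ψ z.1 z.2) :
    Measurable fun z : (I → ℝ) × (I → ℝ) => ringGenerator p ψ z.1 z.2 := by
  refine Finset.measurable_sum _ fun k _ => Measurable.sub ?_ hψ
  exact hψ.comp (measurable_fst.prodMk ((measurable_ringUpdate p k).comp measurable_snd))

/-- Unless two rings occur, the increment of `ψ` is the sum over `k` of the jump at `k` times the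
indicator that `k` alone rings. Independence factors each expectation, the indicator having mean `δ
exp (-n δ)`, where `n` is the number of sites and `δ` the length of the interval. The double rings
and the replacement of the exponential by one each cost `2 B (n δ)²`. -/
theorem abs_integral_sub_generator_le (h : IsDrivenSmoothing p y₀ P N Y) (hp0 : ∀ i j, 0 ≤ p i j)
    (hp1 : ∀ i, ∑ j, p i j = 1) (hy₀ : y₀ ∈ unitCube I)
    (hψ : Measurable fun z : (I → ℝ) × (I → ℝ) => ψ z.1 z.2)
    (hB : ∀ x ∈ unitCube I, ∀ y ∈ unitCube I, |ψ x y| ≤ B) {s t u : ℝ≥0} (hst : s ≤ t)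
    (htu : t ≤ u) :
    |∫ ω, ψ (Y s ω) (Y u ω) ∂P - ∫ ω, ψ (Y s ω) (Y t ω) ∂P -
      ((u - t : ℝ≥0) : ℝ) * ∫ ω, ringGenerator p ψ (Y s ω) (Y t ω) ∂P| ≤
      4 * B * (Fintype.card I) ^ 2 * ((u - t : ℝ≥0) : ℝ) ^ 2 := by
  have hB0 : 0 ≤ B := (abs_nonneg _).trans (hB _ hy₀ _ hy₀)
  set δ : ℝ := ((u - t : ℝ≥0) : ℝ) with hδ
  have hδ0 : 0 ≤ δ := NNReal.coe_nonneg _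
  set n : ℝ := (Fintype.card I : ℝ) with hn
  have hn0 : 0 ≤ n := Nat.cast_nonneg _
  let φ : I → (I → ℝ) → (I → ℝ) → ℝ := fun k x y => ψ x (ringUpdate p k y) - ψ x y
  have hφm : ∀ k, Measurable fun z : (I → ℝ) × (I → ℝ) => φ k z.1 z.2 := fun k =>
    (hψ.comp (measurable_fst.prodMk ((measurable_ringUpdate p k).comp measurable_snd))).sub hψ
  have hφB : ∀ k, ∀ x ∈ unitCube I, ∀ y ∈ unitCube I, |φ k x y| ≤ 2 * B := by
    intro k x hx y hy
    have h1 := abs_le.1 (hB x hx _ (ringUpdate_mem_unitCube hp0 hp1 hy k))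
    have h2 := abs_le.1 (hB x hx y hy)
    rw [abs_le]; constructor <;> linarith
  have hφi : ∀ k, Integrable (fun ω => φ k (Y s ω) (Y t ω)) P := fun k =>
    h.integrable_pair hp0 hp1 hy₀ (hφm k) (hφB k) s t
  have hEm : ∀ k : I, MeasurableSet {ω | ringCount N t u ω = Pi.single k 1} := fun k =>
    measurableSet_ringCount_mem h.clocks t u {Pi.single k 1}
  let χ : I → Ω → ℝ := fun k => {ω | ringCount N t u ω = Pi.single k 1}.indicator fun _ => 1
  have hχφi : ∀ k, Integrable (fun ω => φ k (Y s ω) (Y t ω) * χ k ω) P := fun k => by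
    have h1 := (hφi k).indicator (hEm k)
    refine h1.congr (ae_of_all _ fun ω => ?_)
    by_cases hω : ω ∈ {ω | ringCount N t u ω = Pi.single k 1} <;> simp [χ, hω]
  have hmain : ∀ k, ∫ ω, φ k (Y s ω) (Y t ω) * χ k ω ∂P =
      (∫ ω, φ k (Y s ω) (Y t ω) ∂P) * (δ * Real.exp (-(n * δ))) := by
    intro k
    have hind : IndepFun (fun ω => φ k (Y s ω) (Y t ω)) (χ k) P := by
      have h1 := (h.indepFun_ringCount hst htu).comp (hφm k)
        (measurable_from_top (f := ({Pi.single k 1} : Set (I → ℕ)).indicator fun _ => (1 : ℝ)) |>.mono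
          (le_of_eq ?_) le_rfl)
      · exact h1
      · exact (MeasurableSpace.ext fun S => ⟨fun _ => (Set.to_countable S).measurableSet,
          fun _ => trivial⟩ : (⊤ : MeasurableSpace (I → ℕ)) = _)
    rw [hind.integral_fun_mul_eq_mul_integral (hφi k).aestronglyMeasurable
      (measurable_const.indicator (hEm k)).aestronglyMeasurable,
      integral_indicator_const _ (hEm k), measureReal_ringCount_eq_single h.clocks h.indep htu,
      smul_eq_mul, mul_one]
  have hD : Integrable (fun ω => ψ (Y s ω) (Y u ω) - ψ (Y s ω) (Y t ω)) P :=
    (h.integrable_pair hp0 hp1 hy₀ hψ hB s u).sub (h.integrable_pair hp0 hp1 hy₀ hψ hB s t)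
  have hrest : |∫ ω, (ψ (Y s ω) (Y u ω) - ψ (Y s ω) (Y t ω) -
      ∑ k, φ k (Y s ω) (Y t ω) * χ k ω) ∂P| ≤ 2 * B * (n * δ) ^ 2 := by
    refine abs_integral_le_of_eq_zero (S := {ω | 1 < ∑ k, ringCount N t u ω k})
      (measurableSet_ringCount_mem h.clocks t u {y | 1 < ∑ k, y k}) (by positivity) ?_ ?_
      (measureReal_one_lt_sum_ringCount_le h.clocks h.indep htu)
    · filter_upwards [h.ae_mem_unitCube hp0 hp1 hy₀, h.ae_eq_ringStep htu] with ω hω hstep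
      have h1 := abs_le.1 (hB _ (hω s) _ (hω u))
      have h2 := abs_le.1 (hB _ (hω s) _ (hω t))
      by_cases hgood : ∃ k, ringCount N t u ω = Pi.single k 1
      · obtain ⟨k, hk⟩ := hgood
        have hstep' := hstep (by simp [hk])
        rw [hk, ringStep_single] at hstep'
        have hsum : ∑ l, φ l (Y s ω) (Y t ω) * χ l ω = φ k (Y s ω) (Y t ω) := by
          rw [Finset.sum_eq_single k]
          · simp [χ, hk]
          · intro l _ hl
            have : (Pi.single k 1 : I → ℕ) ≠ Pi.single l 1 := fun he => by
              have := congrFun he l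
              simp [hl] at this
            simp [χ, hk, this]
          · simp
        rw [hsum, hstep']
        simp only [φ, sub_self, abs_zero]
        positivity
      · have hsum : ∑ l, φ l (Y s ω) (Y t ω) * χ l ω = 0 :=
          Finset.sum_eq_zero fun l _ => by
            have : ringCount N t u ω ≠ Pi.single l 1 := fun he => hgood ⟨l, he⟩
            simp [χ, this]
        rw [hsum, sub_zero, abs_le]
        constructor <;> linarith
    · filter_upwards [h.ae_eq_ringStep htu] with ω hstep hS
      have hle : ∑ k, ringCount N t u ω k ≤ 1 := not_lt.1 hS
      have hstep' := hstep hle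
      rcases (sum_le_one_iff _).1 hle with h0 | ⟨k, hk⟩
      · rw [h0, ringStep_zero] at hstep'
        rw [hstep', sub_self, zero_sub, neg_eq_zero]
        refine Finset.sum_eq_zero fun l _ => ?_
        have : (0 : I → ℕ) ≠ Pi.single l 1 := fun he => by
          have := congrFun he l
          simp at this
        simp [χ, h0, this]
      · rw [hk, ringStep_single] at hstep'
        have hsum : ∑ l, φ l (Y s ω) (Y t ω) * χ l ω = φ k (Y s ω) (Y t ω) := by
          rw [Finset.sum_eq_single k]
          · simp [χ, hk]
          · intro l _ hl
            have : (Pi.single k 1 : I → ℕ) ≠ Pi.single l 1 := fun he => by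
              have := congrFun he l
              simp [hl] at this
            simp [χ, hk, this]
          · simp
        rw [hsum, hstep']
        simp [φ]
  rw [integral_sub hD (integrable_finsetSum _ fun k _ => hχφi k),
    integral_finsetSum _ fun k _ => hχφi k,
    integral_sub (h.integrable_pair hp0 hp1 hy₀ hψ hB s u)
      (h.integrable_pair hp0 hp1 hy₀ hψ hB s t), Finset.sum_congr rfl fun k _ => hmain k,
    ← Finset.sum_mul] at hrest
  have hgen : ∫ ω, ringGenerator p ψ (Y s ω) (Y t ω) ∂P = ∑ k, ∫ ω, φ k (Y s ω) (Y t ω) ∂P :=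
    integral_finsetSum _ fun k _ => hφi k
  rw [← hgen] at hrest
  set G := ∫ ω, ringGenerator p ψ (Y s ω) (Y t ω) ∂P with hG
  have hGB : |G| ≤ n * (2 * B) := by
    have h1 : ∀ᵐ ω ∂P, ‖ringGenerator p ψ (Y s ω) (Y t ω)‖ ≤ n * (2 * B) := by
      filter_upwards [h.ae_mem_unitCube hp0 hp1 hy₀] with ω hω
      exact abs_ringGenerator_le hp0 hp1 hB _ (hω s) _ (hω t)
    simpa using norm_integral_le_of_norm_le_const h1
  have hexp1 : Real.exp (-(n * δ)) ≤ 1 := Real.exp_le_one_iff.2 (by nlinarith)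
  have hexp2 := Real.add_one_le_exp (-(n * δ))
  have h2 : |G * (δ * Real.exp (-(n * δ))) - δ * G| ≤ 2 * B * (n * δ) ^ 2 := by
    have : G * (δ * Real.exp (-(n * δ))) - δ * G = -(G * (δ * (1 - Real.exp (-(n * δ))))) := by ring
    rw [this, abs_neg, abs_mul, abs_of_nonneg (mul_nonneg hδ0 (by linarith) :
      0 ≤ δ * (1 - Real.exp (-(n * δ))))]
    calc |G| * (δ * (1 - Real.exp (-(n * δ)))) ≤ n * (2 * B) * (δ * (n * δ)) := by
          have : 0 ≤ 1 - Real.exp (-(n * δ)) := by linarith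
          gcongr
          linarith
      _ = _ := by ring
  have h3 := abs_le.1 hrest
  have h4 := abs_le.1 h2
  rw [abs_le]
  constructor <;> nlinarith

/-- The forward equation for two-time expectations. -/
theorem hasDerivWithinAt_integral (h : IsDrivenSmoothing p y₀ P N Y) (hp0 : ∀ i j, 0 ≤ p i j)
    (hp1 : ∀ i, ∑ j, p i j = 1) (hy₀ : y₀ ∈ unitCube I)
    (hψ : Measurable fun z : (I → ℝ) × (I → ℝ) => ψ z.1 z.2)
    (hB : ∀ x ∈ unitCube I, ∀ y ∈ unitCube I, |ψ x y| ≤ B) (s : ℝ≥0) {t : ℝ} (hst : s ≤ t) :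
    HasDerivWithinAt (fun t : ℝ => ∫ ω, ψ (Y s ω) (Y t.toNNReal ω) ∂P)
      (∫ ω, ringGenerator p ψ (Y s ω) (Y t.toNNReal ω) ∂P) (Set.Ici (s : ℝ)) t := by
  have hcoe : ∀ t u : ℝ, (s : ℝ) ≤ t → t ≤ u → ((u.toNNReal - t.toNNReal : ℝ≥0) : ℝ) = u - t := by
    intro t u hst htu
    have h0 : 0 ≤ t := s.2.trans hst
    rw [NNReal.coe_sub (Real.toNNReal_le_toNNReal htu), Real.coe_toNNReal _ h0,
      Real.coe_toNNReal _ (h0.trans htu)]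
  refine hasDerivWithinAt_of_quadratic_error (K := 4 * B * (Fintype.card I) ^ 2)
    (f' := fun t : ℝ => ∫ ω, ringGenerator p ψ (Y s ω) (Y t.toNNReal ω) ∂P)
    (L := 2 * (Fintype.card I * (2 * B)) * Fintype.card I) ?_ ?_ hst
  · intro t u hst htu
    have h1 := h.abs_integral_sub_generator_le hp0 hp1 hy₀ hψ hB (s := s)
      (NNReal.le_toNNReal_of_coe_le hst) (Real.toNNReal_le_toNNReal htu)
    rwa [hcoe t u hst htu] at h1
  · intro t u hst htu
    have h1 := h.abs_integral_sub_le hp0 hp1 hy₀ (measurable_ringGenerator (p := p) hψ)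
      (abs_ringGenerator_le hp0 hp1 hB) s (Real.toNNReal_le_toNNReal htu)
    rw [hcoe t u hst htu] at h1
    linarith

end IsDrivenSmoothing

end Generator

/-! ### Fourier analysis of the torus and of a single ring. -/

section TorusFourier

variable {d n : ℕ}

lemma zmod_one_ne_zero (hn : 3 ≤ n) : (1 : ZMod n) ≠ 0 := by
  intro h
  have h1 : ((1 : ℕ) : ZMod n) = 0 := by exact_mod_cast h
  have := Nat.le_of_dvd one_pos ((ZMod.natCast_eq_zero_iff 1 n).1 h1)
  omega

lemma zmod_one_ne_neg_one (hn : 3 ≤ n) : (1 : ZMod n) ≠ -1 := by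
  intro h
  have h1 : ((2 : ℕ) : ZMod n) = 0 := by
    have : (1 : ZMod n) + 1 = 0 := by nth_rewrite 1 [h]; simp
    push_cast
    rw [← this]; norm_num
  have := Nat.le_of_dvd two_pos ((ZMod.natCast_eq_zero_iff 2 n).1 h1)
  omega

/-- For `n ≥ 3` the steps `1` and `-1` are nonzero and distinct modulo `n`, so direction and sign
enumerate the neighbours without repetition. -/
lemma sum_torusAdj [NeZero n] (hn : 3 ≤ n) (j : Torus d n) (f : Torus d n → ℝ) :
    ∑ i, (if TorusAdj j i then f i else 0) =
      ∑ k : Fin d, (f (j + Pi.single k 1) + f (j - Pi.single k 1)) := by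
  let ε : Bool → ZMod n := fun b => if b then 1 else -1
  have hε0 : ∀ b, ε b ≠ 0 := by
    intro b; cases b <;> simp [ε, zmod_one_ne_zero hn]
  have hεinj : Function.Injective ε := by
    intro b c hbc
    cases b <;> cases c <;> simp [ε] at hbc ⊢
    · exact zmod_one_ne_neg_one hn hbc.symm
    · exact zmod_one_ne_neg_one hn hbc
  let g : Fin d × Bool → Torus d n := fun x => j + Pi.single x.1 (ε x.2)
  have hg : Function.Injective g := by
    rintro ⟨k, b⟩ ⟨l, c⟩ h
    have h' : (Pi.single k (ε b) : Torus d n) = Pi.single l (ε c) := add_left_cancel h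
    have hkl : k = l := by
      by_contra hne
      have := congrFun h' k
      simp only [Pi.single_eq_same, Pi.single_eq_of_ne hne] at this
      exact hε0 b this
    subst hkl
    have := congrFun h' k
    simp only [Pi.single_eq_same] at this
    rw [hεinj this]
  have himg : Finset.univ.filter (fun i => TorusAdj j i) = Finset.univ.image g := by
    ext i
    simp only [Finset.mem_filter, Finset.mem_univ, true_and, Finset.mem_image, Prod.exists,
      Bool.exists_bool, g, ε, TorusAdj]
    refine exists_congr fun k => ?_
    simp only [Pi.single_neg, Bool.false_eq_true, if_false, if_true, ← sub_eq_add_neg]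
    tauto
  rw [← Finset.sum_filter, himg, Finset.sum_image fun _ _ _ _ h => hg h, Fintype.sum_prod_type]
  refine Finset.sum_congr rfl fun k _ => ?_
  simp [g, ε, Pi.single_neg, ← sub_eq_add_neg]

lemma sum_srwMatrix_mul [NeZero n] (hn : 3 ≤ n) (j : Torus d n) (f : Torus d n → ℝ) :
    ∑ i, srwMatrix d n j i * f i =
      (1 / (2 * (d : ℝ))) * ∑ k : Fin d, (f (j + Pi.single k 1) + f (j - Pi.single k 1)) := by
  rw [← sum_torusAdj hn, Finset.mul_sum]
  refine Finset.sum_congr rfl fun i _ => ?_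
  unfold srwMatrix
  split_ifs <;> simp

lemma srwMatrix_nonneg (i j : Torus d n) : 0 ≤ srwMatrix d n i j := by
  unfold srwMatrix
  split_ifs <;> positivity

lemma sum_srwMatrix [NeZero n] (hd : 1 ≤ d) (hn : 3 ≤ n) (j : Torus d n) :
    ∑ i, srwMatrix d n j i = 1 := by
  have h := sum_srwMatrix_mul hn j fun _ => 1
  have hd' : (d : ℝ) ≠ 0 := by positivity
  simp only [mul_one] at h
  rw [h]
  simp
  field_simp
  norm_num

/-- The characters of the torus. -/
noncomputable def torusChar [NeZero n] (ξ j : Torus d n) : ℂ :=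
  ∏ k, ZMod.stdAddChar (ξ k * j k)

variable [NeZero n]

lemma torusChar_add (ξ i j : Torus d n) :
    torusChar ξ (i + j) = torusChar ξ i * torusChar ξ j := by
  simp [torusChar, mul_add, AddChar.map_add_eq_mul, Finset.prod_mul_distrib]

lemma conj_torusChar (ξ j : Torus d n) :
    (starRingEnd ℂ) (torusChar ξ j) = torusChar ξ (-j) := by
  simp [torusChar, map_prod, AddChar.map_neg_eq_conj]

lemma torusChar_zero_left (j : Torus d n) : torusChar 0 j = 1 := by
  simp [torusChar]

lemma normSq_torusChar (ξ j : Torus d n) : Complex.normSq (torusChar ξ j) = 1 := by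
  have h : torusChar ξ j * (starRingEnd ℂ) (torusChar ξ j) = 1 := by
    rw [conj_torusChar, ← torusChar_add, add_neg_cancel]
    simp [torusChar]
  rw [Complex.mul_conj] at h
  exact_mod_cast h

lemma torusChar_sub (ξ i j : Torus d n) :
    torusChar ξ (i - j) = torusChar ξ i * (starRingEnd ℂ) (torusChar ξ j) := by
  rw [sub_eq_add_neg, torusChar_add, conj_torusChar]

lemma sum_torusChar (j : Torus d n) :
    ∑ ξ, torusChar ξ j = if j = 0 then ((n : ℂ) ^ d) else 0 := by
  have h : ∑ ξ : Torus d n, torusChar ξ j =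
      ∏ k, ∑ x : ZMod n, ZMod.stdAddChar (x * j k) := by
    rw [Finset.prod_univ_sum]
    simp only [Fintype.piFinset_univ]
    rfl
  rw [h]
  have h2 : ∀ k, ∑ x : ZMod n, ZMod.stdAddChar (x * j k) = if j k = 0 then (n : ℂ) else 0 := by
    intro k
    rw [AddChar.sum_mulShift _ (ZMod.isPrimitive_stdAddChar n)]
    simp [ZMod.card]
  simp_rw [h2]
  split_ifs with h0
  · subst h0; simp
  · obtain ⟨k, hk⟩ := Function.ne_iff.1 h0
    exact Finset.prod_eq_zero (Finset.mem_univ k) (if_neg hk)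

/-- Fourier transform of a real function on the torus. -/
noncomputable def torusFourier (y : Torus d n → ℝ) (ξ : Torus d n) : ℂ :=
  ∑ j, (y j : ℂ) * torusChar ξ j

lemma torusFourier_zero (y : Torus d n → ℝ) : torusFourier y 0 = ((∑ j, y j : ℝ) : ℂ) := by
  simp [torusFourier, torusChar_zero_left]

/-- Plancherel, by orthogonality of the characters. Taking for `z` the function `y` or its Laplacian
turns variance and energy into spectral sums. -/
lemma sum_torusFourier_mul_conj (y z : Torus d n → ℝ) :
    ∑ ξ, torusFourier y ξ * (starRingEnd ℂ) (torusFourier z ξ) =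
      ((n ^ d * ∑ j, y j * z j : ℝ) : ℂ) := by
  have h1 : ∀ ξ, torusFourier y ξ * (starRingEnd ℂ) (torusFourier z ξ) =
      ∑ i, ∑ j, (y i : ℂ) * z j * torusChar ξ (i - j) := by
    intro ξ
    simp only [torusFourier, map_sum, map_mul, Complex.conj_ofReal, Finset.sum_mul_sum]
    refine Finset.sum_congr rfl fun i _ => Finset.sum_congr rfl fun j _ => ?_
    rw [torusChar_sub]; ring
  simp_rw [h1]
  rw [Finset.sum_comm]
  have h2 : ∀ i : Torus d n, ∑ ξ, ∑ j, (y i : ℂ) * z j * torusChar ξ (i - j) =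
      (n : ℂ) ^ d * (y i * z i) := by
    intro i
    rw [Finset.sum_comm]
    simp_rw [← Finset.mul_sum, sum_torusChar, sub_eq_zero]
    simp only [mul_ite, mul_zero, Finset.sum_ite_eq, Finset.mem_univ, if_true]
    ring
  simp_rw [h2, ← Finset.mul_sum]
  push_cast
  rfl

/-- Generator eigenvalues of simple random walk on the torus. -/
noncomputable def srwEigenvalue (ξ : Torus d n) : ℝ :=
  (1 / (d : ℝ)) * ∑ k, (1 - Real.cos (2 * Real.pi * (ξ k).valMinAbs / n))

lemma stdAddChar_add_neg (x : ZMod n) :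
    ZMod.stdAddChar x + ZMod.stdAddChar (-x) =
      ((2 * Real.cos (2 * Real.pi * x.valMinAbs / n) : ℝ) : ℂ) := by
  have h := ZMod.stdAddChar_coe (N := n) x.valMinAbs
  rw [ZMod.coe_valMinAbs] at h
  rw [AddChar.map_neg_eq_conj, h, Complex.add_conj]
  have : (2 * Real.pi * Complex.I * x.valMinAbs / n : ℂ) =
      ((2 * Real.pi * x.valMinAbs / n : ℝ) : ℂ) * Complex.I := by
    push_cast; ring
  rw [this, Complex.exp_ofReal_mul_I_re]

/-- `(1 - p) y`. -/
noncomputable def torusLaplacian (y : Torus d n → ℝ) (j : Torus d n) : ℝ :=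
  y j - ∑ i, srwMatrix d n j i * y i

lemma torusChar_single (ξ : Torus d n) (k : Fin d) (a : ZMod n) :
    torusChar ξ (Pi.single k a) = ZMod.stdAddChar (ξ k * a) := by
  rw [torusChar, Finset.prod_eq_single k]
  · simp
  · intro l _ hl; simp [hl]
  · simp

/-- Translation by `±1` in direction `k` multiplies the transform by conjugate character values,
which add up to twice a cosine. -/
lemma torusFourier_torusLaplacian (hd : 1 ≤ d) (hn : 3 ≤ n) (y : Torus d n → ℝ) (ξ : Torus d n) :
    torusFourier (torusLaplacian y) ξ = srwEigenvalue ξ * torusFourier y ξ := by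
  have hd' : (d : ℂ) ≠ 0 := by exact_mod_cast (by omega : d ≠ 0)
  have hplus : ∀ k : Fin d, ∑ j, (y (j + Pi.single k 1) : ℂ) * torusChar ξ j =
      ZMod.stdAddChar (-ξ k) * torusFourier y ξ := by
    intro k
    rw [← Equiv.sum_comp (Equiv.subRight (Pi.single k 1 : Torus d n)), torusFourier, Finset.mul_sum]
    refine Finset.sum_congr rfl fun j _ => ?_
    simp only [Equiv.subRight_apply, sub_add_cancel]
    rw [sub_eq_add_neg, torusChar_add, ← Pi.single_neg, torusChar_single]
    simp only [mul_neg, mul_one]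
    ring
  have hminus : ∀ k : Fin d, ∑ j, (y (j - Pi.single k 1) : ℂ) * torusChar ξ j =
      ZMod.stdAddChar (ξ k) * torusFourier y ξ := by
    intro k
    rw [← Equiv.sum_comp (Equiv.addRight (Pi.single k 1 : Torus d n)), torusFourier, Finset.mul_sum]
    refine Finset.sum_congr rfl fun j _ => ?_
    simp only [Equiv.coe_addRight, add_sub_cancel_right]
    rw [torusChar_add, torusChar_single]
    simp only [mul_one]
    ring
  have h1 : torusFourier (torusLaplacian y) ξ = torusFourier y ξ - (1 / (2 * (d : ℂ))) *
      ∑ k : Fin d, (∑ j, (y (j + Pi.single k 1) : ℂ) * torusChar ξ j +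
        ∑ j, (y (j - Pi.single k 1) : ℂ) * torusChar ξ j) := by
    simp_rw [← Finset.sum_add_distrib]
    rw [Finset.sum_comm, torusFourier, torusFourier, Finset.mul_sum, ← Finset.sum_sub_distrib]
    refine Finset.sum_congr rfl fun j _ => ?_
    rw [torusLaplacian, sum_srwMatrix_mul hn]
    push_cast
    rw [sub_mul, mul_assoc, Finset.sum_mul]
    simp_rw [add_mul]
  rw [h1]
  simp_rw [hplus, hminus, ← add_mul]
  rw [← Finset.sum_mul]
  have h2 : ∀ k : Fin d, ZMod.stdAddChar (-ξ k) + ZMod.stdAddChar (ξ k) =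
      ((2 * Real.cos (2 * Real.pi * (ξ k).valMinAbs / n) : ℝ) : ℂ) := fun k => by
    rw [add_comm, stdAddChar_add_neg]
  simp_rw [h2]
  rw [srwEigenvalue, Finset.sum_sub_distrib]
  push_cast
  rw [← Finset.mul_sum]
  simp only [Finset.sum_const, Finset.card_univ, Fintype.card_fin, nsmul_eq_mul, mul_one]
  field_simp

/-- Power spectrum of a function on the torus. -/
noncomputable def torusPower (ξ : Torus d n) (y : Torus d n → ℝ) : ℝ :=
  Complex.normSq (torusFourier y ξ)

lemma torusPower_nonneg (ξ : Torus d n) (y : Torus d n → ℝ) : 0 ≤ torusPower ξ y :=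
  Complex.normSq_nonneg _

lemma torusPower_zero (y : Torus d n → ℝ) : torusPower 0 y = (∑ j, y j) ^ 2 := by
  rw [torusPower, torusFourier_zero, Complex.normSq_ofReal, sq]

lemma sum_torusPower (y : Torus d n → ℝ) :
    ∑ ξ, torusPower ξ y = (n : ℝ) ^ d * ∑ j, y j ^ 2 := by
  have h := sum_torusFourier_mul_conj y y
  simp_rw [Complex.mul_conj, ← sq] at h
  exact_mod_cast h

lemma sum_eigenvalue_mul_torusPower (hd : 1 ≤ d) (hn : 3 ≤ n) (y : Torus d n → ℝ) :
    ∑ ξ, srwEigenvalue ξ * torusPower ξ y = (n : ℝ) ^ d * ∑ j, y j * torusLaplacian y j := by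
  have h := sum_torusFourier_mul_conj y (torusLaplacian y)
  have hc : ∀ ξ, torusFourier y ξ * (starRingEnd ℂ) (torusFourier (torusLaplacian y) ξ) =
      ((srwEigenvalue ξ * torusPower ξ y : ℝ) : ℂ) := by
    intro ξ
    rw [torusFourier_torusLaplacian hd hn, map_mul, Complex.conj_ofReal, mul_left_comm,
      Complex.mul_conj, torusPower]
    push_cast; rfl
  simp_rw [hc] at h
  exact_mod_cast h

lemma sum_eigenvalue_sq_mul_torusPower (hd : 1 ≤ d) (hn : 3 ≤ n) (y : Torus d n → ℝ) :
    ∑ ξ, srwEigenvalue ξ ^ 2 * torusPower ξ y = (n : ℝ) ^ d * ∑ j, torusLaplacian y j ^ 2 := by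
  rw [← sum_torusPower]
  refine Finset.sum_congr rfl fun ξ _ => ?_
  rw [torusPower, torusPower, torusFourier_torusLaplacian hd hn, Complex.normSq_mul,
    Complex.normSq_ofReal, sq]

lemma torusPower_single (ξ i : Torus d n) : torusPower ξ (Pi.single i 1) = 1 := by
  rw [torusPower, torusFourier, Finset.sum_eq_single i]
  · simp [normSq_torusChar]
  · intro j _ hj; simp [hj]
  · simp

/-- The trace of `1 - p`, read off from a point mass: its power spectrum is identically one, and the
diagonal of `p` vanishes. -/
lemma sum_srwEigenvalue (hd : 1 ≤ d) (hn : 3 ≤ n) :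
    ∑ ξ : Torus d n, srwEigenvalue ξ = (n : ℝ) ^ d := by
  have h := sum_eigenvalue_mul_torusPower hd hn (Pi.single (0 : Torus d n) 1)
  simp_rw [torusPower_single, mul_one] at h
  rw [h, Finset.sum_eq_single 0, torusLaplacian, sum_srwMatrix_mul hn]
  · have h1 : (1 : ZMod n) ≠ 0 := zmod_one_ne_zero hn
    simp [h1]
  · intro j _ hj; simp [hj]
  · simp

lemma torusFourier_ringUpdate (k ξ : Torus d n) (y : Torus d n → ℝ) :
    torusFourier (ringUpdate (srwMatrix d n) k y) ξ =
      torusFourier y ξ - torusLaplacian y k * torusChar ξ k := by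
  rw [torusFourier, torusFourier, ← Finset.add_sum_erase _ _ (Finset.mem_univ k),
    ← Finset.add_sum_erase _ (fun j => (y j : ℂ) * torusChar ξ j) (Finset.mem_univ k)]
  have h : ∑ x ∈ Finset.univ.erase k, (ringUpdate (srwMatrix d n) k y x : ℂ) * torusChar ξ x =
      ∑ x ∈ Finset.univ.erase k, (y x : ℂ) * torusChar ξ x :=
    Finset.sum_congr rfl fun x hx => by
      rw [ringUpdate, Function.update_of_ne (Finset.ne_of_mem_erase hx)]
  rw [h, ringUpdate, Function.update_self, torusLaplacian]
  push_cast
  ring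

/-- The generator acting on the power spectrum. -/
lemma sum_torusPower_ringUpdate_sub (hd : 1 ≤ d) (hn : 3 ≤ n) (ξ : Torus d n)
    (y : Torus d n → ℝ) :
    ∑ k, (torusPower ξ (ringUpdate (srwMatrix d n) k y) - torusPower ξ y) =
      -(2 * srwEigenvalue ξ) * torusPower ξ y + ∑ k, torusLaplacian y k ^ 2 := by
  -- The quadratic term does not see `ξ` because characters are unimodular, so all modes receive the
  -- same source. The linear terms sum over `k` to the transform of the Laplacian, where the
  -- eigenvalue appears.
  have h1 : ∀ k, torusPower ξ (ringUpdate (srwMatrix d n) k y) - torusPower ξ y =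
      torusLaplacian y k ^ 2 - 2 * ((starRingEnd ℂ) (torusFourier y ξ) *
        (torusLaplacian y k * torusChar ξ k)).re := by
    intro k
    rw [torusPower, torusPower, torusFourier_ringUpdate, Complex.normSq_sub, Complex.normSq_mul,
      normSq_torusChar, Complex.normSq_ofReal, mul_one,
      ← Complex.conj_re (torusFourier y ξ * (starRingEnd ℂ) _), map_mul, Complex.conj_conj]
    ring
  simp_rw [h1]
  rw [Finset.sum_sub_distrib, ← Finset.mul_sum, ← Complex.re_sum, ← Finset.mul_sum]
  have h2 : ∑ k, (torusLaplacian y k : ℂ) * torusChar ξ k = srwEigenvalue ξ * torusFourier y ξ :=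
    torusFourier_torusLaplacian hd hn y ξ
  have h3 : (starRingEnd ℂ) (torusFourier y ξ) * (srwEigenvalue ξ * torusFourier y ξ) =
      ((srwEigenvalue ξ * torusPower ξ y : ℝ) : ℂ) := by
    rw [mul_left_comm, mul_comm ((starRingEnd ℂ) _), Complex.mul_conj, torusPower]
    push_cast; rfl
  rw [h2, h3, Complex.ofReal_re]
  ring

lemma sum_comp_add_right {G : Type*} [AddGroup G] [Fintype G] (f : G → ℝ) (a : G) :
    ∑ i, f (i + a) = ∑ i, f i :=
  Equiv.sum_comp (Equiv.addRight a) f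

lemma sum_sum_torusAdj_sq (hn : 3 ≤ n) (y : Torus d n → ℝ) :
    ∑ i : Torus d n, ∑ j, (if TorusAdj i j then (y i - y j) ^ 2 else 0) =
      4 * d * ∑ i : Torus d n, y i ^ 2 - 2 * ∑ i : Torus d n, y i * ∑ k : Fin d,
        (y (i + Pi.single k 1) + y (i - Pi.single k 1)) := by
  have hshift : ∀ e : Torus d n, ∑ i : Torus d n, (y (i + e)) ^ 2 = ∑ i : Torus d n, y i ^ 2 :=
    fun e => sum_comp_add_right (fun i : Torus d n => y i ^ 2) e
  have hshift' : ∀ e : Torus d n, ∑ i : Torus d n, (y (i - e)) ^ 2 = ∑ i : Torus d n, y i ^ 2 :=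
    fun e => by
      simp_rw [sub_eq_add_neg]
      exact sum_comp_add_right (fun i : Torus d n => y i ^ 2) (-e)
  have h2 : ∀ i : Torus d n, ∑ j, (if TorusAdj i j then (y i - y j) ^ 2 else 0) =
      2 * d * y i ^ 2 + ∑ k : Fin d, (y (i + Pi.single k 1) ^ 2 + y (i - Pi.single k 1) ^ 2) -
        2 * (y i * ∑ k : Fin d, (y (i + Pi.single k 1) + y (i - Pi.single k 1))) := by
    intro i
    refine (sum_torusAdj hn i fun j => (y i - y j) ^ 2).trans ?_
    have h4 : 2 * (d : ℝ) * y i ^ 2 = ∑ _k : Fin d, 2 * y i ^ 2 := by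
      simp only [Finset.sum_const, Finset.card_univ, Fintype.card_fin, nsmul_eq_mul]
      ring
    have h6 : 2 * (y i * ∑ k : Fin d, (y (i + Pi.single k 1) + y (i - Pi.single k 1))) =
        ∑ k : Fin d, 2 * (y i * (y (i + Pi.single k 1) + y (i - Pi.single k 1))) := by
      rw [Finset.mul_sum, Finset.mul_sum]
    rw [h4, h6, ← Finset.sum_add_distrib, ← Finset.sum_sub_distrib]
    exact Finset.sum_congr rfl fun k _ => by ring
  rw [Finset.sum_congr rfl fun i _ => h2 i, Finset.sum_sub_distrib, Finset.sum_add_distrib,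
    ← Finset.mul_sum, ← Finset.mul_sum, Finset.sum_comm]
  have h5 : ∀ k : Fin d, ∑ i : Torus d n, (y (i + Pi.single k 1) ^ 2 + y (i - Pi.single k 1) ^ 2) =
      2 * ∑ i : Torus d n, y i ^ 2 := fun k => by
    rw [Finset.sum_add_distrib, hshift, hshift']; ring
  rw [Finset.sum_congr rfl fun k _ => h5 k]
  simp only [Finset.sum_const, Finset.card_univ, Fintype.card_fin, nsmul_eq_mul]
  ring

lemma sum_mul_torusLaplacian (hn : 3 ≤ n) (y : Torus d n → ℝ) :
    ∑ j, y j * torusLaplacian y j = ∑ j, y j ^ 2 - (1 / (2 * (d : ℝ))) *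
      ∑ i : Torus d n, y i * ∑ k : Fin d, (y (i + Pi.single k 1) + y (i - Pi.single k 1)) := by
  rw [Finset.mul_sum, ← Finset.sum_sub_distrib]
  refine Finset.sum_congr rfl fun j _ => ?_
  rw [torusLaplacian, sum_srwMatrix_mul hn]
  ring

lemma spatialEnergy_eq (hd : 1 ≤ d) (hn : 3 ≤ n) (y : Torus d n → ℝ) :
    spatialEnergy y =
      ((n : ℝ) ^ d)⁻¹ * (((n : ℝ) ^ d)⁻¹ * ∑ ξ, srwEigenvalue ξ * torusPower ξ y) := by
  have hd' : (d : ℝ) ≠ 0 := by positivity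
  have hn' : (n : ℝ) ^ d ≠ 0 := by positivity
  rw [sum_eigenvalue_mul_torusPower hd hn, spatialEnergy, sum_sum_torusAdj_sq hn,
    sum_mul_torusLaplacian hn, inv_mul_cancel_left₀ hn', mul_inv]
  set S := ∑ i : Torus d n, y i * ∑ k : Fin d, (y (i + Pi.single k 1) + y (i - Pi.single k 1))
  field_simp
  ring

/-- Subtracting the spatial mean removes exactly the zero frequency. -/
lemma spatialVariance_eq (y : Torus d n → ℝ) :
    spatialVariance y =
      ((n : ℝ) ^ d)⁻¹ * (((n : ℝ) ^ d)⁻¹ * ∑ ξ ∈ Finset.univ.erase 0, torusPower ξ y) := by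
  have hn' : (n : ℝ) ^ d ≠ 0 := by
    have : (n : ℝ) ≠ 0 := Nat.cast_ne_zero.2 (NeZero.ne n)
    positivity
  have h1 : ∑ ξ ∈ Finset.univ.erase 0, torusPower ξ y =
      (n : ℝ) ^ d * ∑ j, y j ^ 2 - (∑ j, y j) ^ 2 := by
    rw [← sum_torusPower, ← Finset.add_sum_erase _ _ (Finset.mem_univ 0), torusPower_zero]
    ring
  have hcard : ((Fintype.card (Torus d n) : ℕ) : ℝ) = (n : ℝ) ^ d := by
    simp [Torus, ZMod.card]
  have h2 : ∑ j, (y j - spatialMean y) ^ 2 = ∑ j, y j ^ 2 - ((n : ℝ) ^ d)⁻¹ * (∑ j, y j) ^ 2 := by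
    simp_rw [sub_sq]
    rw [Finset.sum_add_distrib, Finset.sum_sub_distrib, ← Finset.sum_mul, ← Finset.mul_sum,
      Finset.sum_const, Finset.card_univ, nsmul_eq_mul, hcard, spatialMean]
    field_simp
    ring
  rw [spatialVariance, h1, h2]
  field_simp

end TorusFourier

/-! ### Eigenvalue bounds and the frequencies near the gap. -/

section EigenvalueBounds

variable {n : ℕ}

/-- One-dimensional eigenvalues. -/
noncomputable def cycleEigenvalue (x : ZMod n) : ℝ :=
  1 - Real.cos (2 * Real.pi * x.valMinAbs / n)

lemma cycleEigenvalue_nonneg (x : ZMod n) : 0 ≤ cycleEigenvalue x := by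
  unfold cycleEigenvalue; linarith [Real.cos_le_one (2 * Real.pi * x.valMinAbs / n)]

lemma cycleEigenvalue_le_two (x : ZMod n) : cycleEigenvalue x ≤ 2 := by
  unfold cycleEigenvalue; linarith [Real.neg_one_le_cos (2 * Real.pi * x.valMinAbs / n)]

lemma pi_sq_le_ten : Real.pi ^ 2 ≤ 10 := by nlinarith [Real.pi_lt_d2, Real.pi_pos]

lemma cycleEigenvalue_le (x : ZMod n) :
    cycleEigenvalue x ≤ 20 * ((x.valMinAbs : ℝ) ^ 2 / n ^ 2) := by
  have h := Real.one_sub_sq_div_two_le_cos (x := 2 * Real.pi * x.valMinAbs / n)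
  have h1 : (2 * Real.pi * x.valMinAbs / n) ^ 2 / 2 =
      2 * Real.pi ^ 2 * ((x.valMinAbs : ℝ) ^ 2 / n ^ 2) := by ring
  rw [h1] at h
  have h2 : 0 ≤ (x.valMinAbs : ℝ) ^ 2 / (n : ℝ) ^ 2 := by positivity
  rw [cycleEigenvalue]
  nlinarith [pi_sq_le_ten]

lemma gapOne_le (n : ℕ) : gapOne n ≤ 20 / (n : ℝ) ^ 2 := by
  have h := Real.one_sub_sq_div_two_le_cos (x := 2 * Real.pi / n)
  have h1 : (2 * Real.pi / n) ^ 2 / 2 = 2 * Real.pi ^ 2 * (1 / (n : ℝ) ^ 2) := by ring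
  rw [h1] at h
  have h2 : 0 ≤ 1 / (n : ℝ) ^ 2 := by positivity
  rw [gapOne, div_eq_mul_one_div (20 : ℝ)]
  nlinarith [pi_sq_le_ten]

lemma le_gapOne {n : ℕ} (hn : 2 ≤ n) : 8 / (n : ℝ) ^ 2 ≤ gapOne n := by
  have hn' : (2 : ℝ) ≤ n := by exact_mod_cast hn
  have hpi := Real.pi_pos
  have h := Real.cos_le_one_sub_mul_cos_sq (x := 2 * Real.pi / n) (by
    rw [abs_of_nonneg (by positivity), div_le_iff₀ (by linarith)]
    nlinarith)
  have h1 : 2 / Real.pi ^ 2 * (2 * Real.pi / n) ^ 2 = 8 / (n : ℝ) ^ 2 := by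
    field_simp; ring
  rw [gapOne]
  linarith

variable [NeZero n]

lemma abs_valMinAbs_mul_two_le (x : ZMod n) : |(x.valMinAbs : ℝ)| * 2 ≤ n := by
  have h := x.valMinAbs_mem_Ioc
  have h1 : -(n : ℝ) < x.valMinAbs * 2 := by exact_mod_cast h.1
  have h2 : (x.valMinAbs : ℝ) * 2 ≤ n := by exact_mod_cast h.2
  rcases abs_cases (x.valMinAbs : ℝ) with h3 | h3 <;> linarith [h3.1]

lemma abs_two_pi_mul_valMinAbs_div_le (x : ZMod n) :
    |2 * Real.pi * x.valMinAbs / n| ≤ Real.pi := by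
  have hn : (0 : ℝ) < n := Nat.cast_pos.2 (NeZero.pos n)
  rw [abs_div, abs_mul, abs_of_pos (by positivity : 0 < 2 * Real.pi), abs_of_pos hn,
    div_le_iff₀ hn]
  nlinarith [abs_valMinAbs_mul_two_le x, Real.pi_pos]

lemma le_cycleEigenvalue (x : ZMod n) :
    8 * ((x.valMinAbs : ℝ) ^ 2 / n ^ 2) ≤ cycleEigenvalue x := by
  have h := Real.cos_le_one_sub_mul_cos_sq (abs_two_pi_mul_valMinAbs_div_le x)
  have hpi := Real.pi_ne_zero
  have h1 : 2 / Real.pi ^ 2 * (2 * Real.pi * x.valMinAbs / n) ^ 2 =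
      8 * ((x.valMinAbs : ℝ) ^ 2 / n ^ 2) := by
    field_simp; ring
  rw [cycleEigenvalue]
  linarith

lemma one_sub_cos_le_cycleEigenvalue (x : ZMod n) {m : ℕ} (hm : m ≤ x.valMinAbs.natAbs) :
    1 - Real.cos (2 * Real.pi * m / n) ≤ cycleEigenvalue x := by
  have hn : (0 : ℝ) < n := Nat.cast_pos.2 (NeZero.pos n)
  have hpi := Real.pi_pos
  rw [cycleEigenvalue, ← Real.cos_abs (2 * Real.pi * x.valMinAbs / n)]
  have hm' : (m : ℝ) ≤ |(x.valMinAbs : ℝ)| := by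
    rw [← Int.cast_abs, Int.abs_eq_natAbs, Int.cast_natCast]
    exact_mod_cast hm
  have h := Real.cos_le_cos_of_nonneg_of_le_pi (x := 2 * Real.pi * m / n) (by positivity)
    (abs_two_pi_mul_valMinAbs_div_le x) (by
      rw [abs_div, abs_mul, abs_of_pos (by positivity : 0 < 2 * Real.pi), abs_of_pos hn]
      gcongr)
  linarith

lemma gapOne_le_cycleEigenvalue {x : ZMod n} (hx : x ≠ 0) : gapOne n ≤ cycleEigenvalue x := by
  have h := one_sub_cos_le_cycleEigenvalue x (m := 1)
    (Nat.one_le_iff_ne_zero.2 (by rwa [Ne, Int.natAbs_eq_zero, ZMod.valMinAbs_eq_zero]))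
  simpa [gapOne] using h

/-- Since `1 - cos 2z = 2 (1 - cos z)(1 + cos z)`, it suffices that `cos (2π/n) ≥ 0`, which is where
`n ≥ 4` enters. -/
lemma two_mul_gapOne_le (hn : 4 ≤ n) {x : ZMod n} (hx : 2 ≤ x.valMinAbs.natAbs) :
    2 * gapOne n ≤ cycleEigenvalue x := by
  refine le_trans ?_ (one_sub_cos_le_cycleEigenvalue x hx)
  have hn' : (4 : ℝ) ≤ n := by exact_mod_cast hn
  have hpi := Real.pi_pos
  have h1 : 2 * Real.pi * (2 : ℕ) / n = 2 * (2 * Real.pi / n) := by push_cast; ring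
  have h2 : 0 ≤ Real.cos (2 * Real.pi / n) := by
    refine Real.cos_nonneg_of_neg_pi_div_two_le_of_le ?_ ?_
    · have : 0 ≤ 2 * Real.pi / n := by positivity
      linarith
    · rw [div_le_iff₀ (by linarith)]
      nlinarith
  have h3 := Real.cos_le_one (2 * Real.pi / n)
  rw [h1, Real.cos_two_mul, gapOne]
  nlinarith

/-- Oddness excludes the frequency `n/2`, the only one at which the cosine would equal `-1`. -/
lemma cycleEigenvalue_lt_two (hodd : Odd n) (x : ZMod n) : cycleEigenvalue x < 2 := by
  have hn : (0 : ℝ) < n := Nat.cast_pos.2 (NeZero.pos n)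
  have hpi := Real.pi_pos
  have hlt : |2 * Real.pi * x.valMinAbs / n| < Real.pi := by
    rw [abs_div, abs_mul, abs_of_pos (by positivity : 0 < 2 * Real.pi), abs_of_pos hn,
      div_lt_iff₀ hn]
    have h1 : 2 * x.valMinAbs.natAbs < n := by
      have := x.natAbs_valMinAbs_le
      obtain ⟨m, rfl⟩ := hodd
      omega
    have h2 : |(x.valMinAbs : ℝ)| = (x.valMinAbs.natAbs : ℝ) := by
      rw [← Int.cast_abs, Int.abs_eq_natAbs, Int.cast_natCast]
    have h3 : 2 * (x.valMinAbs.natAbs : ℝ) < n := by exact_mod_cast h1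
    rw [h2]
    nlinarith
  have h := Real.cos_lt_cos_of_nonneg_of_le_pi (abs_nonneg _) le_rfl hlt
  rw [Real.cos_abs, Real.cos_pi] at h
  rw [cycleEigenvalue]
  linarith

variable {d : ℕ}

omit [NeZero n] in
lemma srwEigenvalue_eq (ξ : Torus d n) :
    srwEigenvalue ξ = (1 / (d : ℝ)) * ∑ k, cycleEigenvalue (ξ k) := rfl

omit [NeZero n] in
lemma srwEigenvalue_nonneg (ξ : Torus d n) : 0 ≤ srwEigenvalue ξ := by
  rw [srwEigenvalue_eq]
  have := Finset.sum_nonneg fun k (_ : k ∈ Finset.univ) => cycleEigenvalue_nonneg (ξ k)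
  positivity

omit [NeZero n] in
lemma srwEigenvalue_zero : srwEigenvalue (0 : Torus d n) = 0 := by
  simp [srwEigenvalue]

lemma srwEigenvalue_lt_two (hd : 1 ≤ d) (hodd : Odd n) (ξ : Torus d n) : srwEigenvalue ξ < 2 := by
  have hd' : (0 : ℝ) < d := by exact_mod_cast hd
  rw [srwEigenvalue_eq, one_div_mul_eq_div, div_lt_iff₀ hd']
  have : Nonempty (Fin d) := ⟨⟨0, hd⟩⟩
  calc ∑ k, cycleEigenvalue (ξ k) < ∑ _k : Fin d, (2 : ℝ) :=
        Finset.sum_lt_sum_of_nonempty Finset.univ_nonempty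
          fun k _ => cycleEigenvalue_lt_two hodd (ξ k)
    _ = 2 * d := by simp [mul_comm]

lemma gapOne_div_le_srwEigenvalue {ξ : Torus d n} (hξ : ξ ≠ 0) :
    gapOne n / d ≤ srwEigenvalue ξ := by
  obtain ⟨k, hk⟩ := Function.ne_iff.1 hξ
  rw [srwEigenvalue_eq, one_div_mul_eq_div]
  gcongr
  exact (gapOne_le_cycleEigenvalue hk).trans
    (Finset.single_le_sum (fun l _ => cycleEigenvalue_nonneg (ξ l)) (Finset.mem_univ k))

/-- The nonzero frequencies close to the spectral gap. -/
noncomputable def lowFrequencies (d n : ℕ) [NeZero n] : Finset (Torus d n) :=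
  open Classical in
  Finset.univ.filter fun ξ => ξ ≠ 0 ∧ srwEigenvalue ξ < 2 * (gapOne n / d)

/-- Two nonzero coordinates, or one of absolute value at least two, already contribute twice `gapOne
n`. -/
lemma eq_single_of_mem_lowFrequencies (hn : 4 ≤ n) {ξ : Torus d n}
    (h : ξ ∈ lowFrequencies d n) :
    ∃ x : Fin d × Bool, ξ = Pi.single x.1 (if x.2 then 1 else -1) := by
  classical
  simp only [lowFrequencies, Finset.mem_filter, Finset.mem_univ, true_and] at h
  obtain ⟨hξ, hlt⟩ := h
  obtain ⟨k, hk⟩ := Function.ne_iff.1 hξ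
  simp only [Pi.zero_apply] at hk
  have hd' : (0 : ℝ) < d := by exact_mod_cast k.pos
  have hlt' : ∑ l, cycleEigenvalue (ξ l) < 2 * gapOne n := by
    rw [srwEigenvalue_eq, one_div_mul_eq_div, ← mul_div_assoc, div_lt_div_iff_of_pos_right hd']
      at hlt
    exact hlt
  rw [← Finset.add_sum_erase _ _ (Finset.mem_univ k)] at hlt'
  have hzero : ∀ l, l ≠ k → ξ l = 0 := by
    intro l hl
    by_contra hne
    have h1 := Finset.single_le_sum (f := fun l => cycleEigenvalue (ξ l))
      (fun l _ => cycleEigenvalue_nonneg (ξ l)) (Finset.mem_erase.2 ⟨hl, Finset.mem_univ l⟩)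
    have h2 := gapOne_le_cycleEigenvalue hk
    have h3 := gapOne_le_cycleEigenvalue hne
    linarith
  have hone : (ξ k).valMinAbs.natAbs = 1 := by
    have h0 : (ξ k).valMinAbs.natAbs ≠ 0 := by
      rwa [Ne, Int.natAbs_eq_zero, ZMod.valMinAbs_eq_zero]
    by_contra h1
    have h2 := two_mul_gapOne_le hn (x := ξ k) (by omega)
    have h3 := Finset.sum_nonneg fun l (_ : l ∈ Finset.univ.erase k) =>
      cycleEigenvalue_nonneg (ξ l)
    linarith
  have hval : ξ k = 1 ∨ ξ k = -1 := by
    rw [← ZMod.coe_valMinAbs (ξ k)]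
    rcases Int.natAbs_eq (ξ k).valMinAbs with h | h <;> rw [hone] at h <;> rw [h] <;> simp
  have hfun : ξ = Pi.single k (ξ k) := by
    funext l
    by_cases hl : l = k
    · subst hl; simp
    · rw [Pi.single_eq_of_ne hl, hzero l hl]
  rcases hval with h | h
  · exact ⟨(k, true), by rw [hfun, h]; simp⟩
  · exact ⟨(k, false), by rw [hfun, h]; simp⟩

lemma card_lowFrequencies_le (hn : 4 ≤ n) : (lowFrequencies d n).card ≤ 2 * d := by
  classical
  have hsub : lowFrequencies d n ⊆ Finset.univ.image
      fun x : Fin d × Bool => (Pi.single x.1 (if x.2 then 1 else -1) : Torus d n) := by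
    intro ξ hξ
    obtain ⟨x, hx⟩ := eq_single_of_mem_lowFrequencies hn hξ
    exact Finset.mem_image.2 ⟨x, Finset.mem_univ x, hx.symm⟩
  refine (Finset.card_le_card hsub).trans (Finset.card_image_le.trans ?_)
  simp [mul_comm]

lemma two_mul_gap_le_of_notMem {ξ : Torus d n} (hξ : ξ ≠ 0) (h : ξ ∉ lowFrequencies d n) :
    2 * (gapOne n / d) ≤ srwEigenvalue ξ := by
  by_contra hlt
  exact h (by simp [lowFrequencies, hξ, not_le.1 hlt])

end EigenvalueBounds

/-! ### Heat trace, renewal kernel and lower spectral sums. -/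

section HeatTrace

variable {d n : ℕ} [NeZero n]

lemma sum_exp_neg_le (a : ℝ) (ha : 0 < a) (m : ℕ) :
    ∑ i ∈ Finset.range m, Real.exp (-(a * i)) ≤ 1 + 1 / a := by
  have h1 : ∀ i : ℕ, Real.exp (-(a * i)) = Real.exp (-a) ^ i := fun i => by
    rw [← Real.exp_nat_mul]; ring_nf
  simp_rw [h1]
  have hlt : Real.exp (-a) < 1 := Real.exp_lt_one_iff.2 (by linarith)
  have hgeom : ∑ i ∈ Finset.range m, Real.exp (-a) ^ i ≤ (1 - Real.exp (-a))⁻¹ := by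
    rw [← one_div, le_div_iff₀ (by linarith), geom_sum_mul_neg]
    have : 0 ≤ Real.exp (-a) ^ m := by positivity
    linarith
  refine hgeom.trans ?_
  have h2 : a + 1 ≤ Real.exp a := Real.add_one_le_exp a
  have h3 : Real.exp (-a) ≤ 1 / (a + 1) := by
    rw [Real.exp_neg, ← one_div]
    gcongr
  have h4 : a / (a + 1) ≤ 1 - Real.exp (-a) := by
    have : a / (a + 1) = 1 - 1 / (a + 1) := by field_simp; ring
    linarith
  calc (1 - Real.exp (-a))⁻¹ ≤ (a / (a + 1))⁻¹ := by gcongr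
    _ = 1 + 1 / a := by rw [inv_div]; field_simp

lemma sum_exp_neg_abs_valMinAbs_le (a : ℝ) (ha : 0 < a) :
    ∑ x : ZMod n, Real.exp (-(a * |(x.valMinAbs : ℝ)|)) ≤ 2 * (1 + 1 / a) := by
  classical
  have habs : ∀ x : ZMod n, |(x.valMinAbs : ℝ)| = (x.valMinAbs.natAbs : ℝ) := fun x => by
    rw [← Int.cast_abs, Int.abs_eq_natAbs, Int.cast_natCast]
  have hpart : ∀ S : Finset (ZMod n), Set.InjOn (fun x : ZMod n => x.valMinAbs.natAbs) S →
      ∑ x ∈ S, Real.exp (-(a * |(x.valMinAbs : ℝ)|)) ≤ 1 + 1 / a := by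
    intro S hS
    simp_rw [habs]
    rw [← Finset.sum_image (f := fun i : ℕ => Real.exp (-(a * i)))
      (g := fun x : ZMod n => x.valMinAbs.natAbs) fun x hx y hy h => hS hx hy h]
    refine le_trans ?_ (sum_exp_neg_le a ha (n + 1))
    refine Finset.sum_le_sum_of_subset_of_nonneg ?_ fun _ _ _ => (Real.exp_pos _).le
    intro i hi
    obtain ⟨x, -, rfl⟩ := Finset.mem_image.1 hi
    have := x.natAbs_valMinAbs_le
    exact Finset.mem_range.2 (by omega)
  -- The absolute value is injective on representatives of one sign, so each half is part of a
  -- geometric series.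
  rw [← Finset.sum_filter_add_sum_filter_not _ fun x : ZMod n => 0 ≤ x.valMinAbs, two_mul]
  refine add_le_add (hpart _ ?_) (hpart _ ?_)
  · intro x hx y hy h
    simp only [Finset.coe_filter, Finset.mem_univ, true_and, Set.mem_ofPred_eq] at hx hy h
    exact ZMod.valMinAbs_inj.1 (by omega)
  · intro x hx y hy h
    simp only [Finset.coe_filter, Finset.mem_univ, true_and, Set.mem_ofPred_eq] at hx hy h
    exact ZMod.valMinAbs_inj.1 (by omega)

/-- The quadratic lower bound on the eigenvalue gives Gaussian decay at scale `n / √s`; weakening it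
to exponential decay leaves a geometric sum. -/
lemma sum_exp_neg_cycleEigenvalue_le {s : ℝ} (hs : 0 < s) :
    ∑ x : ZMod n, Real.exp (-(s * cycleEigenvalue x)) ≤ 4 * (1 + n / Real.sqrt s) := by
  have hn : (0 : ℝ) < n := Nat.cast_pos.2 (NeZero.pos n)
  have hsq : 0 < Real.sqrt s := Real.sqrt_pos.2 hs
  have hterm : ∀ x : ZMod n, Real.exp (-(s * cycleEigenvalue x)) ≤
      2 * Real.exp (-(Real.sqrt s / n * |(x.valMinAbs : ℝ)|)) := by
    intro x
    set z := Real.sqrt s / n * |(x.valMinAbs : ℝ)| with hz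
    have hz2 : z ^ 2 = s * ((x.valMinAbs : ℝ) ^ 2 / n ^ 2) := by
      rw [hz, mul_pow, div_pow, Real.sq_sqrt hs.le, sq_abs]; ring
    have h1 : 8 * z ^ 2 ≤ s * cycleEigenvalue x := by
      rw [hz2]
      nlinarith [mul_le_mul_of_nonneg_left (le_cycleEigenvalue x) hs.le]
    have h2 : z - s * cycleEigenvalue x ≤ 1 / 2 := by nlinarith [sq_nonneg (z - 1 / 4)]
    have h3 : Real.exp (1 / 2) ≤ 2 := by
      have h5 : Real.exp (1 / 2) ^ 2 = Real.exp 1 := by rw [← Real.exp_nat_mul]; norm_num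
      nlinarith [Real.exp_one_lt_d9, Real.exp_pos (1 / 2)]
    calc Real.exp (-(s * cycleEigenvalue x))
        = Real.exp (z - s * cycleEigenvalue x) * Real.exp (-z) := by
          rw [← Real.exp_add]; ring_nf
      _ ≤ 2 * Real.exp (-z) := by
          gcongr
          exact (Real.exp_le_exp.2 h2).trans h3
  calc _ ≤ ∑ x : ZMod n, 2 * Real.exp (-(Real.sqrt s / n * |(x.valMinAbs : ℝ)|)) :=
        Finset.sum_le_sum fun x _ => hterm x
    _ ≤ 2 * (2 * (1 + 1 / (Real.sqrt s / n))) := by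
        rw [← Finset.mul_sum]
        gcongr
        exact sum_exp_neg_abs_valMinAbs_le _ (by positivity)
    _ = _ := by rw [one_div_div]; ring

lemma sum_exp_neg_srwEigenvalue (s : ℝ) :
    ∑ ξ : Torus d n, Real.exp (-(s * srwEigenvalue ξ)) =
      (∑ x : ZMod n, Real.exp (-(s / d * cycleEigenvalue x))) ^ d := by
  have h1 : ∀ ξ : Torus d n, Real.exp (-(s * srwEigenvalue ξ)) =
      ∏ k, Real.exp (-(s / d * cycleEigenvalue (ξ k))) := by
    intro ξ
    rw [← Real.exp_sum, srwEigenvalue_eq, Finset.sum_neg_distrib, ← Finset.mul_sum]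
    ring_nf
  simp_rw [h1]
  rw [← Fin.prod_const, Finset.prod_univ_sum]
  simp only [Fintype.piFinset_univ]

/-- Heat trace bound. -/
lemma heatTrace_le (d : ℕ) (hd : 1 ≤ d) : ∃ C : ℝ, 0 < C ∧ ∀ (n : ℕ) [NeZero n] (s : ℝ), 0 ≤ s →
    ((n : ℝ) ^ d)⁻¹ * ∑ ξ : Torus d n, Real.exp (-(s * srwEigenvalue ξ)) ≤
      C * ((1 + s) ^ (-((d : ℝ) / 2)) + ((n : ℝ) ^ d)⁻¹) := by
  have hd0 : (1 : ℝ) ≤ d := by exact_mod_cast hd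
  refine ⟨Real.exp 2 * (4 * d) ^ d * 2 ^ (d - 1), by positivity, fun n _ s hs => ?_⟩
  have hn : (0 : ℝ) < n := Nat.cast_pos.2 (NeZero.pos n)
  have hs1 : 0 < 1 + s := by linarith
  have hsq : 0 < Real.sqrt (1 + s) := Real.sqrt_pos.2 hs1
  -- Passing from `s` to `1 + s` costs a factor `exp 2`, as eigenvalues are at most two, and makes
  -- the bound uniform down to `s = 0`.
  have hshift : ∑ ξ : Torus d n, Real.exp (-(s * srwEigenvalue ξ)) ≤
      Real.exp 2 * ∑ ξ : Torus d n, Real.exp (-((1 + s) * srwEigenvalue ξ)) := by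
    rw [Finset.mul_sum]
    refine Finset.sum_le_sum fun ξ _ => ?_
    rw [← Real.exp_add]
    refine Real.exp_le_exp.2 ?_
    have hle : srwEigenvalue ξ ≤ 2 := by
      rw [srwEigenvalue_eq, one_div_mul_eq_div, div_le_iff₀ (by linarith)]
      calc ∑ k, cycleEigenvalue (ξ k) ≤ ∑ _k : Fin d, (2 : ℝ) :=
            Finset.sum_le_sum fun k _ => cycleEigenvalue_le_two (ξ k)
        _ = 2 * d := by simp [mul_comm]
    linarith
  have hcyc : ∑ x : ZMod n, Real.exp (-((1 + s) / d * cycleEigenvalue x)) ≤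
      4 * d * (1 + n / Real.sqrt (1 + s)) := by
    refine (sum_exp_neg_cycleEigenvalue_le (by positivity)).trans ?_
    have h1 : Real.sqrt (1 + s) / d ≤ Real.sqrt ((1 + s) / d) := by
      rw [Real.sqrt_div hs1.le]
      gcongr
      rw [Real.sqrt_le_left (by linarith)]
      nlinarith
    have h2 : (n : ℝ) / Real.sqrt ((1 + s) / d) ≤ d * (n / Real.sqrt (1 + s)) := by
      calc (n : ℝ) / Real.sqrt ((1 + s) / d) ≤ n / (Real.sqrt (1 + s) / d) := by gcongr
        _ = d * (n / Real.sqrt (1 + s)) := by field_simp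
    nlinarith
  have hfin : ((n : ℝ) ^ d)⁻¹ * (4 * d * (1 + n / Real.sqrt (1 + s))) ^ d ≤
      (4 * d) ^ d * 2 ^ (d - 1) * ((1 + s) ^ (-((d : ℝ) / 2)) + ((n : ℝ) ^ d)⁻¹) := by
    have h1 : ((n : ℝ) ^ d)⁻¹ * (4 * d * (1 + n / Real.sqrt (1 + s))) ^ d =
        (4 * d) ^ d * ((Real.sqrt (1 + s))⁻¹ + (n : ℝ)⁻¹) ^ d := by
      rw [← inv_pow, ← mul_pow, ← mul_pow]
      congr 1
      field_simp
      ring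
    have h2 : (Real.sqrt (1 + s))⁻¹ ^ d = (1 + s) ^ (-((d : ℝ) / 2)) := by
      rw [Real.sqrt_eq_rpow, ← Real.rpow_neg hs1.le, ← Real.rpow_natCast, ← Real.rpow_mul hs1.le]
      congr 1; ring
    rw [h1, ← h2, ← inv_pow, mul_assoc]
    gcongr
    exact add_pow_le (by positivity) (by positivity) d
  calc _ ≤ ((n : ℝ) ^ d)⁻¹ * (Real.exp 2 * (4 * d * (1 + n / Real.sqrt (1 + s))) ^ d) := by
        rw [sum_exp_neg_srwEigenvalue] at hshift ⊢
        rw [sum_exp_neg_srwEigenvalue] at hshift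
        gcongr
        refine hshift.trans ?_
        gcongr
    _ = Real.exp 2 * (((n : ℝ) ^ d)⁻¹ * (4 * d * (1 + n / Real.sqrt (1 + s))) ^ d) := by ring
    _ ≤ Real.exp 2 * _ := mul_le_mul_of_nonneg_left hfin (Real.exp_pos _).le
    _ = _ := by ring

/-- The profile governing the second derivative of the return probability. -/
noncomputable def decayProfile (d n : ℕ) (t : ℝ) : ℝ :=
  (1 + t) ^ (-((d : ℝ) / 2 + 2)) + ((n : ℝ) ^ (d + 4))⁻¹

lemma mul_rpow_neg_two_le {n : ℕ} [NeZero n] (d : ℕ) {t : ℝ} (ht : 0 ≤ t) :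
    ((1 + t) ^ (-((d : ℝ) / 2)) + ((n : ℝ) ^ d)⁻¹) * ((1 + t) ^ 2)⁻¹ ≤ 2 * decayProfile d n t := by
  have hn : (0 : ℝ) < n := Nat.cast_pos.2 (NeZero.pos n)
  have h1 : 0 < 1 + t := by linarith
  have hpow : (1 + t) ^ (-((d : ℝ) / 2)) * ((1 + t) ^ 2)⁻¹ = (1 + t) ^ (-((d : ℝ) / 2 + 2)) := by
    rw [neg_add, Real.rpow_add h1, Real.rpow_neg h1.le 2]
    norm_cast
  have hcross : ((n : ℝ) ^ d)⁻¹ * ((1 + t) ^ 2)⁻¹ ≤ decayProfile d n t := by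
    rw [decayProfile]
    -- Before the diffusive time `n²` the factor `n^{-d}` is at most `(1 + t)^{-d/2}`; after it `(1
    -- + t)^{-2}` is at most `n^{-4}`.
    rcases le_total (1 + t) ((n : ℝ) ^ 2) with h | h
    · have h2 : ((n : ℝ) ^ d)⁻¹ ≤ (1 + t) ^ (-((d : ℝ) / 2)) := by
        rw [Real.rpow_neg h1.le]
        gcongr
        calc (1 + t) ^ ((d : ℝ) / 2) ≤ ((n : ℝ) ^ 2) ^ ((d : ℝ) / 2) := by gcongr
          _ = (n : ℝ) ^ d := by
            rw [← Real.rpow_natCast (n : ℝ) 2, ← Real.rpow_mul hn.le, ← Real.rpow_natCast]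
            congr 1; push_cast; ring
      calc ((n : ℝ) ^ d)⁻¹ * ((1 + t) ^ 2)⁻¹ ≤ (1 + t) ^ (-((d : ℝ) / 2)) * ((1 + t) ^ 2)⁻¹ := by
            gcongr
        _ ≤ _ := by rw [hpow]; exact le_add_of_nonneg_right (by positivity)
    · calc ((n : ℝ) ^ d)⁻¹ * ((1 + t) ^ 2)⁻¹ ≤ ((n : ℝ) ^ d)⁻¹ * (((n : ℝ) ^ 2) ^ 2)⁻¹ := by
            gcongr
        _ = ((n : ℝ) ^ (d + 4))⁻¹ := by rw [← mul_inv]; ring_nf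
        _ ≤ _ := le_add_of_nonneg_left (by positivity)
  rw [add_mul, hpow]
  have : (1 + t) ^ (-((d : ℝ) / 2 + 2)) ≤ decayProfile d n t := by
    rw [decayProfile]; exact le_add_of_nonneg_right (by positivity)
  linarith

/-- The kernel of the renewal equation, tilted at rate slightly below twice the gap, is bounded
by the decay profile. -/
lemma tilted_kernel_le (d : ℕ) (hd : 1 ≤ d) : ∃ C : ℝ, 0 < C ∧ ∀ (n : ℕ) [NeZero n], 4 ≤ n →
    ∀ θ : ℝ, θ ≤ 2 * (gapOne n / d) → ∀ t : ℝ, 0 ≤ t →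
    ((n : ℝ) ^ d)⁻¹ * ∑ ξ ∈ Finset.univ.erase (0 : Torus d n),
      srwEigenvalue ξ ^ 2 * Real.exp (-((2 * srwEigenvalue ξ - θ) * t)) ≤
      C * decayProfile d n t := by
  obtain ⟨C, hC, hheat⟩ := heatTrace_le d hd
  have hd0 : (1 : ℝ) ≤ d := by exact_mod_cast hd
  refine ⟨2 * d * 1600 + 24 * (C * 2 ^ ((d : ℝ) / 2)) * 2, by positivity,
    fun n _ hn4 θ hθ t ht => ?_⟩
  classical
  have hn : (0 : ℝ) < n := Nat.cast_pos.2 (NeZero.pos n)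
  have h1 : 0 < 1 + t := by linarith
  have hgap0 : 0 ≤ gapOne n := by
    have := le_gapOne (n := n) (by omega)
    exact le_trans (by positivity) this
  -- Near the gap, `λ²` is of order `n^{-4}` and the tilted exponential is at most one. Elsewhere `2
  -- λ - θ ≥ λ`, so half of `exp (-λ t)` absorbs `λ²` into `(1 + t)^{-2}` and the other half is kept
  -- for the heat trace.
  have hsplit : ∀ ξ ∈ Finset.univ.erase (0 : Torus d n),
      srwEigenvalue ξ ^ 2 * Real.exp (-((2 * srwEigenvalue ξ - θ) * t)) ≤
        (if ξ ∈ lowFrequencies d n then 1600 * ((n : ℝ) ^ 4)⁻¹ else 0) +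
          24 * ((1 + t) ^ 2)⁻¹ * Real.exp (-(t / 2 * srwEigenvalue ξ)) := by
    intro ξ hξ
    have hξ0 := Finset.ne_of_mem_erase hξ
    have hlam := srwEigenvalue_nonneg ξ
    have hgap := gapOne_div_le_srwEigenvalue hξ0
    split_ifs with hlow
    · have h2 : srwEigenvalue ξ < 2 * (gapOne n / d) := by
        simp only [lowFrequencies, Finset.mem_filter] at hlow
        exact hlow.2.2
      have h3 : gapOne n / d ≤ 20 / (n : ℝ) ^ 2 :=
        (div_le_self hgap0 hd0).trans (gapOne_le n)
      have h4 : srwEigenvalue ξ ^ 2 ≤ (40 / (n : ℝ) ^ 2) ^ 2 := by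
        have : srwEigenvalue ξ ≤ 40 / (n : ℝ) ^ 2 := by
          have h5 : 40 / (n : ℝ) ^ 2 = 2 * (20 / (n : ℝ) ^ 2) := by ring
          linarith
        gcongr
      have h6 : Real.exp (-((2 * srwEigenvalue ξ - θ) * t)) ≤ 1 :=
        Real.exp_le_one_iff.2 (by nlinarith)
      have h7 : (40 / (n : ℝ) ^ 2) ^ 2 = 1600 * ((n : ℝ) ^ 4)⁻¹ := by
        rw [div_pow]; ring
      calc _ ≤ (40 / (n : ℝ) ^ 2) ^ 2 * 1 := by gcongr
        _ = 1600 * ((n : ℝ) ^ 4)⁻¹ := by rw [mul_one, h7]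
        _ ≤ _ := le_add_of_nonneg_right (by positivity)
    · rw [zero_add]
      have h2 := two_mul_gap_le_of_notMem hξ0 hlow
      set l := srwEigenvalue ξ with hl
      have hl2 : l ≤ 2 := by
        rw [hl, srwEigenvalue_eq, one_div_mul_eq_div, div_le_iff₀ (by linarith)]
        calc ∑ k, cycleEigenvalue (ξ k) ≤ ∑ _k : Fin d, (2 : ℝ) :=
              Finset.sum_le_sum fun k _ => cycleEigenvalue_le_two (ξ k)
          _ = 2 * d := by simp [mul_comm]
      have h3 : Real.exp (-((2 * l - θ) * t)) ≤
          Real.exp (-(t / 2 * l)) * Real.exp (-(t / 2 * l)) := by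
        rw [← Real.exp_add]
        refine Real.exp_le_exp.2 ?_
        nlinarith
      have h4 : l ^ 2 * Real.exp (-(t / 2 * l)) ≤ 24 * ((1 + t) ^ 2)⁻¹ := by
        set w := (1 + t) * l with hw
        have hw0 : 0 ≤ w := by positivity
        have h5 : (w / 2) ^ 2 / 2 ≤ Real.exp (w / 2) := by
          have := Real.quadratic_le_exp_of_nonneg (x := w / 2) (by positivity)
          linarith
        have h6 : Real.exp (-(t / 2 * l)) = Real.exp (l / 2) * (Real.exp (w / 2))⁻¹ := by
          rw [← Real.exp_neg, ← Real.exp_add, hw]; ring_nf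
        have h7 : Real.exp (l / 2) ≤ 3 := by
          have : Real.exp (l / 2) ≤ Real.exp 1 := Real.exp_le_exp.2 (by linarith)
          linarith [Real.exp_one_lt_d9]
        have h8 : w ^ 2 * (Real.exp (w / 2))⁻¹ ≤ 8 := by
          rw [← div_eq_mul_inv, div_le_iff₀ (Real.exp_pos _)]
          nlinarith
        have h9 : l ^ 2 = w ^ 2 * ((1 + t) ^ 2)⁻¹ := by
          rw [hw, mul_pow]; field_simp
        calc l ^ 2 * Real.exp (-(t / 2 * l))
            = (w ^ 2 * (Real.exp (w / 2))⁻¹) * Real.exp (l / 2) * ((1 + t) ^ 2)⁻¹ := by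
              rw [h6, h9]; ring
          _ ≤ 8 * 3 * ((1 + t) ^ 2)⁻¹ := by gcongr
          _ = _ := by ring
      calc l ^ 2 * Real.exp (-((2 * l - θ) * t))
          ≤ l ^ 2 * (Real.exp (-(t / 2 * l)) * Real.exp (-(t / 2 * l))) := by gcongr
        _ = (l ^ 2 * Real.exp (-(t / 2 * l))) * Real.exp (-(t / 2 * l)) := by ring
        _ ≤ _ := by gcongr
  have hlowsum : ∑ ξ ∈ Finset.univ.erase (0 : Torus d n),
      (if ξ ∈ lowFrequencies d n then 1600 * ((n : ℝ) ^ 4)⁻¹ else 0) ≤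
        2 * d * (1600 * ((n : ℝ) ^ 4)⁻¹) := by
    calc _ ≤ ∑ ξ : Torus d n, (if ξ ∈ lowFrequencies d n then 1600 * ((n : ℝ) ^ 4)⁻¹ else 0) :=
          Finset.sum_le_sum_of_subset_of_nonneg (Finset.subset_univ _)
            fun _ _ _ => by split_ifs <;> positivity
      _ = (lowFrequencies d n).card * (1600 * ((n : ℝ) ^ 4)⁻¹) := by
          rw [← Finset.sum_filter, Finset.sum_const, nsmul_eq_mul]
          congr 3
          ext; simp
      _ ≤ _ := by
          have : ((lowFrequencies d n).card : ℝ) ≤ 2 * d := by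
            exact_mod_cast card_lowFrequencies_le hn4
          gcongr
  have hhalf : (1 + t / 2) ^ (-((d : ℝ) / 2)) ≤
      2 ^ ((d : ℝ) / 2) * (1 + t) ^ (-((d : ℝ) / 2)) := by
    have h2 : (1 + t) / 2 ≤ 1 + t / 2 := by linarith
    calc (1 + t / 2) ^ (-((d : ℝ) / 2)) ≤ ((1 + t) / 2) ^ (-((d : ℝ) / 2)) :=
          Real.rpow_le_rpow_of_nonpos (by positivity) h2
            (neg_nonpos.2 (by positivity))
      _ = _ := by
          rw [Real.div_rpow h1.le (by norm_num), Real.rpow_neg (by norm_num : (0 : ℝ) ≤ 2),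
            div_inv_eq_mul, mul_comm]
  have hheat' := hheat n (t / 2) (by positivity)
  have h2pow : (1 : ℝ) ≤ 2 ^ ((d : ℝ) / 2) := Real.one_le_rpow (by norm_num) (by positivity)
  have herase : ∑ ξ ∈ Finset.univ.erase (0 : Torus d n), Real.exp (-(t / 2 * srwEigenvalue ξ)) ≤
      ∑ ξ : Torus d n, Real.exp (-(t / 2 * srwEigenvalue ξ)) :=
    Finset.sum_le_sum_of_subset_of_nonneg (Finset.subset_univ _) fun _ _ _ => (Real.exp_pos _).le
  have hprof := mul_rpow_neg_two_le (n := n) d ht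
  have hprof' : ((n : ℝ) ^ (d + 4))⁻¹ ≤ decayProfile d n t := by
    rw [decayProfile]; exact le_add_of_nonneg_left (by positivity)
  calc _ ≤ ((n : ℝ) ^ d)⁻¹ * (2 * d * (1600 * ((n : ℝ) ^ 4)⁻¹) +
        24 * ((1 + t) ^ 2)⁻¹ * ∑ ξ : Torus d n, Real.exp (-(t / 2 * srwEigenvalue ξ))) := by
        gcongr
        refine (Finset.sum_le_sum hsplit).trans ?_
        rw [Finset.sum_add_distrib, ← Finset.mul_sum]
        gcongr
    _ = 2 * d * 1600 * ((n : ℝ) ^ (d + 4))⁻¹ + 24 * ((1 + t) ^ 2)⁻¹ *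
        (((n : ℝ) ^ d)⁻¹ * ∑ ξ : Torus d n, Real.exp (-(t / 2 * srwEigenvalue ξ))) := by
        rw [pow_add, mul_inv]; ring
    _ ≤ 2 * d * 1600 * decayProfile d n t + 24 * ((1 + t) ^ 2)⁻¹ *
        (C * (2 ^ ((d : ℝ) / 2) * ((1 + t) ^ (-((d : ℝ) / 2)) + ((n : ℝ) ^ d)⁻¹))) := by
        refine add_le_add (by gcongr) (mul_le_mul_of_nonneg_left (hheat'.trans ?_) (by positivity))
        refine mul_le_mul_of_nonneg_left ?_ hC.le
        rw [mul_add]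
        exact add_le_add hhalf (le_mul_of_one_le_left (by positivity) h2pow)
    _ = 2 * d * 1600 * decayProfile d n t + 24 * (C * 2 ^ ((d : ℝ) / 2)) *
        (((1 + t) ^ (-((d : ℝ) / 2)) + ((n : ℝ) ^ d)⁻¹) * ((1 + t) ^ 2)⁻¹) := by ring
    _ ≤ 2 * d * 1600 * decayProfile d n t + 24 * (C * 2 ^ ((d : ℝ) / 2)) *
        (2 * decayProfile d n t) := by gcongr
    _ = _ := by ring

/-- The mass of the tilted renewal kernel is below one. -/
lemma tilted_kernel_mass_le (hd : 1 ≤ d) (hn : 19 ≤ n) {ρ : ℝ}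
    (hρ : 102400 / (n : ℝ) ^ (d + 4) ≤ ρ) :
    ((n : ℝ) ^ d)⁻¹ * ∑ ξ ∈ Finset.univ.erase (0 : Torus d n),
      srwEigenvalue ξ ^ 2 / (2 * srwEigenvalue ξ - (2 * (gapOne n / d) - ρ)) ≤ 3 / 4 := by
  classical
  have hd0 : (1 : ℝ) ≤ d := by exact_mod_cast hd
  have hn0 : (19 : ℝ) ≤ n := by exact_mod_cast hn
  have hnpos : (0 : ℝ) < n := by linarith
  have hρ0 : 0 < ρ := lt_of_lt_of_le (by positivity) hρ
  set l₁ := gapOne n / d with hl₁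
  have hl1pos : 0 < l₁ := by
    have := le_gapOne (n := n) (by omega)
    have h8 : 0 < 8 / (n : ℝ) ^ 2 := by positivity
    rw [hl₁]; exact div_pos (h8.trans_le this) (by linarith)
  have hl1n : l₁ ≤ 20 / (d * (n : ℝ) ^ 2) := by
    rw [hl₁, div_le_iff₀ (by linarith)]
    refine (gapOne_le n).trans (le_of_eq ?_)
    field_simp
  have hl1small : l₁ ≤ 1 / 16 := by
    refine hl1n.trans ?_
    rw [div_le_div_iff₀ (by positivity) (by norm_num)]
    nlinarith
  -- Near the gap the denominator is at least `ρ`. For `λ ≥ 2 l₁` one has `(λ/2 + l₁)(2λ - 2l₁) ≥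
  -- λ²`; since eigenvalues average to one, the terms `λ/2` contribute the untilted mass `1/2`.
  have hterm : ∀ ξ ∈ Finset.univ.erase (0 : Torus d n),
      srwEigenvalue ξ ^ 2 / (2 * srwEigenvalue ξ - (2 * l₁ - ρ)) ≤
        (if ξ ∈ lowFrequencies d n then 4 * l₁ ^ 2 / ρ else 0) + (srwEigenvalue ξ / 2 + l₁) := by
    intro ξ hξ
    have hξ0 := Finset.ne_of_mem_erase hξ
    have hlam := srwEigenvalue_nonneg ξ
    have hgap := gapOne_div_le_srwEigenvalue hξ0
    rw [← hl₁] at hgap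
    split_ifs with hlow
    · have h2 : srwEigenvalue ξ < 2 * l₁ := by
        simp only [lowFrequencies, Finset.mem_filter] at hlow
        exact hlow.2.2
      have h3 : srwEigenvalue ξ ^ 2 / (2 * srwEigenvalue ξ - (2 * l₁ - ρ)) ≤ (2 * l₁) ^ 2 / ρ := by
        gcongr
        linarith
      have h4 : (2 * l₁) ^ 2 / ρ = 4 * l₁ ^ 2 / ρ := by ring
      linarith
    · have h2 := two_mul_gap_le_of_notMem hξ0 hlow
      rw [← hl₁] at h2
      rw [zero_add, div_le_iff₀ (by linarith)]
      nlinarith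
  have hlowsum : ∑ ξ ∈ Finset.univ.erase (0 : Torus d n),
      (if ξ ∈ lowFrequencies d n then 4 * l₁ ^ 2 / ρ else 0) ≤ 2 * d * (4 * l₁ ^ 2 / ρ) := by
    calc _ ≤ ∑ ξ : Torus d n, (if ξ ∈ lowFrequencies d n then 4 * l₁ ^ 2 / ρ else 0) :=
          Finset.sum_le_sum_of_subset_of_nonneg (Finset.subset_univ _)
            fun _ _ _ => by split_ifs <;> positivity
      _ = (lowFrequencies d n).card * (4 * l₁ ^ 2 / ρ) := by
          rw [← Finset.sum_filter, Finset.sum_const, nsmul_eq_mul]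
          congr 3
          ext; simp
      _ ≤ _ := by
          have : ((lowFrequencies d n).card : ℝ) ≤ 2 * d := by
            exact_mod_cast card_lowFrequencies_le (by omega)
          gcongr
  have hmain : ∑ ξ ∈ Finset.univ.erase (0 : Torus d n), (srwEigenvalue ξ / 2 + l₁) ≤
      (n : ℝ) ^ d * (1 / 2 + l₁) := by
    calc _ ≤ ∑ ξ : Torus d n, (srwEigenvalue ξ / 2 + l₁) :=
          Finset.sum_le_sum_of_subset_of_nonneg (Finset.subset_univ _)
            fun ξ _ _ => by have := srwEigenvalue_nonneg ξ; positivity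
      _ = _ := by
          rw [Finset.sum_add_distrib, ← Finset.sum_div, sum_srwEigenvalue hd (by omega)]
          simp [ZMod.card]
          ring
  -- This dictates the size of `ρ`: with `l₁ ≤ 20 / (d n²)`, the constant `102400` makes the left
  -- side at most `n^d / (32 d)`. The total mass is then at most `1/2 + 1/16 + 1/8`.
  have hlow2 : 2 * d * (4 * l₁ ^ 2 / ρ) ≤ (n : ℝ) ^ d * (1 / 8) := by
    have h1 : l₁ ^ 2 ≤ (20 / (d * (n : ℝ) ^ 2)) ^ 2 := by gcongr
    calc 2 * d * (4 * l₁ ^ 2 / ρ) ≤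
        2 * d * (4 * (20 / (d * (n : ℝ) ^ 2)) ^ 2 / (102400 / (n : ℝ) ^ (d + 4))) := by gcongr
      _ = (n : ℝ) ^ d * (1 / 32) * (1 / d) := by
          rw [pow_add]
          field_simp
          norm_num
      _ ≤ (n : ℝ) ^ d * (1 / 32) * 1 := by
          gcongr
          rw [div_le_one (by linarith)]
          exact hd0
      _ ≤ _ := by
          have : (0 : ℝ) < (n : ℝ) ^ d := by positivity
          linarith
  rw [inv_mul_le_iff₀ (by positivity)]
  refine (Finset.sum_le_sum hterm).trans ?_
  rw [Finset.sum_add_distrib]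
  have : (0 : ℝ) < (n : ℝ) ^ d := by positivity
  nlinarith

/-- Lower bound for the spectral sums. -/
lemma exists_le_spectral_sum (d : ℕ) (hd : 1 ≤ d) (p : ℕ) : ∃ c : ℝ, 0 < c ∧
    ∀ (n : ℕ) [NeZero n], 3 ≤ n → ∀ t : ℝ, 16 ≤ t →
    c / min (t ^ ((d : ℝ) / 2 + p)) ((n : ℝ) ^ (d + 2 * p)) *
      Real.exp (-(2 * (gapOne n / d)) * t) ≤
    ((n : ℝ) ^ d)⁻¹ * ∑ ξ ∈ Finset.univ.erase (0 : Torus d n),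
      srwEigenvalue ξ ^ p * Real.exp (-(2 * srwEigenvalue ξ * t)) := by
  classical
  have hd0 : (1 : ℝ) ≤ d := by exact_mod_cast hd
  -- The first constant comes from a box of frequencies with `2/t ≤ λ ≤ 80/t`, the second from one
  -- gap frequency and `gapOne n ≥ 8 / n²`.
  refine ⟨min (Real.exp (-160) * 2 ^ p) ((8 / d) ^ p), by positivity, fun n _ hn3 t ht => ?_⟩
  set c := min (Real.exp (-160) * 2 ^ p) ((8 / (d : ℝ)) ^ p)
  have hn0 : (3 : ℝ) ≤ n := by exact_mod_cast hn3
  have hn : (0 : ℝ) < n := by linarith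
  have ht0 : 0 < t := by linarith
  have hgap := le_gapOne (n := n) (by omega)
  have hgap0 : 0 ≤ gapOne n := le_trans (by positivity) hgap
  have hpos : ∀ ξ : Torus d n, 0 ≤ srwEigenvalue ξ ^ p * Real.exp (-(2 * srwEigenvalue ξ * t)) :=
    fun ξ => mul_nonneg (pow_nonneg (srwEigenvalue_nonneg ξ) p) (Real.exp_pos _).le
  have hnpow : ((n : ℝ) ^ 2) ^ ((d : ℝ) / 2 + p) = (n : ℝ) ^ (d + 2 * p) := by
    rw [← Real.rpow_natCast (n : ℝ) 2, ← Real.rpow_mul hn.le, ← Real.rpow_natCast]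
    congr 1; push_cast; ring
  have hexp0 : (0 : ℝ) ≤ (d : ℝ) / 2 + p := by positivity
  rcases le_total t ((n : ℝ) ^ 2) with htn | htn
  · rw [min_eq_left (by rw [← hnpow]; gcongr)]
    have hsq : 0 < Real.sqrt t := Real.sqrt_pos.2 ht0
    have hsq4 : 4 ≤ Real.sqrt t := Real.le_sqrt_of_sq_le (by linarith)
    have hsqn : Real.sqrt t ≤ n := Real.sqrt_le_iff.2 ⟨hn.le, htn⟩
    -- All coordinates will lie between `r` and `2r`, giving `(r + 1)^d ≥ (n/√t)^d` frequencies. As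
    -- `t ≥ 16`, `2r` is at most `n/2`, so these integers are their own minimal representatives.
    set r := ⌊(n : ℝ) / Real.sqrt t⌋₊ with hr
    have hq1 : 1 ≤ (n : ℝ) / Real.sqrt t := by rwa [one_le_div hsq]
    have hr1 : 1 ≤ r := Nat.le_floor (by simpa using hq1)
    have hr1' : (1 : ℝ) ≤ r := by exact_mod_cast hr1
    have hrle : (r : ℝ) ≤ n / Real.sqrt t := Nat.floor_le (by positivity)
    have hrlt : (n : ℝ) / Real.sqrt t < r + 1 := Nat.lt_floor_add_one _
    have h2r : 2 * r ≤ n / 2 := by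
      rw [Nat.le_div_iff_mul_le two_pos]
      have h1 : (r : ℝ) ≤ n / 4 := hrle.trans (by gcongr)
      have : (r : ℝ) * 4 ≤ n := by linarith
      have : r * 4 ≤ n := by exact_mod_cast this
      omega
    let emb : ℕ → ZMod n := fun m => (m : ZMod n)
    have hval : ∀ m ∈ Finset.Icc r (2 * r), (emb m).valMinAbs = m := fun m hm =>
      ZMod.valMinAbs_natCast_of_le_half ((Finset.mem_Icc.1 hm).2.trans h2r)
    let S : Finset (ZMod n) := (Finset.Icc r (2 * r)).image emb
    have hScard : S.card = r + 1 := by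
      rw [Finset.card_image_of_injOn, Nat.card_Icc]
      · omega
      · intro a ha b hb hab
        have h1 := hval a ha
        have h2 := hval b hb
        rw [hab, h2] at h1
        exact_mod_cast h1.symm
    let T : Finset (Torus d n) := Fintype.piFinset fun _ => S
    have hTcard : T.card = (r + 1) ^ d := by
      simp [T, Fintype.card_piFinset, hScard]
    have hTmem : ∀ ξ ∈ T, ∀ k, (r : ℝ) ≤ (ξ k).valMinAbs ∧ ((ξ k).valMinAbs : ℝ) ≤ 2 * r := by
      intro ξ hξ k
      obtain ⟨m, hm, hmk⟩ := Finset.mem_image.1 (Fintype.mem_piFinset.1 hξ k)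
      rw [← hmk, hval m hm]
      have := Finset.mem_Icc.1 hm
      constructor
      · exact_mod_cast this.1
      · exact_mod_cast this.2
    have hrn1 : 1 / (4 * t) ≤ (r : ℝ) ^ 2 / n ^ 2 := by
      have h1 : (n : ℝ) / Real.sqrt t ≤ 2 * r := by linarith
      have h2 : ((n : ℝ) / Real.sqrt t) ^ 2 ≤ (2 * r) ^ 2 := by gcongr
      rw [div_pow, Real.sq_sqrt ht0.le, div_le_iff₀ ht0] at h2
      rw [div_le_div_iff₀ (by positivity) (by positivity)]
      nlinarith
    have hrn2 : (r : ℝ) ^ 2 / n ^ 2 ≤ 1 / t := by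
      have h2 : (r : ℝ) ^ 2 ≤ ((n : ℝ) / Real.sqrt t) ^ 2 := by gcongr
      rw [div_pow, Real.sq_sqrt ht0.le, le_div_iff₀ ht0] at h2
      rw [div_le_div_iff₀ (by positivity) (by positivity)]
      linarith
    have hlow : ∀ ξ ∈ T, 2 / t ≤ srwEigenvalue ξ := by
      intro ξ hξ
      rw [srwEigenvalue_eq, one_div_mul_eq_div, le_div_iff₀ (by linarith)]
      calc 2 / t * d = ∑ _k : Fin d, 2 / t := by simp [mul_comm]
        _ ≤ _ := Finset.sum_le_sum fun k _ => by
          refine le_trans ?_ (le_cycleEigenvalue (ξ k))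
          have h1 := (hTmem ξ hξ k).1
          calc 2 / t = 8 * (1 / (4 * t)) := by field_simp; norm_num
            _ ≤ 8 * ((r : ℝ) ^ 2 / n ^ 2) := by gcongr
            _ ≤ _ := by gcongr
    have hupp : ∀ ξ ∈ T, srwEigenvalue ξ ≤ 80 / t := by
      intro ξ hξ
      rw [srwEigenvalue_eq, one_div_mul_eq_div, div_le_iff₀ (by linarith)]
      calc _ ≤ ∑ _k : Fin d, 80 / t := Finset.sum_le_sum fun k _ => by
            refine (cycleEigenvalue_le (ξ k)).trans ?_
            have h1 := hTmem ξ hξ k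
            have h0 : (0 : ℝ) ≤ (ξ k).valMinAbs := by linarith [h1.1]
            calc 20 * (((ξ k).valMinAbs : ℝ) ^ 2 / n ^ 2) ≤ 20 * ((2 * r) ^ 2 / (n : ℝ) ^ 2) := by
                  gcongr
                  exact h1.2
              _ = 80 * ((r : ℝ) ^ 2 / n ^ 2) := by ring
              _ ≤ 80 * (1 / t) := by gcongr
              _ = 80 / t := by ring
        _ = 80 / t * d := by simp [mul_comm]
    have hTsub : T ⊆ Finset.univ.erase 0 := by
      intro ξ hξ
      refine Finset.mem_erase.2 ⟨?_, Finset.mem_univ ξ⟩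
      rintro rfl
      have h1 := hlow 0 hξ
      rw [srwEigenvalue_zero] at h1
      have : 0 < 2 / t := by positivity
      linarith
    have hsum : (r + 1 : ℝ) ^ d * ((2 / t) ^ p * Real.exp (-160)) ≤
        ∑ ξ ∈ Finset.univ.erase (0 : Torus d n),
          srwEigenvalue ξ ^ p * Real.exp (-(2 * srwEigenvalue ξ * t)) := by
      refine le_trans ?_ (Finset.sum_le_sum_of_subset_of_nonneg hTsub fun ξ _ _ => hpos ξ)
      have h1 : (r + 1 : ℝ) ^ d * ((2 / t) ^ p * Real.exp (-160)) =
          T.card • ((2 / t) ^ p * Real.exp (-160)) := by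
        rw [hTcard, nsmul_eq_mul]; push_cast; rfl
      rw [h1]
      refine Finset.card_nsmul_le_sum _ _ _ fun ξ hξ => ?_
      have h2 := hlow ξ hξ
      have h3 := hupp ξ hξ
      have h4 := srwEigenvalue_nonneg ξ
      rw [le_div_iff₀ ht0] at h3
      gcongr
      linarith
    have hrpow : t ^ (-((d : ℝ) / 2)) ≤ ((n : ℝ) ^ d)⁻¹ * (r + 1 : ℝ) ^ d := by
      have h1 : t ^ (-((d : ℝ) / 2)) = ((Real.sqrt t)⁻¹) ^ d := by
        rw [Real.sqrt_eq_rpow, ← Real.rpow_neg ht0.le, ← Real.rpow_natCast,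
          ← Real.rpow_mul ht0.le]
        congr 1; ring
      rw [h1, ← inv_pow, ← mul_pow]
      gcongr
      rw [inv_mul_eq_div, le_div_iff₀ hn, inv_mul_eq_div]
      exact hrlt.le
    have hexple : Real.exp (-(2 * (gapOne n / d)) * t) ≤ 1 := by
      refine Real.exp_le_one_iff.2 ?_
      have : 0 ≤ gapOne n / d := by positivity
      nlinarith
    calc c / t ^ ((d : ℝ) / 2 + p) * Real.exp (-(2 * (gapOne n / d)) * t)
        ≤ (Real.exp (-160) * 2 ^ p) / t ^ ((d : ℝ) / 2 + p) * 1 := by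
          gcongr
          exact min_le_left _ _
      _ = t ^ (-((d : ℝ) / 2)) * ((2 / t) ^ p * Real.exp (-160)) := by
          rw [Real.rpow_add ht0, Real.rpow_neg ht0.le, Real.rpow_natCast, div_pow]
          field_simp
      _ ≤ ((n : ℝ) ^ d)⁻¹ * (r + 1 : ℝ) ^ d * ((2 / t) ^ p * Real.exp (-160)) := by gcongr
      _ ≤ _ := by
          rw [mul_assoc]
          gcongr
  · rw [min_eq_right (by rw [← hnpow]; gcongr)]
    -- Past the diffusive time one frequency at the spectral gap is enough.
    let e : Torus d n := Pi.single ⟨0, hd⟩ 1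
    have hval1 : (1 : ZMod n).valMinAbs = 1 := by
      have := ZMod.valMinAbs_natCast_of_le_half (n := n) (a := 1) (by omega)
      simpa using this
    have hcyc1 : cycleEigenvalue (1 : ZMod n) = gapOne n := by
      simp [cycleEigenvalue, gapOne, hval1]
    have hcyc0 : cycleEigenvalue (0 : ZMod n) = 0 := by simp [cycleEigenvalue]
    have he : srwEigenvalue e = gapOne n / d := by
      rw [srwEigenvalue_eq, Finset.sum_eq_single ⟨0, hd⟩]
      · simp [e, hcyc1, div_eq_inv_mul]
      · intro k _ hk
        simp [e, hk, hcyc0]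
      · simp
    have hemem : e ∈ Finset.univ.erase (0 : Torus d n) := by
      refine Finset.mem_erase.2 ⟨fun h0 => ?_, Finset.mem_univ _⟩
      have := congrFun h0 ⟨0, hd⟩
      simp [e] at this
      exact zmod_one_ne_zero hn3 this
    calc c / (n : ℝ) ^ (d + 2 * p) * Real.exp (-(2 * (gapOne n / d)) * t)
        ≤ (8 / (d : ℝ)) ^ p / (n : ℝ) ^ (d + 2 * p) * Real.exp (-(2 * (gapOne n / d)) * t) := by
          gcongr
          exact min_le_right _ _
      _ = ((n : ℝ) ^ d)⁻¹ * ((8 / (n : ℝ) ^ 2 / d) ^ p *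
            Real.exp (-(2 * (gapOne n / d) * t))) := by
          rw [pow_add, pow_mul, div_pow, div_pow, div_pow, neg_mul]
          field_simp
      _ ≤ ((n : ℝ) ^ d)⁻¹ * (srwEigenvalue e ^ p * Real.exp (-(2 * srwEigenvalue e * t))) := by
          rw [he]
          gcongr
      _ ≤ _ := by
          gcongr
          exact Finset.single_le_sum (fun ξ _ => hpos ξ) hemem

end HeatTrace

/-! ### Calculus on the half-line. -/

section HalfLine

lemma antitoneOn_Ici_of_hasDerivWithinAt {f f' : ℝ → ℝ}
    (hf : ∀ t, 0 ≤ t → HasDerivWithinAt f (f' t) (Set.Ici 0) t) (hf' : ∀ t, 0 ≤ t → f' t ≤ 0) :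
    AntitoneOn f (Set.Ici 0) := by
  refine antitoneOn_of_hasDerivWithinAt_nonpos (f' := f') (convex_Ici 0)
    (fun t ht => (hf t ht).continuousWithinAt) (fun t ht => ?_) fun t ht => hf' t (interior_subset ht)
  exact (hf t (interior_subset ht)).mono interior_subset

lemma integral_eq_sub_of_hasDerivWithinAt_Ici {f f' : ℝ → ℝ}
    (hf : ∀ t, 0 ≤ t → HasDerivWithinAt f (f' t) (Set.Ici 0) t)
    (hf' : ContinuousOn f' (Set.Ici 0)) {a b : ℝ} (ha : 0 ≤ a) (hab : a ≤ b) :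
    ∫ s in a..b, f' s = f b - f a := by
  have hsub : Set.Icc a b ⊆ Set.Ici 0 := fun s hs => ha.trans hs.1
  refine intervalIntegral.integral_eq_sub_of_hasDerivAt_of_le hab
    (fun t ht => ((hf t (hsub ht)).continuousWithinAt).mono hsub) (fun t ht => ?_) ?_
  · exact (hf t (ha.trans ht.1.le)).hasDerivAt (Ici_mem_nhds (lt_of_le_of_lt ha ht.1))
  · refine ContinuousOn.intervalIntegrable ?_
    rw [Set.uIcc_of_le hab]
    exact hf'.mono hsub

end HalfLine

/-! ### The closed linear system for the mean power spectrum. -/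

section PowerFlow

variable {d n : ℕ} [NeZero n]

/-- Intensity of the mass fluctuations. -/
noncomputable def flowSource (a : Torus d n → ℝ → ℝ) (t : ℝ) : ℝ :=
  ((n : ℝ) ^ d)⁻¹ * ∑ ξ, srwEigenvalue ξ ^ 2 * a ξ t

/-- Only one factor `n^{-d}` is kept: for the process this is `n^d` times the expected
`spatialEnergy`, the scale of the squared total mass. `flowVariance` is scaled in the same way. -/
noncomputable def flowEnergy (a : Torus d n → ℝ → ℝ) (t : ℝ) : ℝ :=
  ((n : ℝ) ^ d)⁻¹ * ∑ ξ, srwEigenvalue ξ * a ξ t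

noncomputable def flowVariance (a : Torus d n → ℝ → ℝ) (t : ℝ) : ℝ :=
  ((n : ℝ) ^ d)⁻¹ * ∑ ξ ∈ Finset.univ.erase 0, a ξ t

/-- The evolution of the expected power spectrum. -/
structure IsPowerFlow (a : Torus d n → ℝ → ℝ) : Prop where
  nonneg : ∀ ξ t, 0 ≤ t → 0 ≤ a ξ t
  init : ∀ ξ, a ξ 0 = 1
  deriv : ∀ ξ t, 0 ≤ t →
    HasDerivWithinAt (a ξ) (-(2 * srwEigenvalue ξ) * a ξ t + flowSource a t) (Set.Ici 0) t

lemma hasDerivWithinAt_exp_mul {c : ℝ} {s : Set ℝ} {t : ℝ} :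
    HasDerivWithinAt (fun t : ℝ => Real.exp (c * t)) (c * Real.exp (c * t)) s t := by
  have h := ((hasDerivAt_id t).const_mul c).exp.hasDerivWithinAt (s := s)
  simpa [mul_comm] using h

lemma sum_erase_eq_sum (f : Torus d n → ℝ) (h : f 0 = 0) :
    ∑ ξ ∈ Finset.univ.erase 0, f ξ = ∑ ξ, f ξ :=
  Finset.sum_erase _ h

lemma natCast_pow_pos : (0 : ℝ) < (n : ℝ) ^ d := by
  have : (0 : ℝ) < n := Nat.cast_pos.2 (NeZero.pos n)
  positivity

namespace IsPowerFlow

variable {a : Torus d n → ℝ → ℝ}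

lemma continuousOn (h : IsPowerFlow a) (ξ : Torus d n) : ContinuousOn (a ξ) (Set.Ici 0) :=
  fun t ht => (h.deriv ξ t ht).continuousWithinAt

lemma continuousOn_source (h : IsPowerFlow a) : ContinuousOn (flowSource a) (Set.Ici 0) :=
  continuousOn_const.mul (continuousOn_finsetSum _ fun ξ _ =>
    continuousOn_const.mul (h.continuousOn ξ))

lemma source_nonneg (h : IsPowerFlow a) {t : ℝ} (ht : 0 ≤ t) : 0 ≤ flowSource a t :=
  mul_nonneg (by positivity) (Finset.sum_nonneg fun ξ _ =>
    mul_nonneg (sq_nonneg _) (h.nonneg ξ t ht))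

lemma energy_nonneg (h : IsPowerFlow a) {t : ℝ} (ht : 0 ≤ t) : 0 ≤ flowEnergy a t :=
  mul_nonneg (by positivity) (Finset.sum_nonneg fun ξ _ =>
    mul_nonneg (srwEigenvalue_nonneg ξ) (h.nonneg ξ t ht))

lemma variance_nonneg (h : IsPowerFlow a) {t : ℝ} (ht : 0 ≤ t) : 0 ≤ flowVariance a t :=
  mul_nonneg (by positivity) (Finset.sum_nonneg fun ξ _ => h.nonneg ξ t ht)

/-- Damping contributes `-2 S`; the common source contributes `S` times the average eigenvalue,
which is one. -/
lemma deriv_energy (h : IsPowerFlow a) (hd : 1 ≤ d) (hn : 3 ≤ n) {t : ℝ} (ht : 0 ≤ t) :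
    HasDerivWithinAt (flowEnergy a) (-flowSource a t) (Set.Ici 0) t := by
  have h1 : HasDerivWithinAt (flowEnergy a) (((n : ℝ) ^ d)⁻¹ * ∑ ξ : Torus d n, srwEigenvalue ξ *
      (-(2 * srwEigenvalue ξ) * a ξ t + flowSource a t)) (Set.Ici 0) t :=
    (HasDerivWithinAt.fun_sum fun ξ _ => (h.deriv ξ t ht).const_mul (srwEigenvalue ξ)).const_mul _
  refine h1.congr_deriv ?_
  have h2 : ∀ ξ : Torus d n, srwEigenvalue ξ * (-(2 * srwEigenvalue ξ) * a ξ t + flowSource a t) =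
      -2 * (srwEigenvalue ξ ^ 2 * a ξ t) + srwEigenvalue ξ * flowSource a t := fun ξ => by ring
  simp_rw [h2]
  rw [Finset.sum_add_distrib, ← Finset.mul_sum, ← Finset.sum_mul, sum_srwEigenvalue hd hn, mul_add,
    inv_mul_cancel_left₀ natCast_pow_pos.ne', mul_left_comm]
  rw [flowSource]
  ring

lemma deriv_variance (h : IsPowerFlow a) {t : ℝ} (ht : 0 ≤ t) :
    HasDerivWithinAt (flowVariance a)
      (-2 * flowEnergy a t + (1 - ((n : ℝ) ^ d)⁻¹) * flowSource a t) (Set.Ici 0) t := by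
  have h1 : HasDerivWithinAt (flowVariance a) (((n : ℝ) ^ d)⁻¹ *
      ∑ ξ ∈ Finset.univ.erase (0 : Torus d n),
        (-(2 * srwEigenvalue ξ) * a ξ t + flowSource a t)) (Set.Ici 0) t :=
    (HasDerivWithinAt.fun_sum fun ξ _ => h.deriv ξ t ht).const_mul _
  refine h1.congr_deriv ?_
  have hpos : (0 : ℝ) < (n : ℝ) ^ d := natCast_pow_pos
  have hcard : ((Finset.univ.erase (0 : Torus d n)).card : ℝ) = (n : ℝ) ^ d - 1 := by
    rw [Finset.cast_card_erase_of_mem (Finset.mem_univ _)]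
    simp [ZMod.card]
  have h2 : ∑ ξ ∈ Finset.univ.erase (0 : Torus d n), srwEigenvalue ξ * a ξ t =
      ∑ ξ, srwEigenvalue ξ * a ξ t := sum_erase_eq_sum _ (by rw [srwEigenvalue_zero, zero_mul])
  have h3 : ∀ ξ : Torus d n, -(2 * srwEigenvalue ξ) * a ξ t + flowSource a t =
      -2 * (srwEigenvalue ξ * a ξ t) + flowSource a t := fun ξ => by ring
  simp_rw [h3]
  rw [Finset.sum_add_distrib, ← Finset.mul_sum, h2, Finset.sum_const, nsmul_eq_mul, hcard, mul_add,
    flowEnergy]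
  field_simp

lemma deriv_zero (h : IsPowerFlow a) {t : ℝ} (ht : 0 ≤ t) :
    HasDerivWithinAt (a 0) (flowSource a t) (Set.Ici 0) t := by
  simpa [srwEigenvalue_zero] using h.deriv 0 t ht

/-- Conservation law relating the second moment of the mass to the energy. -/
lemma zero_add_energy (h : IsPowerFlow a) (hd : 1 ≤ d) (hn : 3 ≤ n) {s t : ℝ} (hs : 0 ≤ s)
    (hst : s ≤ t) : a 0 t - a 0 s = flowEnergy a s - flowEnergy a t := by
  have h1 := integral_eq_sub_of_hasDerivWithinAt_Ici (fun t ht => h.deriv_zero ht)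
    h.continuousOn_source hs hst
  have h2 := integral_eq_sub_of_hasDerivWithinAt_Ici (fun t ht => h.deriv_energy hd hn ht)
    h.continuousOn_source.neg hs hst
  rw [intervalIntegral.integral_neg] at h2
  linarith

lemma energy_le_two_mul_variance (h : IsPowerFlow a) (hd : 1 ≤ d) (hodd : Odd n) {t : ℝ}
    (ht : 0 ≤ t) : flowEnergy a t ≤ 2 * flowVariance a t := by
  rw [flowEnergy, flowVariance, mul_left_comm, Finset.mul_sum _ _ (2 : ℝ), ← sum_erase_eq_sum
    (fun ξ : Torus d n => srwEigenvalue ξ * a ξ t) (by rw [srwEigenvalue_zero, zero_mul])]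
  refine mul_le_mul_of_nonneg_left (Finset.sum_le_sum fun ξ _ => ?_) (by positivity)
  exact mul_le_mul_of_nonneg_right (srwEigenvalue_lt_two hd hodd ξ).le (h.nonneg ξ t ht)

lemma gap_mul_variance_le (h : IsPowerFlow a) {t : ℝ} (ht : 0 ≤ t) :
    gapOne n / d * flowVariance a t ≤ flowEnergy a t := by
  rw [flowEnergy, flowVariance, mul_left_comm, Finset.mul_sum, ← sum_erase_eq_sum
    (fun ξ : Torus d n => srwEigenvalue ξ * a ξ t) (by rw [srwEigenvalue_zero, zero_mul])]
  refine mul_le_mul_of_nonneg_left (Finset.sum_le_sum fun ξ hξ => ?_) (by positivity)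
  exact mul_le_mul_of_nonneg_right (gapOne_div_le_srwEigenvalue (Finset.ne_of_mem_erase hξ))
    (h.nonneg ξ t ht)

/-- The largest of the finitely many eigenvalues serves as `L`; it is strictly below two because `n`
is odd. -/
lemma exists_source_le (h : IsPowerFlow a) (hd : 1 ≤ d) (hodd : Odd n) :
    ∃ L : ℝ, L < 2 ∧ ∀ t, 0 ≤ t → flowSource a t ≤ L * flowEnergy a t := by
  obtain ⟨ξ₀, -, hmax⟩ := Finset.exists_max_image Finset.univ
    (fun ξ : Torus d n => srwEigenvalue ξ) ⟨0, Finset.mem_univ 0⟩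
  refine ⟨srwEigenvalue ξ₀, srwEigenvalue_lt_two hd hodd ξ₀, fun t ht => ?_⟩
  rw [flowSource, flowEnergy, mul_left_comm, Finset.mul_sum _ _ (srwEigenvalue ξ₀)]
  refine mul_le_mul_of_nonneg_left (Finset.sum_le_sum fun ξ _ => ?_) (by positivity)
  rw [sq, mul_assoc]
  exact mul_le_mul_of_nonneg_right (hmax ξ (Finset.mem_univ ξ))
    (mul_nonneg (srwEigenvalue_nonneg ξ) (h.nonneg ξ t ht))

/-- The variance is a Lyapunov function: its derivative is at most `-(2 - L) E`, hence at most `-c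
V`. The rate depends on `n`; only the limit is used, as boundary value at infinity and for almost
sure convergence. -/
lemma tendsto_variance (h : IsPowerFlow a) (hd : 1 ≤ d) (hn : 3 ≤ n) (hodd : Odd n) :
    Tendsto (flowVariance a) atTop (𝓝 0) := by
  obtain ⟨L, hL, hsource⟩ := h.exists_source_le hd hodd
  set c := (2 - L) * (gapOne n / d) with hc
  have hd0 : (0 : ℝ) < d := by exact_mod_cast hd
  have hgap : 0 < gapOne n / d := by
    have := le_gapOne (n := n) (by omega)
    have h3 : (0 : ℝ) < n := by exact_mod_cast (by omega : 0 < n)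
    exact div_pos (lt_of_lt_of_le (by positivity) this) hd0
  have hcpos : 0 < c := mul_pos (by linarith) hgap
  have hanti : AntitoneOn (fun t => flowVariance a t * Real.exp (c * t)) (Set.Ici 0) := by
    refine antitoneOn_Ici_of_hasDerivWithinAt
      (fun t ht => (h.deriv_variance ht).mul hasDerivWithinAt_exp_mul) fun t ht => ?_
    have h1 := hsource t ht
    have h2 := h.gap_mul_variance_le ht
    have h3 := h.source_nonneg ht
    have h4 := Real.exp_pos (c * t)
    have h5 : (0 : ℝ) ≤ ((n : ℝ) ^ d)⁻¹ := by positivity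
    have h6 : c * flowVariance a t ≤ (2 - L) * flowEnergy a t := by
      rw [hc, mul_assoc]
      exact mul_le_mul_of_nonneg_left h2 (by linarith)
    have h7 : -2 * flowEnergy a t + (1 - ((n : ℝ) ^ d)⁻¹) * flowSource a t +
        c * flowVariance a t ≤ 0 := by nlinarith
    have h8 : (-2 * flowEnergy a t + (1 - ((n : ℝ) ^ d)⁻¹) * flowSource a t) * Real.exp (c * t) +
        flowVariance a t * (c * Real.exp (c * t)) =
        (-2 * flowEnergy a t + (1 - ((n : ℝ) ^ d)⁻¹) * flowSource a t +
          c * flowVariance a t) * Real.exp (c * t) := by ring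
    rw [h8]
    exact mul_nonpos_of_nonpos_of_nonneg h7 h4.le
  have hle : ∀ t, 0 ≤ t → flowVariance a t ≤ flowVariance a 0 * Real.exp (-(c * t)) := by
    intro t ht
    have h1 := hanti (Set.self_mem_Ici) ht ht
    simp only [mul_zero, Real.exp_zero, mul_one] at h1
    rw [Real.exp_neg, ← div_eq_mul_inv, le_div_iff₀ (Real.exp_pos _)]
    exact h1
  have hlim : Tendsto (fun t : ℝ => flowVariance a 0 * Real.exp (-(c * t))) atTop (𝓝 0) := by
    have h1 : Tendsto (fun t : ℝ => c * t) atTop atTop := tendsto_id.const_mul_atTop hcpos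
    have h2 := (Real.tendsto_exp_neg_atTop_nhds_zero.comp h1).const_mul (flowVariance a 0)
    simpa using h2
  refine tendsto_of_tendsto_of_tendsto_of_le_of_le' tendsto_const_nhds hlim ?_ ?_
  · filter_upwards [eventually_ge_atTop 0] with t ht using h.variance_nonneg ht
  · filter_upwards [eventually_ge_atTop 0] with t ht using hle t ht

lemma tendsto_energy (h : IsPowerFlow a) (hd : 1 ≤ d) (hn : 3 ≤ n) (hodd : Odd n) :
    Tendsto (flowEnergy a) atTop (𝓝 0) := by
  have h1 := (h.tendsto_variance hd hn hodd).const_mul 2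
  rw [mul_zero] at h1
  refine tendsto_of_tendsto_of_tendsto_of_le_of_le' tendsto_const_nhds h1 ?_ ?_
  · filter_upwards [eventually_ge_atTop 0] with t ht using h.energy_nonneg ht
  · filter_upwards [eventually_ge_atTop 0] with t ht using h.energy_le_two_mul_variance hd hodd ht

/-- Each mode decays at most at the random walk rate. -/
lemma exp_le (h : IsPowerFlow a) (ξ : Torus d n) {t : ℝ} (ht : 0 ≤ t) :
    Real.exp (-(2 * srwEigenvalue ξ * t)) ≤ a ξ t := by
  set c := 2 * srwEigenvalue ξ with hc
  have hanti : AntitoneOn (fun t => -(a ξ t * Real.exp (c * t))) (Set.Ici 0) := by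
    refine antitoneOn_Ici_of_hasDerivWithinAt
      (fun t ht => ((h.deriv ξ t ht).mul hasDerivWithinAt_exp_mul).neg) fun t ht => ?_
    have h1 := mul_nonneg (h.source_nonneg ht) (Real.exp_pos (c * t)).le
    nlinarith
  have h1 := hanti (Set.self_mem_Ici) ht ht
  simp only [mul_zero, Real.exp_zero, mul_one, h.init] at h1
  rw [Real.exp_neg, inv_le_iff_one_le_mul₀ (Real.exp_pos _)]
  linarith

lemma exists_le_energy_variance (d : ℕ) (hd : 1 ≤ d) : ∃ c : ℝ, 0 < c ∧
    ∀ (n : ℕ) [NeZero n], 3 ≤ n → ∀ a : Torus d n → ℝ → ℝ, IsPowerFlow a → ∀ t : ℝ, 16 ≤ t →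
      c / min (t ^ ((d : ℝ) / 2 + 1)) ((n : ℝ) ^ (d + 2)) *
        Real.exp (-(2 * (gapOne n / d)) * t) ≤ flowEnergy a t ∧
      c / min (t ^ ((d : ℝ) / 2)) ((n : ℝ) ^ d) *
        Real.exp (-(2 * (gapOne n / d)) * t) ≤ flowVariance a t := by
  obtain ⟨c₁, hc₁, h₁⟩ := exists_le_spectral_sum d hd 1
  obtain ⟨c₀, hc₀, h₀⟩ := exists_le_spectral_sum d hd 0
  refine ⟨min c₁ c₀, lt_min hc₁ hc₀, fun n _ hn a ha t ht => ⟨?_, ?_⟩⟩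
  · have h := h₁ n hn t ht
    have hn0 : (0 : ℝ) < n := by exact_mod_cast (by omega : 0 < n)
    simp only [Nat.cast_one, mul_one, pow_one] at h
    calc _ ≤ c₁ / min (t ^ ((d : ℝ) / 2 + 1)) ((n : ℝ) ^ (d + 2)) *
        Real.exp (-(2 * (gapOne n / d)) * t) := by
          gcongr
          exact min_le_left _ _
      _ ≤ _ := h
      _ ≤ flowEnergy a t := by
        rw [flowEnergy, ← sum_erase_eq_sum (fun ξ : Torus d n => srwEigenvalue ξ * a ξ t)
          (by rw [srwEigenvalue_zero, zero_mul])]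
        refine mul_le_mul_of_nonneg_left (Finset.sum_le_sum fun ξ _ => ?_) (by positivity)
        exact mul_le_mul_of_nonneg_left (ha.exp_le ξ (by linarith)) (srwEigenvalue_nonneg ξ)
  · have h := h₀ n hn t ht
    have hn0 : (0 : ℝ) < n := by exact_mod_cast (by omega : 0 < n)
    simp only [Nat.cast_zero, mul_zero, add_zero, pow_zero, one_mul] at h
    calc _ ≤ c₀ / min (t ^ ((d : ℝ) / 2)) ((n : ℝ) ^ d) *
        Real.exp (-(2 * (gapOne n / d)) * t) := by
          gcongr
          exact min_le_right _ _
      _ ≤ _ := h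
      _ ≤ flowVariance a t :=
        mul_le_mul_of_nonneg_left (Finset.sum_le_sum fun ξ _ => ha.exp_le ξ (by linarith))
          (by positivity)

end IsPowerFlow

end PowerFlow

/-! ### The renewal equation and the upper bounds. -/

section Renewal

variable {d n : ℕ} [NeZero n]

/-- The renewal kernel tilted at rate `θ`. -/
noncomputable def tiltedKernel (d n : ℕ) [NeZero n] (θ u : ℝ) : ℝ :=
  ((n : ℝ) ^ d)⁻¹ * ∑ ξ ∈ Finset.univ.erase (0 : Torus d n),
    srwEigenvalue ξ ^ 2 * Real.exp (-((2 * srwEigenvalue ξ - θ) * u))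

/-- The integral of `tiltedKernel d n θ` over the half-line, provided `θ` is below twice the gap. -/
noncomputable def tiltedMass (d n : ℕ) [NeZero n] (θ : ℝ) : ℝ :=
  ((n : ℝ) ^ d)⁻¹ * ∑ ξ ∈ Finset.univ.erase (0 : Torus d n),
    srwEigenvalue ξ ^ 2 / (2 * srwEigenvalue ξ - θ)

lemma continuous_tiltedKernel (θ : ℝ) : Continuous (tiltedKernel d n θ) :=
  continuous_const.mul (continuous_finsetSum _ fun ξ _ => by fun_prop)

lemma tiltedKernel_nonneg (θ u : ℝ) : 0 ≤ tiltedKernel d n θ u :=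
  mul_nonneg (by positivity) (Finset.sum_nonneg fun ξ _ => by positivity)

lemma two_mul_srwEigenvalue_sub_pos {θ : ℝ} (hθ : θ < 2 * (gapOne n / d)) {ξ : Torus d n}
    (hξ : ξ ∈ Finset.univ.erase 0) : 0 < 2 * srwEigenvalue ξ - θ := by
  have := gapOne_div_le_srwEigenvalue (Finset.ne_of_mem_erase hξ)
  linarith

lemma integral_tiltedKernel_le {θ : ℝ} (hθ : θ < 2 * (gapOne n / d)) {r t : ℝ} (hr : 0 ≤ r)
    (hrt : r ≤ t) : ∫ s in r..t, tiltedKernel d n θ (t - s) ≤ tiltedMass d n θ := by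
  -- A nonnegative antiderivative of the reversed kernel whose value at `t` is the full mass.
  set H : ℝ → ℝ := fun s => ((n : ℝ) ^ d)⁻¹ * ∑ ξ ∈ Finset.univ.erase (0 : Torus d n),
    srwEigenvalue ξ ^ 2 / (2 * srwEigenvalue ξ - θ) * Real.exp (-((2 * srwEigenvalue ξ - θ) * t)) *
      Real.exp ((2 * srwEigenvalue ξ - θ) * s) with hH
  have hderiv : ∀ s, 0 ≤ s → HasDerivWithinAt H (tiltedKernel d n θ (t - s)) (Set.Ici 0) s := by
    intro s _
    have h1 : HasDerivWithinAt H (((n : ℝ) ^ d)⁻¹ * ∑ ξ ∈ Finset.univ.erase (0 : Torus d n),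
        srwEigenvalue ξ ^ 2 / (2 * srwEigenvalue ξ - θ) *
          Real.exp (-((2 * srwEigenvalue ξ - θ) * t)) * ((2 * srwEigenvalue ξ - θ) *
          Real.exp ((2 * srwEigenvalue ξ - θ) * s))) (Set.Ici 0) s :=
      (HasDerivWithinAt.fun_sum fun ξ _ => hasDerivWithinAt_exp_mul.const_mul _).const_mul _
    refine h1.congr_deriv ?_
    rw [tiltedKernel]
    congr 1
    refine Finset.sum_congr rfl fun ξ hξ => ?_
    have hpos := two_mul_srwEigenvalue_sub_pos hθ hξ
    have h2 : Real.exp (-((2 * srwEigenvalue ξ - θ) * (t - s))) =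
        Real.exp (-((2 * srwEigenvalue ξ - θ) * t)) * Real.exp ((2 * srwEigenvalue ξ - θ) * s) := by
      rw [← Real.exp_add]; ring_nf
    rw [h2]
    linear_combination (Real.exp (-((2 * srwEigenvalue ξ - θ) * t)) *
      Real.exp ((2 * srwEigenvalue ξ - θ) * s)) * div_mul_cancel₀ (srwEigenvalue ξ ^ 2) hpos.ne'
  rw [integral_eq_sub_of_hasDerivWithinAt_Ici hderiv
    ((continuous_tiltedKernel θ).comp (continuous_const.sub continuous_id)).continuousOn hr hrt]
  have hHt : H t = tiltedMass d n θ := by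
    rw [hH, tiltedMass]
    simp only
    congr 1
    refine Finset.sum_congr rfl fun ξ _ => ?_
    rw [mul_assoc, ← Real.exp_add]
    simp
  have hHr : 0 ≤ H r := by
    refine mul_nonneg (by positivity) (Finset.sum_nonneg fun ξ hξ => ?_)
    have hpos := two_mul_srwEigenvalue_sub_pos hθ hξ
    positivity
  linarith

omit [NeZero n] in
/-- The decay profile is almost constant on slightly shorter scales. -/
lemma decayProfile_mul_le {x t : ℝ} (hx : 0 < x) (hx1 : x ≤ 1) (ht : 0 ≤ t) :
    decayProfile d n (x * t) ≤ x ^ (-((d : ℝ) / 2 + 2)) * decayProfile d n t := by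
  have h1 : x * (1 + t) ≤ 1 + x * t := by nlinarith
  have hq : -((d : ℝ) / 2 + 2) ≤ 0 := neg_nonpos.2 (by positivity)
  have hx2 : 1 ≤ x ^ (-((d : ℝ) / 2 + 2)) := Real.one_le_rpow_of_pos_of_le_one_of_nonpos hx hx1 hq
  rw [decayProfile, decayProfile, mul_add]
  refine add_le_add ?_ (le_mul_of_one_le_left (by positivity) hx2)
  rw [← Real.mul_rpow hx.le (by linarith)]
  exact Real.rpow_le_rpow_of_nonpos (by positivity) h1 hq

omit [NeZero n] in
lemma decayProfile_antitone {s t : ℝ} (hs : 0 ≤ s) (hst : s ≤ t) :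
    decayProfile d n t ≤ decayProfile d n s := by
  have hq : -((d : ℝ) / 2 + 2) ≤ 0 := neg_nonpos.2 (by positivity)
  rw [decayProfile, decayProfile]
  gcongr 1
  exact Real.rpow_le_rpow_of_nonpos (by linarith) (by linarith) hq

omit [NeZero n] in
lemma decayProfile_pos {t : ℝ} (ht : 0 ≤ t) : 0 < decayProfile d n t := by
  have : 0 < 1 + t := by linarith
  rw [decayProfile]; positivity

omit [NeZero n] in
lemma continuousOn_decayProfile : ContinuousOn (decayProfile d n) (Set.Ici 0) := by
  refine ContinuousOn.add (ContinuousOn.rpow_const (by fun_prop) fun t ht => Or.inl ?_)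
    continuousOn_const
  have : (0 : ℝ) ≤ t := ht
  positivity

namespace IsPowerFlow

variable {a : Torus d n → ℝ → ℝ}

/-- Renewal equation for the tilted source. -/
lemma renewal (h : IsPowerFlow a) (θ : ℝ) {t : ℝ} (ht : 0 ≤ t) :
    Real.exp (θ * t) * flowSource a t = tiltedKernel d n θ t +
      ∫ s in (0 : ℝ)..t, tiltedKernel d n θ (t - s) * (Real.exp (θ * s) * flowSource a s) := by
  -- Variation of constants: `F` runs from the kernel at `s = 0` to the tilted source at `s = t`,
  -- and the damping cancels from its derivative. The zero mode carries no weight.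
  set F : ℝ → ℝ := fun s => ((n : ℝ) ^ d)⁻¹ * ∑ ξ ∈ Finset.univ.erase (0 : Torus d n),
    srwEigenvalue ξ ^ 2 * Real.exp (-((2 * srwEigenvalue ξ - θ) * t)) *
      (a ξ s * Real.exp (2 * srwEigenvalue ξ * s)) with hF
  have hderiv : ∀ s, 0 ≤ s → HasDerivWithinAt F
      (tiltedKernel d n θ (t - s) * (Real.exp (θ * s) * flowSource a s)) (Set.Ici 0) s := by
    intro s hs
    have h1 : HasDerivWithinAt F (((n : ℝ) ^ d)⁻¹ * ∑ ξ ∈ Finset.univ.erase (0 : Torus d n),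
        srwEigenvalue ξ ^ 2 * Real.exp (-((2 * srwEigenvalue ξ - θ) * t)) *
          ((-(2 * srwEigenvalue ξ) * a ξ s + flowSource a s) *
            Real.exp (2 * srwEigenvalue ξ * s) +
            a ξ s * (2 * srwEigenvalue ξ * Real.exp (2 * srwEigenvalue ξ * s)))) (Set.Ici 0) s :=
      (HasDerivWithinAt.fun_sum fun ξ _ =>
        ((h.deriv ξ s hs).mul hasDerivWithinAt_exp_mul).const_mul _).const_mul _
    refine h1.congr_deriv ?_
    rw [tiltedKernel, mul_assoc, Finset.sum_mul]
    congr 1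
    refine Finset.sum_congr rfl fun ξ _ => ?_
    have h2 : Real.exp (-((2 * srwEigenvalue ξ - θ) * (t - s))) * Real.exp (θ * s) =
        Real.exp (-((2 * srwEigenvalue ξ - θ) * t)) * Real.exp (2 * srwEigenvalue ξ * s) := by
      rw [← Real.exp_add, ← Real.exp_add]; ring_nf
    calc _ = srwEigenvalue ξ ^ 2 * (Real.exp (-((2 * srwEigenvalue ξ - θ) * t)) *
          Real.exp (2 * srwEigenvalue ξ * s)) * flowSource a s := by ring
      _ = _ := by rw [← h2]; ring
  have hcont : ContinuousOn (fun s => tiltedKernel d n θ (t - s) *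
      (Real.exp (θ * s) * flowSource a s)) (Set.Ici 0) :=
    ((continuous_tiltedKernel θ).comp (continuous_const.sub continuous_id)).continuousOn.mul
      ((by fun_prop : Continuous fun s : ℝ => Real.exp (θ * s)).continuousOn.mul
        h.continuousOn_source)
  rw [integral_eq_sub_of_hasDerivWithinAt_Ici hderiv hcont le_rfl ht]
  have hFt : F t = Real.exp (θ * t) * flowSource a t := by
    rw [hF, flowSource, mul_left_comm, ← sum_erase_eq_sum
      (fun ξ : Torus d n => srwEigenvalue ξ ^ 2 * a ξ t)
      (by rw [srwEigenvalue_zero]; ring), Finset.mul_sum _ _ (Real.exp (θ * t))]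
    simp only
    congr 1
    refine Finset.sum_congr rfl fun ξ _ => ?_
    have h2 : Real.exp (θ * t) =
        Real.exp (-((2 * srwEigenvalue ξ - θ) * t)) * Real.exp (2 * srwEigenvalue ξ * t) := by
      rw [← Real.exp_add]; ring_nf
    rw [h2]; ring
  have hF0 : F 0 = tiltedKernel d n θ t := by
    rw [hF, tiltedKernel]
    simp [h.init]
  rw [hFt, hF0]
  ring

lemma continuousOn_tilted (h : IsPowerFlow a) (θ : ℝ) :
    ContinuousOn (fun s => Real.exp (θ * s) * flowSource a s) (Set.Ici 0) :=
  (by fun_prop : Continuous fun s : ℝ => Real.exp (θ * s)).continuousOn.mul h.continuousOn_source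

/-- Total tilted source. -/
lemma integral_tilted_source_le (h : IsPowerFlow a) {θ : ℝ} (hθ : θ < 2 * (gapOne n / d))
    (hmass : tiltedMass d n θ ≤ 3 / 4) {T : ℝ} (hT : 0 ≤ T) :
    ∫ s in (0 : ℝ)..T, Real.exp (θ * s) * flowSource a s ≤ 3 := by
  -- The weights make the tilted damping of `W` equal to minus the tilted source, while the source
  -- feeds in its multiple by the mass `μ`. So `(1 - μ)` times the integral is at most `W 0 = μ`,
  -- which gives `3` when `μ ≤ 3/4`.
  set W : ℝ → ℝ := fun s => ((n : ℝ) ^ d)⁻¹ * ∑ ξ ∈ Finset.univ.erase (0 : Torus d n),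
    srwEigenvalue ξ ^ 2 / (2 * srwEigenvalue ξ - θ) * (a ξ s * Real.exp (θ * s)) with hW
  have hderiv : ∀ s, 0 ≤ s → HasDerivWithinAt W
      ((tiltedMass d n θ - 1) * (Real.exp (θ * s) * flowSource a s)) (Set.Ici 0) s := by
    intro s hs
    have h1 : HasDerivWithinAt W (((n : ℝ) ^ d)⁻¹ * ∑ ξ ∈ Finset.univ.erase (0 : Torus d n),
        srwEigenvalue ξ ^ 2 / (2 * srwEigenvalue ξ - θ) *
          ((-(2 * srwEigenvalue ξ) * a ξ s + flowSource a s) * Real.exp (θ * s) +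
            a ξ s * (θ * Real.exp (θ * s)))) (Set.Ici 0) s :=
      (HasDerivWithinAt.fun_sum fun ξ _ =>
        ((h.deriv ξ s hs).mul hasDerivWithinAt_exp_mul).const_mul _).const_mul _
    refine h1.congr_deriv ?_
    have h2 : ∀ ξ ∈ Finset.univ.erase (0 : Torus d n),
        srwEigenvalue ξ ^ 2 / (2 * srwEigenvalue ξ - θ) *
          ((-(2 * srwEigenvalue ξ) * a ξ s + flowSource a s) * Real.exp (θ * s) +
            a ξ s * (θ * Real.exp (θ * s))) =
        srwEigenvalue ξ ^ 2 / (2 * srwEigenvalue ξ - θ) * (Real.exp (θ * s) * flowSource a s) -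
          Real.exp (θ * s) * (srwEigenvalue ξ ^ 2 * a ξ s) := by
      intro ξ hξ
      have hpos := two_mul_srwEigenvalue_sub_pos hθ hξ
      linear_combination (-Real.exp (θ * s) * a ξ s) *
        div_mul_cancel₀ (srwEigenvalue ξ ^ 2) hpos.ne'
    have hfs : ((n : ℝ) ^ d)⁻¹ * ∑ ξ : Torus d n, srwEigenvalue ξ ^ 2 * a ξ s = flowSource a s :=
      rfl
    rw [Finset.sum_congr rfl h2, Finset.sum_sub_distrib, ← Finset.sum_mul, ← Finset.mul_sum,
      sum_erase_eq_sum (fun ξ : Torus d n => srwEigenvalue ξ ^ 2 * a ξ s)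
        (by rw [srwEigenvalue_zero]; ring), tiltedMass]
    linear_combination (-Real.exp (θ * s)) * hfs
  have hint := integral_eq_sub_of_hasDerivWithinAt_Ici hderiv
    (continuousOn_const.mul (h.continuousOn_tilted θ)) le_rfl hT
  rw [intervalIntegral.integral_const_mul] at hint
  have hW0 : W 0 = tiltedMass d n θ := by
    rw [hW, tiltedMass]; simp [h.init]
  have hWT : 0 ≤ W T := by
    refine mul_nonneg (by positivity) (Finset.sum_nonneg fun ξ hξ => ?_)
    have hpos := two_mul_srwEigenvalue_sub_pos hθ hξ
    have := h.nonneg ξ T hT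
    positivity
  have hG : 0 ≤ ∫ s in (0 : ℝ)..T, Real.exp (θ * s) * flowSource a s :=
    intervalIntegral.integral_nonneg hT fun s hs =>
      mul_nonneg (Real.exp_pos _).le (h.source_nonneg hs.1)
  nlinarith

/-- The renewal integral is cut at `(1 - x) t`. On the early part the kernel has argument at least
`x t` and is comparable with its profile at `t`, while the source has integral at most `3`. On the
late part the source obeys the assumed bound with profile comparable to that at `t`, while the
kernel has mass at most `3/4`. -/
lemma tilted_source_le_aux (h : IsPowerFlow a) {θ C : ℝ}
    (hθ : θ < 2 * (gapOne n / d)) (hmass : tiltedMass d n θ ≤ 3 / 4)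
    (hker : ∀ t, 0 ≤ t → tiltedKernel d n θ t ≤ C * decayProfile d n t)
    {x : ℝ} (hx : 0 < x) (hx1 : x < 1) {t A : ℝ} (ht : 0 ≤ t) (hA0 : 0 ≤ A)
    (hA : ∀ s, 0 ≤ s → s ≤ t →
      Real.exp (θ * s) * flowSource a s ≤ A * decayProfile d n s) :
    Real.exp (θ * t) * flowSource a t ≤
      (C + 3 * C * x ^ (-((d : ℝ) / 2 + 2)) +
        3 / 4 * (1 - x) ^ (-((d : ℝ) / 2 + 2)) * A) * decayProfile d n t := by
  set G : ℝ → ℝ := fun s => Real.exp (θ * s) * flowSource a s with hG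
  set r := (1 - x) * t with hr
  have hr0 : 0 ≤ r := mul_nonneg (by linarith) ht
  have hrt : r ≤ t := by nlinarith
  have hxt : t - r = x * t := by rw [hr]; ring
  have hGc := h.continuousOn_tilted θ
  have hC : 0 ≤ C := by
    have h1 := (tiltedKernel_nonneg (d := d) (n := n) θ 0).trans (hker 0 le_rfl)
    exact nonneg_of_mul_nonneg_left h1 (decayProfile_pos le_rfl)
  have hKc : Continuous fun s => tiltedKernel d n θ (t - s) :=
    (continuous_tiltedKernel θ).comp (continuous_const.sub continuous_id)
  have hii : ∀ {f : ℝ → ℝ} {u v : ℝ}, ContinuousOn f (Set.Ici 0) → 0 ≤ u → u ≤ v →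
      IntervalIntegrable f volume u v := by
    intro f u v hf hu huv
    refine ContinuousOn.intervalIntegrable ?_
    rw [Set.uIcc_of_le huv]
    exact hf.mono fun s hs => hu.trans hs.1
  have hKG : ContinuousOn (fun s => tiltedKernel d n θ (t - s) * G s) (Set.Ici 0) :=
    hKc.continuousOn.mul hGc
  have hGnn : ∀ s, 0 ≤ s → 0 ≤ G s := fun s hs =>
    mul_nonneg (Real.exp_pos _).le (h.source_nonneg hs)
  have hfirst : ∫ s in (0 : ℝ)..r, tiltedKernel d n θ (t - s) * G s ≤
      3 * C * x ^ (-((d : ℝ) / 2 + 2)) * decayProfile d n t := by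
    set M := C * (x ^ (-((d : ℝ) / 2 + 2)) * decayProfile d n t) with hM
    have hM0 : 0 ≤ M := by
      have := (decayProfile_pos (d := d) (n := n) ht).le
      positivity
    have hle : ∀ s ∈ Set.Icc 0 r, tiltedKernel d n θ (t - s) * G s ≤ M * G s := by
      intro s hs
      refine mul_le_mul_of_nonneg_right ?_ (hGnn s hs.1)
      have hs' : x * t ≤ t - s := by rw [← hxt]; linarith [hs.2]
      have hxt0 : 0 ≤ x * t := by positivity
      refine (hker _ (hxt0.trans hs')).trans ?_
      refine mul_le_mul_of_nonneg_left ?_ hC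
      exact (decayProfile_antitone hxt0 hs').trans (decayProfile_mul_le hx hx1.le ht)
    calc _ ≤ ∫ s in (0 : ℝ)..r, M * G s :=
          intervalIntegral.integral_mono_on hr0 (hii hKG le_rfl hr0)
            (hii (continuousOn_const.mul hGc) le_rfl hr0) hle
      _ = M * ∫ s in (0 : ℝ)..r, G s := intervalIntegral.integral_const_mul _ _
      _ ≤ M * 3 := by
          gcongr
          exact h.integral_tilted_source_le hθ hmass hr0
      _ = _ := by rw [hM]; ring
  have hsecond : ∫ s in r..t, tiltedKernel d n θ (t - s) * G s ≤
      3 / 4 * (1 - x) ^ (-((d : ℝ) / 2 + 2)) * A * decayProfile d n t := by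
    set M := A * ((1 - x) ^ (-((d : ℝ) / 2 + 2)) * decayProfile d n t) with hM
    have h1x : 0 < 1 - x := by linarith
    have hM0 : 0 ≤ M := by
      have := (decayProfile_pos (d := d) (n := n) ht).le
      positivity
    have hle : ∀ s ∈ Set.Icc r t, tiltedKernel d n θ (t - s) * G s ≤
        M * tiltedKernel d n θ (t - s) := by
      intro s hs
      rw [mul_comm M]
      refine mul_le_mul_of_nonneg_left ?_ (tiltedKernel_nonneg _ _)
      refine (hA s (hr0.trans hs.1) hs.2).trans ?_
      refine mul_le_mul_of_nonneg_left ?_ hA0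
      exact (decayProfile_antitone hr0 hs.1).trans (decayProfile_mul_le h1x (by linarith) ht)
    calc _ ≤ ∫ s in r..t, M * tiltedKernel d n θ (t - s) :=
          intervalIntegral.integral_mono_on hrt (hii hKG hr0 hrt)
            ((continuous_const.mul hKc).intervalIntegrable _ _) hle
      _ = M * ∫ s in r..t, tiltedKernel d n θ (t - s) := intervalIntegral.integral_const_mul _ _
      _ ≤ M * (3 / 4) := by
          gcongr
          exact (integral_tiltedKernel_le hθ hr0 hrt).trans hmass
      _ = _ := by rw [hM]; ring
  have hren := h.renewal θ ht
  rw [← intervalIntegral.integral_add_adjacent_intervals (hii hKG le_rfl hr0) (hii hKG hr0 hrt)]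
    at hren
  have hk := hker t ht
  calc Real.exp (θ * t) * flowSource a t
      ≤ C * decayProfile d n t + (3 * C * x ^ (-((d : ℝ) / 2 + 2)) * decayProfile d n t +
        3 / 4 * (1 - x) ^ (-((d : ℝ) / 2 + 2)) * A * decayProfile d n t) := by
        rw [hren]
        exact add_le_add hk (add_le_add hfirst hsecond)
    _ = _ := by ring

/-- Pointwise bound on the tilted source: the renewal kernel is subexponential. -/
lemma tilted_source_le (h : IsPowerFlow a) {θ C x : ℝ}
    (hθ : θ < 2 * (gapOne n / d)) (hmass : tiltedMass d n θ ≤ 3 / 4)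
    (hker : ∀ t, 0 ≤ t → tiltedKernel d n θ t ≤ C * decayProfile d n t)
    (hx : 0 < x) (hx1 : x < 1) (hx2 : (1 - x) ^ (-((d : ℝ) / 2 + 2)) ≤ 7 / 6)
    {T : ℝ} (hT : 0 ≤ T) :
    Real.exp (θ * T) * flowSource a T ≤
      8 * (C + 3 * C * x ^ (-((d : ℝ) / 2 + 2))) * decayProfile d n T := by
  set D := C + 3 * C * x ^ (-((d : ℝ) / 2 + 2)) with hD
  -- The auxiliary bound is applied where the ratio attains its maximum `A` on `[0, T]`, so no a
  -- priori estimate is needed.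
  have hcont : ContinuousOn (fun s => Real.exp (θ * s) * flowSource a s / decayProfile d n s)
      (Set.Icc 0 T) :=
    ((h.continuousOn_tilted θ).div continuousOn_decayProfile
      fun s hs => (decayProfile_pos hs).ne').mono fun s hs => hs.1
  obtain ⟨t, ht, hmax⟩ := isCompact_Icc.exists_isMaxOn (Set.nonempty_Icc.2 hT) hcont
  set A := Real.exp (θ * t) * flowSource a t / decayProfile d n t with hAdef
  have hpt := decayProfile_pos (d := d) (n := n) ht.1
  have hA0 : 0 ≤ A := div_nonneg (mul_nonneg (Real.exp_pos _).le (h.source_nonneg ht.1)) hpt.le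
  have hA : ∀ s, 0 ≤ s → s ≤ T →
      Real.exp (θ * s) * flowSource a s ≤ A * decayProfile d n s := by
    intro s hs hsT
    rw [← div_le_iff₀ (decayProfile_pos hs)]
    exact hmax ⟨hs, hsT⟩
  have haux := h.tilted_source_le_aux hθ hmass hker hx hx1 ht.1 hA0
    fun s hs hst => hA s hs (hst.trans ht.2)
  rw [← hD, ← div_le_iff₀ hpt, ← hAdef] at haux
  -- As `3/4 * 7/6 = 7/8`, the inequality reads `A ≤ D + 7/8 A` at worst, and `A` can be absorbed.
  have hA8 : A ≤ 8 * D := by nlinarith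
  exact (hA T hT le_rfl).trans (mul_le_mul_of_nonneg_right hA8 (decayProfile_pos hT).le)

end IsPowerFlow

/-- Integration of a tilted decay bound. -/
lemma le_of_neg_deriv_le {f f' : ℝ → ℝ} {C θ q M : ℝ} (hC : 0 ≤ C) (hθ : 0 < θ) (hq : 0 < q)
    (hf : ∀ t, 0 ≤ t → HasDerivWithinAt f (f' t) (Set.Ici 0) t)
    (hf' : ∀ t, 0 ≤ t → -f' t ≤ C * (Real.exp (-(θ * t)) * ((1 + t) ^ (-(q + 1)) + M)))
    (hlim : Tendsto f atTop (𝓝 0)) {t : ℝ} (ht : 0 ≤ t) :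
    f t ≤ C * (Real.exp (-(θ * t)) * (q⁻¹ * (1 + t) ^ (-q) + M / θ)) := by
  -- A supersolution: `-B'` dominates the bound assumed for `-f'`, up to the constant `C`. Hence `C
  -- * B - f` is nonincreasing, and it vanishes at infinity.
  set B : ℝ → ℝ := fun t => Real.exp (-θ * t) * (q⁻¹ * (1 + t) ^ (-q) + M / θ) with hB
  have hBderiv : ∀ t, 0 ≤ t → HasDerivWithinAt B
      (-θ * Real.exp (-θ * t) * (q⁻¹ * (1 + t) ^ (-q) + M / θ) +
        Real.exp (-θ * t) * (q⁻¹ * (-q * (1 + t) ^ (-q - 1)))) (Set.Ici 0) t := by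
    intro t ht
    have h1 : HasDerivAt (fun t : ℝ => (1 + t) ^ (-q)) (-q * (1 + t) ^ (-q - 1)) t := by
      have h2 := ((hasDerivAt_id t).const_add 1).rpow_const (p := -q)
        (Or.inl (by simp only [id]; linarith))
      simpa using h2
    exact hasDerivWithinAt_exp_mul.mul
      ((h1.hasDerivWithinAt.const_mul q⁻¹).add_const (M / θ))
  have hanti : AntitoneOn (fun t => C * B t - f t) (Set.Ici 0) := by
    refine antitoneOn_Ici_of_hasDerivWithinAt
      (fun t ht => ((hBderiv t ht).const_mul C).sub (hf t ht)) fun t ht => ?_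
    have h1 := hf' t ht
    have h1t : 0 < 1 + t := by linarith
    rw [← neg_mul, neg_add'] at h1
    have h2 : -θ * Real.exp (-θ * t) * (q⁻¹ * (1 + t) ^ (-q) + M / θ) +
        Real.exp (-θ * t) * (q⁻¹ * (-q * (1 + t) ^ (-q - 1))) =
        -(Real.exp (-θ * t) * ((1 + t) ^ (-q - 1) + M)) -
          θ * Real.exp (-θ * t) * (q⁻¹ * (1 + t) ^ (-q)) := by
      field_simp
      ring
    have h3 : 0 ≤ C * (θ * Real.exp (-θ * t) * (q⁻¹ * (1 + t) ^ (-q))) := by positivity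
    rw [h2]
    nlinarith
  have hBlim : Tendsto B atTop (𝓝 0) := by
    have h1 : Tendsto (fun t : ℝ => Real.exp (-θ * t)) atTop (𝓝 0) := by
      have h2 := Real.tendsto_exp_neg_atTop_nhds_zero.comp (tendsto_id.const_mul_atTop hθ)
      refine h2.congr fun t => ?_
      simp
    have h3 : Tendsto (fun t : ℝ => (1 + t) ^ (-q)) atTop (𝓝 0) :=
      (tendsto_rpow_neg_atTop hq).comp (tendsto_atTop_add_const_left _ 1 tendsto_id)
    have h4 := h1.mul ((h3.const_mul q⁻¹).add_const (M / θ))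
    rw [hB]
    simpa [mul_assoc] using h4
  have hlim' : Tendsto (fun t => C * B t - f t) atTop (𝓝 0) := by
    simpa using (hBlim.const_mul C).sub hlim
  have h0 : 0 ≤ C * B t - f t := by
    refine le_of_tendsto hlim' ?_
    filter_upwards [eventually_ge_atTop t] with s hs
    exact hanti ht (ht.trans hs) hs
  rw [hB] at h0
  simp only [neg_mul] at h0
  linarith

/-- Upper bounds on the energy and the variance. -/
theorem exists_energy_variance_le (d : ℕ) (hd : 1 ≤ d) : ∃ C : ℝ, 0 < C ∧ ∃ n₀ : ℕ, 3 ≤ n₀ ∧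
    ∀ (n : ℕ) [NeZero n], n₀ ≤ n → Odd n → ∀ a : Torus d n → ℝ → ℝ, IsPowerFlow a →
    ∀ t : ℝ, 0 ≤ t →
      flowEnergy a t ≤
        C * (Real.exp (-((2 * (gapOne n / d) - 102400 / (n : ℝ) ^ (d + 4)) * t)) *
          ((1 + t) ^ (-((d : ℝ) / 2 + 1)) + ((n : ℝ) ^ (d + 2))⁻¹)) ∧
      flowVariance a t ≤
        C * (Real.exp (-((2 * (gapOne n / d) - 102400 / (n : ℝ) ^ (d + 4)) * t)) *
          ((1 + t) ^ (-((d : ℝ) / 2)) + ((n : ℝ) ^ d)⁻¹)) := by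
  obtain ⟨C₀, hC₀, hker⟩ := tilted_kernel_le d hd
  have hd0 : (1 : ℝ) ≤ d := by exact_mod_cast hd
  set q : ℝ := (d : ℝ) / 2 + 2 with hq
  have hq0 : 0 < q := by positivity
  -- By Bernoulli, `(1 - x)^q ≥ 1 - q x = 6/7`.
  set x : ℝ := 1 / (7 * q) with hx
  have hx0 : 0 < x := by positivity
  have hqx : q * x = 1 / 7 := by rw [hx]; field_simp
  have hx1 : x < 1 := by nlinarith
  have hx2 : (1 - x) ^ (-q) ≤ 7 / 6 := by
    have h1 := one_add_mul_self_le_rpow_one_add (s := -x) (by linarith) (p := q) (by linarith)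
    have h2 : 6 / 7 ≤ (1 - x) ^ q := by
      rw [← sub_eq_add_neg] at h1
      nlinarith
    rw [Real.rpow_neg (by linarith)]
    calc ((1 - x) ^ q)⁻¹ ≤ (6 / 7)⁻¹ := by gcongr
      _ = 7 / 6 := by norm_num
  set C₁ := 8 * (C₀ + 3 * C₀ * x ^ (-q)) with hC₁
  have hC₁0 : 0 < C₁ := by positivity
  -- `19` serves the mass bound. The other threshold gives `ρ ≤ 8 / (d n²)`, half of a lower bound
  -- for twice the gap, so `θ` stays at least `8 / (d n²)`.
  refine ⟨C₁ * (1 + d) + 2 * (C₁ * (1 + d)) * (2 + d), by positivity, max 19 (102400 * d),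
    le_trans (by norm_num) (le_max_left _ _), fun n _ hn hodd a ha t ht => ?_⟩
  have hn19 : 19 ≤ n := (le_max_left _ _).trans hn
  have hnd : (102400 * d : ℝ) ≤ n := by exact_mod_cast (le_max_right _ _).trans hn
  have hn0 : (19 : ℝ) ≤ n := by exact_mod_cast hn19
  have hnpos : (0 : ℝ) < n := by linarith
  have hgap := le_gapOne (n := n) (by omega)
  set ρ : ℝ := 102400 / (n : ℝ) ^ (d + 4) with hρ
  have hρ0 : 0 < ρ := by positivity
  set θ : ℝ := 2 * (gapOne n / d) - ρ with hθ
  have hθlt : θ < 2 * (gapOne n / d) := by linarith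
  have hρle : ρ ≤ 8 / (d * (n : ℝ) ^ 2) := by
    rw [hρ, div_le_div_iff₀ (by positivity) (by positivity)]
    have h1 : (n : ℝ) ^ 1 ≤ (n : ℝ) ^ (d + 2) := pow_le_pow_right₀ (by linarith) (by omega)
    have h2 : (n : ℝ) ^ (d + 4) = (n : ℝ) ^ (d + 2) * (n : ℝ) ^ 2 := by rw [← pow_add]
    rw [h2]
    have h3 : (0 : ℝ) < (n : ℝ) ^ 2 := by positivity
    have h4 : 102400 * (d : ℝ) ≤ 8 * (n : ℝ) ^ (d + 2) := by linarith
    nlinarith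
  have hθge : 8 / (d * (n : ℝ) ^ 2) ≤ θ := by
    have h1 : 2 * (8 / (n : ℝ) ^ 2 / d) ≤ 2 * (gapOne n / d) := by gcongr
    have h2 : 2 * (8 / (n : ℝ) ^ 2 / d) = 2 * (8 / (d * (n : ℝ) ^ 2)) := by
      field_simp
    linarith
  have hθpos : 0 < θ := lt_of_lt_of_le (by positivity) hθge
  -- In the saturated regime each integration divides by `θ`, which costs two powers of `n`: from
  -- `n^{-(d+4)}` to `n^{-(d+2)}` to `n^{-d}`.
  have hdivθ : ∀ m : ℕ, ((n : ℝ) ^ (m + 2))⁻¹ / θ ≤ d * ((n : ℝ) ^ m)⁻¹ := by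
    intro m
    rw [div_le_iff₀ hθpos]
    calc ((n : ℝ) ^ (m + 2))⁻¹ ≤ 8 * ((n : ℝ) ^ (m + 2))⁻¹ := by
          have : 0 ≤ ((n : ℝ) ^ (m + 2))⁻¹ := by positivity
          linarith
      _ = d * ((n : ℝ) ^ m)⁻¹ * (8 / (d * (n : ℝ) ^ 2)) := by
          rw [pow_add]; field_simp
      _ ≤ _ := by gcongr
  have hmass : tiltedMass d n θ ≤ 3 / 4 := tilted_kernel_mass_le hd hn19 le_rfl
  have hsource : ∀ t, 0 ≤ t → flowSource a t ≤
      C₁ * (Real.exp (-(θ * t)) * ((1 + t) ^ (-((d : ℝ) / 2 + 1 + 1)) + ((n : ℝ) ^ (d + 4))⁻¹)) := by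
    intro t ht
    have h1 := ha.tilted_source_le hθlt hmass
      (fun t ht => hker n (by omega) θ hθlt.le t ht) hx0 hx1 hx2 ht
    have h2 : (d : ℝ) / 2 + 1 + 1 = d / 2 + 2 := by ring
    rw [← hC₁, decayProfile] at h1
    rw [h2, Real.exp_neg, mul_left_comm, ← div_eq_inv_mul, le_div_iff₀ (Real.exp_pos _)]
    linarith
  have henergy : ∀ t, 0 ≤ t → flowEnergy a t ≤ C₁ * (1 + d) *
      (Real.exp (-(θ * t)) * ((1 + t) ^ (-((d : ℝ) / 2 + 1)) + ((n : ℝ) ^ (d + 2))⁻¹)) := by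
    intro t ht
    have h1t : 0 < 1 + t := by linarith
    have h1 := le_of_neg_deriv_le hC₁0.le hθpos (q := (d : ℝ) / 2 + 1) (by positivity)
      (M := ((n : ℝ) ^ (d + 4))⁻¹) (fun t ht => ha.deriv_energy hd (by omega) ht)
      (fun t ht => by rw [neg_neg]; exact hsource t ht)
      (ha.tendsto_energy hd (by omega) hodd) ht
    refine h1.trans ?_
    rw [mul_assoc C₁, mul_left_comm (1 + (d : ℝ))]
    refine mul_le_mul_of_nonneg_left (mul_le_mul_of_nonneg_left ?_ (Real.exp_pos _).le) hC₁0.le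
    have h2 : ((d : ℝ) / 2 + 1)⁻¹ ≤ 1 := inv_le_one_of_one_le₀ (by linarith)
    have h3 := hdivθ (d + 2)
    have h4 : 0 ≤ (1 + t) ^ (-((d : ℝ) / 2 + 1)) := by positivity
    have h5 : 0 ≤ ((n : ℝ) ^ (d + 2))⁻¹ := by positivity
    have h6 : ((d : ℝ) / 2 + 1)⁻¹ * (1 + t) ^ (-((d : ℝ) / 2 + 1)) ≤
        1 * (1 + t) ^ (-((d : ℝ) / 2 + 1)) := by gcongr
    nlinarith
  have hvariance : flowVariance a t ≤ 2 * (C₁ * (1 + d)) * (2 + d) *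
      (Real.exp (-(θ * t)) * ((1 + t) ^ (-((d : ℝ) / 2)) + ((n : ℝ) ^ d)⁻¹)) := by
    have h1t : 0 < 1 + t := by linarith
    have h1 := le_of_neg_deriv_le (C := 2 * (C₁ * (1 + d))) (by positivity) hθpos
      (q := (d : ℝ) / 2) (by positivity)
      (M := ((n : ℝ) ^ (d + 2))⁻¹) (fun t ht => ha.deriv_variance ht)
      (fun t ht => by
        have h2 := henergy t ht
        have h3 := ha.source_nonneg ht
        have h4 : ((n : ℝ) ^ d)⁻¹ ≤ 1 := inv_le_one_of_one_le₀ (one_le_pow₀ (by linarith))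
        nlinarith)
      (ha.tendsto_variance hd (by omega) hodd) ht
    refine h1.trans ?_
    rw [mul_assoc (2 * (C₁ * (1 + (d : ℝ)))), mul_left_comm (2 + (d : ℝ))]
    refine mul_le_mul_of_nonneg_left (mul_le_mul_of_nonneg_left ?_ (Real.exp_pos _).le)
      (by positivity)
    have h2 : ((d : ℝ) / 2)⁻¹ ≤ 2 := by
      rw [inv_div, div_le_iff₀ (by linarith)]; linarith
    have h3 := hdivθ d
    have h4 : 0 ≤ (1 + t) ^ (-((d : ℝ) / 2)) := by positivity
    have h5 : 0 ≤ ((n : ℝ) ^ d)⁻¹ := by positivity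
    have h6 : ((d : ℝ) / 2)⁻¹ * (1 + t) ^ (-((d : ℝ) / 2)) ≤
        2 * (1 + t) ^ (-((d : ℝ) / 2)) := by gcongr
    nlinarith
  have h1t : 0 < 1 + t := by linarith
  refine ⟨(henergy t ht).trans ?_, hvariance.trans ?_⟩
  · refine mul_le_mul_of_nonneg_right ?_ (by positivity)
    exact le_add_of_nonneg_right (by positivity)
  · refine mul_le_mul_of_nonneg_right ?_ (by positivity)
    exact le_add_of_nonneg_left (by positivity)

end Renewal

/-! ### Bounded observables and coalescence of configurations. -/

section UnitCube

variable {I : Type*}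

lemma exists_abs_le_of_continuous {ψ : (I → ℝ) → (I → ℝ) → ℝ}
    (hψ : Continuous fun z : (I → ℝ) × (I → ℝ) => ψ z.1 z.2) :
    ∃ B, ∀ x ∈ unitCube I, ∀ y ∈ unitCube I, |ψ x y| ≤ B := by
  have hc : IsCompact (unitCube I) := by
    have h : unitCube I = Set.univ.pi fun _ => Set.Icc (0 : ℝ) 1 := by
      ext y; exact ⟨fun h j _ => h j, fun h j => h j trivial⟩
    rw [h]
    exact isCompact_univ_pi fun _ => isCompact_Icc
  obtain ⟨B, hB⟩ := (hc.prod hc).exists_bound_of_continuousOn hψ.continuousOn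
  exact ⟨B, fun x hx y hy => hB (x, y) ⟨hx, hy⟩⟩

lemma single_mem_unitCube [DecidableEq I] (i : I) : (Pi.single i 1 : I → ℝ) ∈ unitCube I := by
  intro j
  rcases eq_or_ne j i with rfl | hj
  · simp
  · simp [hj]

end UnitCube

section Coalescence

variable {d n : ℕ} [NeZero n]

lemma card_torus : (Fintype.card (Torus d n) : ℝ) = (n : ℝ) ^ d := by
  simp [Torus, ZMod.card]

lemma abs_sub_spatialMean_lt {y : Torus d n → ℝ} {ε : ℝ} (hε : 0 < ε)
    (h : spatialVariance y < ((n : ℝ) ^ d)⁻¹ * ε ^ 2) (j : Torus d n) :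
    |y j - spatialMean y| < ε := by
  have hN : 0 < ((n : ℝ) ^ d)⁻¹ := inv_pos.2 natCast_pow_pos
  have h1 : ∑ i : Torus d n, (y i - spatialMean y) ^ 2 < ε ^ 2 := lt_of_mul_lt_mul_left h hN.le
  have h2 := Finset.single_le_sum (f := fun i : Torus d n => (y i - spatialMean y) ^ 2)
    (fun i _ => sq_nonneg _) (Finset.mem_univ j)
  exact abs_lt_of_sq_lt_sq (h2.trans_lt h1) hε.le

/-- Small variance at a single time puts all values in a short interval, and invariance of intervals
traps every later value there. -/
lemma exists_tendsto_of_spatialVariance {y : ℝ≥0 → Torus d n → ℝ}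
    (hmono : ∀ s t, s ≤ t → ∀ c₁ c₂, (∀ j, y s j ∈ Set.Icc c₁ c₂) → ∀ j, y t j ∈ Set.Icc c₁ c₂)
    (hvar : ∀ δ : ℝ, 0 < δ → ∃ s, spatialVariance (y s) < δ) :
    ∃ L, ∀ j, Tendsto (fun t => y t j) atTop (𝓝 L) := by
  have hN : 0 < ((n : ℝ) ^ d)⁻¹ := inv_pos.2 natCast_pow_pos
  have hclose : ∀ ε : ℝ, 0 < ε → ∃ s, ∃ c, ∀ t, s ≤ t → ∀ j, |y t j - c| ≤ ε := by
    intro ε hε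
    obtain ⟨s, hs⟩ := hvar (((n : ℝ) ^ d)⁻¹ * ε ^ 2) (by positivity)
    refine ⟨s, spatialMean (y s), fun t hst j => ?_⟩
    have h1 := hmono s t hst (spatialMean (y s) - ε) (spatialMean (y s) + ε) (fun j => by
      have h2 := abs_lt.1 (abs_sub_spatialMean_lt hε hs j)
      constructor <;> linarith) j
    rw [abs_le]
    constructor <;> linarith [h1.1, h1.2]
  have hcauchy : CauchySeq fun t => y t 0 := by
    rw [Metric.cauchySeq_iff']
    intro ε hε
    obtain ⟨s, c, h⟩ := hclose (ε / 3) (by positivity)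
    refine ⟨s, fun t hst => ?_⟩
    have h1 := abs_le.1 (h t hst 0)
    have h2 := abs_le.1 (h s le_rfl 0)
    rw [Real.dist_eq, abs_lt]
    constructor <;> linarith
  obtain ⟨L, hL⟩ := cauchySeq_tendsto_of_complete hcauchy
  refine ⟨L, fun j => ?_⟩
  have hdiff : Tendsto (fun t => y t j - y t 0) atTop (𝓝 0) := by
    rw [Metric.tendsto_atTop]
    intro ε hε
    obtain ⟨s, c, h⟩ := hclose (ε / 3) (by positivity)
    refine ⟨s, fun t hst => ?_⟩
    have h1 := abs_le.1 (h t hst 0)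
    have h2 := abs_le.1 (h t hst j)
    rw [Real.dist_eq, sub_zero, abs_lt]
    constructor <;> linarith
  simpa using hdiff.add hL

lemma tendsto_spatialMean {y : ℝ≥0 → Torus d n → ℝ} {L : ℝ}
    (h : ∀ j, Tendsto (fun t => y t j) atTop (𝓝 L)) :
    Tendsto (fun t => spatialMean (y t)) atTop (𝓝 L) := by
  have h1 := (tendsto_finsetSum Finset.univ fun j _ => h j).const_mul ((n : ℝ) ^ d)⁻¹
  have hN : ((n : ℝ) ^ d) ≠ 0 := natCast_pow_pos.ne'
  rwa [Finset.sum_const, Finset.card_univ, nsmul_eq_mul, card_torus, inv_mul_cancel_left₀ hN] at h1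

lemma sum_sub_sq_eq (y : Torus d n → ℝ) (L : ℝ) :
    ∑ j, (y j - L) ^ 2 =
      (n : ℝ) ^ d * spatialVariance y + ((n : ℝ) ^ d)⁻¹ * (∑ j, y j - (n : ℝ) ^ d * L) ^ 2 := by
  have hN : ((n : ℝ) ^ d) ≠ 0 := natCast_pow_pos.ne'
  have hexp : ∀ c : ℝ, ∑ j : Torus d n, (y j - c) ^ 2 =
      ∑ j : Torus d n, y j ^ 2 - 2 * c * ∑ j : Torus d n, y j + (n : ℝ) ^ d * c ^ 2 := by
    intro c
    simp_rw [sub_sq, Finset.sum_add_distrib, Finset.sum_sub_distrib, Finset.sum_const,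
      Finset.card_univ, nsmul_eq_mul, card_torus, Finset.mul_sum]
    congr 2
    exact Finset.sum_congr rfl fun j _ => by ring
  rw [spatialVariance, hexp, hexp, spatialMean]
  field_simp
  ring

end Coalescence

/-! ### The torus process: mean powers, total mass and its limit. -/

section TorusSmoothing

variable {d n : ℕ} [NeZero n]

lemma continuous_torusPower (ξ : Torus d n) : Continuous (torusPower ξ) := by
  unfold torusPower torusFourier
  exact Complex.continuous_normSq.comp (by fun_prop)

lemma sum_ringUpdate_srwMatrix (k : Torus d n) (y : Torus d n → ℝ) :
    ∑ j, ringUpdate (srwMatrix d n) k y j = ∑ j, y j - torusLaplacian y k := by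
  have h := torusFourier_ringUpdate k 0 y
  rw [torusFourier_zero, torusFourier_zero, torusChar_zero_left, mul_one] at h
  exact_mod_cast h

lemma sum_torusLaplacian (hd : 1 ≤ d) (hn : 3 ≤ n) (y : Torus d n → ℝ) :
    ∑ k, torusLaplacian y k = 0 := by
  have h := torusFourier_torusLaplacian hd hn y 0
  rw [torusFourier_zero, srwEigenvalue_zero] at h
  rw [Complex.ofReal_zero, zero_mul] at h
  exact_mod_cast h

variable {Ω : Type*} [MeasurableSpace Ω] {P : Measure Ω} {Y : ℝ≥0 → Ω → Torus d n → ℝ}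
  {i : Torus d n}

/-- Mean Fourier power of the configuration. -/
noncomputable def meanPower (P : Measure Ω) (Y : ℝ≥0 → Ω → Torus d n → ℝ) (ξ : Torus d n)
    (t : ℝ) : ℝ := ∫ ω, torusPower ξ (Y t.toNNReal ω) ∂P

variable [IsProbabilityMeasure P]

namespace IsTorusSmoothing

omit [IsProbabilityMeasure P] in
lemma measurable (h : IsTorusSmoothing i P Y) (t : ℝ≥0) : Measurable (Y t) :=
  IsSmoothingProcess.measurable h t

lemma ae_mem_unitCube (h : IsTorusSmoothing i P Y) (hd : 1 ≤ d) (hn : 3 ≤ n) :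
    ∀ᵐ ω ∂P, ∀ t, Y t ω ∈ unitCube (Torus d n) := by
  obtain ⟨N, hN⟩ := IsSmoothingProcess.exists_driven h
  exact hN.ae_mem_unitCube srwMatrix_nonneg (sum_srwMatrix hd hn) (single_mem_unitCube i)

lemma integrable_pair (h : IsTorusSmoothing i P Y) (hd : 1 ≤ d) (hn : 3 ≤ n)
    {ψ : (Torus d n → ℝ) → (Torus d n → ℝ) → ℝ}
    (hψ : Continuous fun z : (Torus d n → ℝ) × (Torus d n → ℝ) => ψ z.1 z.2) (s t : ℝ≥0) :
    Integrable (fun ω => ψ (Y s ω) (Y t ω)) P := by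
  obtain ⟨N, hN⟩ := IsSmoothingProcess.exists_driven h
  obtain ⟨B, hB⟩ := exists_abs_le_of_continuous hψ
  exact hN.integrable_pair srwMatrix_nonneg (sum_srwMatrix hd hn) (single_mem_unitCube i)
    hψ.measurable hB s t

lemma hasDerivWithinAt_integral (h : IsTorusSmoothing i P Y) (hd : 1 ≤ d) (hn : 3 ≤ n)
    {ψ : (Torus d n → ℝ) → (Torus d n → ℝ) → ℝ}
    (hψ : Continuous fun z : (Torus d n → ℝ) × (Torus d n → ℝ) => ψ z.1 z.2) (s : ℝ≥0) {t : ℝ}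
    (hst : s ≤ t) :
    HasDerivWithinAt (fun t : ℝ => ∫ ω, ψ (Y s ω) (Y t.toNNReal ω) ∂P)
      (∫ ω, ringGenerator (srwMatrix d n) ψ (Y s ω) (Y t.toNNReal ω) ∂P) (Set.Ici (s : ℝ)) t := by
  obtain ⟨N, hN⟩ := IsSmoothingProcess.exists_driven h
  obtain ⟨B, hB⟩ := exists_abs_le_of_continuous hψ
  exact hN.hasDerivWithinAt_integral srwMatrix_nonneg (sum_srwMatrix hd hn) (single_mem_unitCube i)
    hψ.measurable hB s hst

lemma integrable_comp (h : IsTorusSmoothing i P Y) (hd : 1 ≤ d) (hn : 3 ≤ n)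
    {f : (Torus d n → ℝ) → ℝ} (hf : Continuous f) (t : ℝ≥0) : Integrable (fun ω => f (Y t ω)) P :=
  h.integrable_pair hd hn (ψ := fun _ y => f y) (hf.comp continuous_snd) t t

lemma isPowerFlow (h : IsTorusSmoothing i P Y) (hd : 1 ≤ d) (hn : 3 ≤ n) :
    IsPowerFlow (meanPower P Y) where
  nonneg ξ t _ := integral_nonneg fun ω => torusPower_nonneg ξ _
  init ξ := by
    have h1 : ∀ᵐ ω ∂P, torusPower ξ (Y (0 : ℝ).toNNReal ω) = 1 := by
      filter_upwards [IsSmoothingProcess.initial h] with ω hω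
      rw [Real.toNNReal_zero, hω, torusPower_single]
    rw [meanPower, integral_congr_ae h1]
    simp
  deriv ξ t ht := by
    have h1 := h.hasDerivWithinAt_integral hd hn (ψ := fun _ y => torusPower ξ y)
      ((continuous_torusPower ξ).comp continuous_snd) 0 (t := t) (by simpa using ht)
    rw [NNReal.coe_zero] at h1
    refine h1.congr_deriv ?_
    have hN : ((n : ℝ) ^ d) ≠ 0 := natCast_pow_pos.ne'
    have h2 : ∀ y : Torus d n → ℝ, ringGenerator (srwMatrix d n) (fun _ y => torusPower ξ y) y y =
        -(2 * srwEigenvalue ξ) * torusPower ξ y +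
          ((n : ℝ) ^ d)⁻¹ * ∑ ζ, srwEigenvalue ζ ^ 2 * torusPower ζ y := by
      intro y
      rw [ringGenerator, sum_torusPower_ringUpdate_sub hd hn, sum_eigenvalue_sq_mul_torusPower hd hn,
        inv_mul_cancel_left₀ hN]
    have hi : ∀ ζ, Integrable (fun ω => torusPower ζ (Y t.toNNReal ω)) P := fun ζ =>
      h.integrable_comp hd hn (continuous_torusPower ζ) _
    calc ∫ ω, ringGenerator (srwMatrix d n) (fun _ y => torusPower ξ y) (Y 0 ω)
          (Y t.toNNReal ω) ∂P
        = ∫ ω, (-(2 * srwEigenvalue ξ) * torusPower ξ (Y t.toNNReal ω) +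
            ((n : ℝ) ^ d)⁻¹ * ∑ ζ, srwEigenvalue ζ ^ 2 * torusPower ζ (Y t.toNNReal ω)) ∂P :=
          integral_congr_ae (ae_of_all _ fun ω => h2 (Y t.toNNReal ω))
      _ = _ := by
          rw [integral_add ((hi ξ).const_mul _)
            ((integrable_finsetSum _ fun ζ _ => (hi ζ).const_mul _).const_mul _),
            integral_const_mul, integral_const_mul,
            integral_finsetSum _ fun ζ _ => (hi ζ).const_mul _]
          simp_rw [integral_const_mul]
          rfl

lemma integral_spatialEnergy (h : IsTorusSmoothing i P Y) (hd : 1 ≤ d) (hn : 3 ≤ n) (t : ℝ≥0) :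
    ∫ ω, spatialEnergy (Y t ω) ∂P = ((n : ℝ) ^ d)⁻¹ * flowEnergy (meanPower P Y) t := by
  have hi : ∀ ζ, Integrable (fun ω => torusPower ζ (Y t ω)) P := fun ζ =>
    h.integrable_comp hd hn (continuous_torusPower ζ) _
  simp_rw [spatialEnergy_eq hd hn, integral_const_mul]
  rw [integral_finsetSum _ fun ζ _ => (hi ζ).const_mul _, flowEnergy]
  simp_rw [integral_const_mul, meanPower, Real.toNNReal_coe]

lemma integral_spatialVariance (h : IsTorusSmoothing i P Y) (hd : 1 ≤ d) (hn : 3 ≤ n)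
    (t : ℝ≥0) :
    ∫ ω, spatialVariance (Y t ω) ∂P = ((n : ℝ) ^ d)⁻¹ * flowVariance (meanPower P Y) t := by
  have hi : ∀ ζ, Integrable (fun ω => torusPower ζ (Y t ω)) P := fun ζ =>
    h.integrable_comp hd hn (continuous_torusPower ζ) _
  simp_rw [spatialVariance_eq, integral_const_mul]
  rw [integral_finsetSum _ fun ζ _ => hi ζ, flowVariance]
  simp_rw [meanPower, Real.toNNReal_coe]

/-- By Markov's inequality at integer times, the event that the variance never falls below a given
level has probability bounded by a null sequence. Interval invariance makes one small value
sufficient, so no summability in time is needed. -/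
lemma ae_exists_spatialVariance_lt (h : IsTorusSmoothing i P Y) (hd : 1 ≤ d) (hn : 3 ≤ n)
    (hodd : Odd n) : ∀ᵐ ω ∂P, ∀ δ : ℝ, 0 < δ → ∃ s, spatialVariance (Y s ω) < δ := by
  have hnonneg : ∀ y : Torus d n → ℝ, 0 ≤ spatialVariance y := fun y =>
    mul_nonneg (by positivity) (Finset.sum_nonneg fun _ _ => sq_nonneg _)
  have hcont : Continuous (spatialVariance (d := d) (n := n)) := by
    unfold spatialVariance spatialMean
    fun_prop
  have hlim : Tendsto (fun k : ℕ => ∫ ω, spatialVariance (Y k ω) ∂P) atTop (𝓝 0) := by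
    simp_rw [h.integral_spatialVariance hd hn]
    have h1 := ((h.isPowerFlow hd hn).tendsto_variance hd hn hodd).comp
      (tendsto_natCast_atTop_atTop (R := ℝ))
    simpa using h1.const_mul ((n : ℝ) ^ d)⁻¹
  have hzero : ∀ m : ℕ, ∀ᵐ ω ∂P, ∃ s, spatialVariance (Y s ω) < 1 / ((m : ℝ) + 1) := by
    intro m
    have hδ : (0 : ℝ) < 1 / ((m : ℝ) + 1) := by positivity
    rw [ae_iff]
    simp only [not_exists, not_lt]
    rw [← measureReal_eq_zero_iff]
    refine le_antisymm ?_ measureReal_nonneg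
    have h1 : ∀ k : ℕ, 1 / ((m : ℝ) + 1) *
        P.real {ω | ∀ s, 1 / ((m : ℝ) + 1) ≤ spatialVariance (Y s ω)} ≤
        ∫ ω, spatialVariance (Y k ω) ∂P := by
      intro k
      refine le_trans ?_ (mul_meas_ge_le_integral_of_nonneg (ae_of_all _ fun ω => hnonneg _)
        (h.integrable_comp hd hn hcont k) (1 / ((m : ℝ) + 1)))
      exact mul_le_mul_of_nonneg_left (measureReal_mono fun ω hω => hω k) hδ.le
    have h2 := ge_of_tendsto' hlim h1
    nlinarith [measureReal_nonneg (μ := P)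
      (s := {ω | ∀ s, 1 / ((m : ℝ) + 1) ≤ spatialVariance (Y s ω)})]
  filter_upwards [ae_all_iff.2 hzero] with ω hω δ hδ
  obtain ⟨m, hm⟩ := exists_nat_one_div_lt hδ
  obtain ⟨s, hs⟩ := hω m
  exact ⟨s, hs.trans hm⟩

/-- Each site converges almost surely to the equilibrium mass. -/
theorem ae_tendsto_limitMass (h : IsTorusSmoothing i P Y) (hd : 1 ≤ d) (hn : 3 ≤ n)
    (hodd : Odd n) : ∀ᵐ ω ∂P, ∀ j, Tendsto (fun t => Y t ω j) atTop (𝓝 (limitMass Y ω)) := by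
  obtain ⟨N, hN⟩ := IsSmoothingProcess.exists_driven h
  filter_upwards [hN.ae_mem_Icc_mono srwMatrix_nonneg (sum_srwMatrix hd hn),
    h.ae_exists_spatialVariance_lt hd hn hodd] with ω hmono hvar
  obtain ⟨L, hL⟩ := exists_tendsto_of_spatialVariance (y := fun t => Y t ω) hmono hvar
  have hlim : limitMass Y ω = L := (tendsto_spatialMean hL).limUnder_eq
  rwa [hlim]

lemma ae_limitMass_mem (h : IsTorusSmoothing i P Y) (hd : 1 ≤ d) (hn : 3 ≤ n) (hodd : Odd n) :
    ∀ᵐ ω ∂P, limitMass Y ω ∈ Set.Icc (0 : ℝ) 1 := by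
  filter_upwards [h.ae_tendsto_limitMass hd hn hodd, h.ae_mem_unitCube hd hn] with ω h1 h2
  exact isClosed_Icc.mem_of_tendsto (h1 0) (Eventually.of_forall fun t => h2 t 0)

/-- The total mass is a martingale: a ring at `k` changes it by minus the Laplacian at `k`, and
these changes sum to zero. This is where the two-time forward equation is needed. -/
lemma integral_sum_mul_sum (h : IsTorusSmoothing i P Y) (hd : 1 ≤ d) (hn : 3 ≤ n) {s u : ℝ≥0}
    (hsu : s ≤ u) :
    ∫ ω, (∑ j, Y s ω j) * ∑ j, Y u ω j ∂P = ∫ ω, (∑ j, Y s ω j) * ∑ j, Y s ω j ∂P := by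
  set ψ : (Torus d n → ℝ) → (Torus d n → ℝ) → ℝ :=
    fun x y => (∑ j : Torus d n, x j) * ∑ j : Torus d n, y j with hψ
  have hψc : Continuous fun z : (Torus d n → ℝ) × (Torus d n → ℝ) => ψ z.1 z.2 := by
    simp only [hψ]
    fun_prop
  have hgen : ∀ x y, ringGenerator (srwMatrix d n) ψ x y = 0 := by
    intro x y
    simp only [ringGenerator, hψ, sum_ringUpdate_srwMatrix, mul_sub, sub_sub_cancel_left]
    rw [Finset.sum_neg_distrib, ← Finset.mul_sum, sum_torusLaplacian hd hn, mul_zero, neg_zero]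
  have hderiv : ∀ t : ℝ, (s : ℝ) ≤ t →
      HasDerivWithinAt (fun t : ℝ => ∫ ω, ψ (Y s ω) (Y t.toNNReal ω) ∂P) 0 (Set.Ici (s : ℝ)) t := by
    intro t ht
    refine (h.hasDerivWithinAt_integral hd hn hψc s ht).congr_deriv ?_
    simp [hgen]
  have h1 := constant_of_has_deriv_right_zero (a := (s : ℝ)) (b := u)
    (fun t ht => (hderiv t ht.1).continuousWithinAt.mono Set.Icc_subset_Ici_self)
    (fun t ht => (hderiv t ht.1).mono (Set.Ici_subset_Ici.2 ht.1)) u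
    ⟨by exact_mod_cast hsu, le_rfl⟩
  simpa [hψ] using h1

/-- By the martingale property the left side is the growth of the second moment of the mass, which
the conservation law equates with the loss of energy. -/
lemma integral_sum_sub_sum_sq (h : IsTorusSmoothing i P Y) (hd : 1 ≤ d) (hn : 3 ≤ n) {t u : ℝ≥0}
    (htu : t ≤ u) :
    ∫ ω, (∑ j, Y t ω j - ∑ j, Y u ω j) ^ 2 ∂P =
      flowEnergy (meanPower P Y) t - flowEnergy (meanPower P Y) u := by
  have hcons := (h.isPowerFlow hd hn).zero_add_energy hd hn (s := t) (t := u) t.2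
    (by exact_mod_cast htu)
  have hsq : ∀ v : ℝ≥0, meanPower P Y 0 v = ∫ ω, (∑ j, Y v ω j) * ∑ j, Y v ω j ∂P := by
    intro v
    simp_rw [meanPower, torusPower_zero, Real.toNNReal_coe, sq]
  have hint : ∀ v w : ℝ≥0, Integrable (fun ω => (∑ j, Y v ω j) * ∑ j, Y w ω j) P := fun v w =>
    h.integrable_pair hd hn (ψ := fun x y => (∑ j : Torus d n, x j) * ∑ j : Torus d n, y j)
      (by fun_prop) v w
  rw [← hcons, hsq, hsq]
  have hexp : ∀ ω, (∑ j, Y t ω j - ∑ j, Y u ω j) ^ 2 =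
      (∑ j, Y u ω j) * ∑ j, Y u ω j + (∑ j, Y t ω j) * ∑ j, Y t ω j -
        2 * ((∑ j, Y t ω j) * ∑ j, Y u ω j) := fun ω => by ring
  simp_rw [hexp]
  have hadd : Integrable (fun ω => (∑ j, Y u ω j) * ∑ j, Y u ω j +
      (∑ j, Y t ω j) * ∑ j, Y t ω j) P := (hint u u).add (hint t t)
  rw [integral_sub hadd ((hint t u).const_mul 2), integral_add (hint u u) (hint t t), integral_const_mul, h.integral_sum_mul_sum hd hn htu]
  ring

/-- The mean square distance of the total mass to its limit is the energy. -/
theorem integral_sum_sub_limitMass_sq (h : IsTorusSmoothing i P Y) (hd : 1 ≤ d) (hn : 3 ≤ n)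
    (hodd : Odd n) (t : ℝ≥0) :
    ∫ ω, (∑ j, Y t ω j - (n : ℝ) ^ d * limitMass Y ω) ^ 2 ∂P =
      flowEnergy (meanPower P Y) t := by
  have hN : (0 : ℝ) < (n : ℝ) ^ d := natCast_pow_pos
  have hlim : Tendsto (fun k : ℕ => ∫ ω, (∑ j, Y t ω j - ∑ j, Y (k : ℝ≥0) ω j) ^ 2 ∂P) atTop
      (𝓝 (∫ ω, (∑ j, Y t ω j - (n : ℝ) ^ d * limitMass Y ω) ^ 2 ∂P)) := by
    refine tendsto_integral_of_dominated_convergence (fun _ => ((n : ℝ) ^ d) ^ 2)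
      (fun k => ?_) (integrable_const _) (fun k => ?_) ?_
    · exact (h.integrable_pair hd hn
        (ψ := fun x y => (∑ j : Torus d n, x j - ∑ j : Torus d n, y j) ^ 2)
        (by fun_prop) t k).aestronglyMeasurable
    · filter_upwards [h.ae_mem_unitCube hd hn] with ω hω
      have hmem : ∀ s, 0 ≤ ∑ j, Y s ω j ∧ ∑ j, Y s ω j ≤ (n : ℝ) ^ d := by
        intro s
        refine ⟨Finset.sum_nonneg fun j _ => (hω s j).1, ?_⟩
        refine (Finset.sum_le_card_nsmul Finset.univ _ 1 fun j _ => (hω s j).2).trans ?_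
        rw [Finset.card_univ, nsmul_eq_mul, card_torus, mul_one]
      rw [Real.norm_eq_abs, abs_of_nonneg (sq_nonneg _)]
      refine sq_le_sq.2 ?_
      rw [abs_of_pos hN, abs_le]
      constructor <;> linarith [(hmem t).1, (hmem t).2, (hmem k).1, (hmem k).2]
    · filter_upwards [h.ae_tendsto_limitMass hd hn hodd] with ω hω
      have h1 : Tendsto (fun k : ℕ => (k : ℝ≥0)) atTop atTop := tendsto_natCast_atTop_atTop
      have h2 := (tendsto_finsetSum Finset.univ fun j _ => hω j).comp h1
      rw [Finset.sum_const, Finset.card_univ, nsmul_eq_mul, card_torus] at h2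
      exact (h2.const_sub _).pow 2
  have hlim' : Tendsto (fun k : ℕ => ∫ ω, (∑ j, Y t ω j - ∑ j, Y (k : ℝ≥0) ω j) ^ 2 ∂P) atTop
      (𝓝 (flowEnergy (meanPower P Y) t)) := by
    have h1 := (((h.isPowerFlow hd hn).tendsto_energy hd hn hodd).comp
      (tendsto_natCast_atTop_atTop (R := ℝ))).const_sub (flowEnergy (meanPower P Y) t)
    rw [sub_zero] at h1
    refine h1.congr' ?_
    have h2 : ∀ᶠ k : ℕ in atTop, t ≤ (k : ℝ≥0) := tendsto_natCast_atTop_atTop.eventually_ge_atTop t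
    filter_upwards [h2] with k hk
    rw [h.integral_sum_sub_sum_sq hd hn hk]
    simp
  exact tendsto_nhds_unique hlim hlim'

/-- A `limsup` along integer times replaces the limit over all real times, making the equilibrium
mass a measurable functional of the path, to which independence from the weights applies. -/
lemma exists_measurable_limitMass (h : IsTorusSmoothing i P Y) (hd : 1 ≤ d) (hn : 3 ≤ n)
    (hodd : Odd n) : ∃ G : (ℝ≥0 → Torus d n → ℝ) → ℝ, Measurable G ∧
      ∀ᵐ ω ∂P, limitMass Y ω = G fun t => Y t ω := by
  refine ⟨fun y => limsup (fun k : ℕ => spatialMean (y k)) atTop, ?_, ?_⟩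
  · refine Measurable.limsup fun k => ?_
    unfold spatialMean
    fun_prop
  · filter_upwards [h.ae_tendsto_limitMass hd hn hodd] with ω hω
    have h1 : Tendsto (fun k : ℕ => (k : ℝ≥0)) atTop atTop := tendsto_natCast_atTop_atTop
    exact ((tendsto_spatialMean hω).comp h1).limsup_eq.symm

lemma integral_sum_sub_sq (h : IsTorusSmoothing i P Y) (hd : 1 ≤ d) (hn : 3 ≤ n) (hodd : Odd n)
    (t : ℝ≥0) :
    ∫ ω, ∑ j, (Y t ω j - limitMass Y ω) ^ 2 ∂P =
      flowVariance (meanPower P Y) t + ((n : ℝ) ^ d)⁻¹ * flowEnergy (meanPower P Y) t := by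
  have hN : (0 : ℝ) < (n : ℝ) ^ d := natCast_pow_pos
  have hcont : Continuous (spatialVariance (d := d) (n := n)) := by
    unfold spatialVariance spatialMean
    fun_prop
  obtain ⟨G, hG, hGY⟩ := h.exists_measurable_limitMass hd hn hodd
  have hint : Integrable (fun ω => (∑ j, Y t ω j - (n : ℝ) ^ d * limitMass Y ω) ^ 2) P := by
    refine Integrable.of_bound (C := ((n : ℝ) ^ d) ^ 2) ?_ ?_
    · have hYm := h.measurable
      refine AEStronglyMeasurable.congr (f := fun ω => (∑ j, Y t ω j - (n : ℝ) ^ d *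
        G fun t => Y t ω) ^ 2) (Measurable.aestronglyMeasurable ?_) ?_
      · have h1 : Measurable fun ω => G fun t => Y t ω := hG.comp (measurable_pi_iff.2 hYm)
        have h2 : ∀ j, Measurable fun ω => Y t ω j := fun j => measurable_pi_iff.1 (hYm t) j
        fun_prop
      · filter_upwards [hGY] with ω hω
        rw [hω]
    · filter_upwards [h.ae_mem_unitCube hd hn, h.ae_limitMass_mem hd hn hodd] with ω hω hL
      have h1 : 0 ≤ ∑ j, Y t ω j := Finset.sum_nonneg fun j _ => (hω t j).1
      have h2 : ∑ j, Y t ω j ≤ (n : ℝ) ^ d := by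
        refine (Finset.sum_le_card_nsmul Finset.univ _ 1 fun j _ => (hω t j).2).trans ?_
        rw [Finset.card_univ, nsmul_eq_mul, card_torus, mul_one]
      have h3 := mul_le_mul_of_nonneg_left hL.2 hN.le
      have h4 := mul_nonneg hN.le hL.1
      rw [Real.norm_eq_abs, abs_of_nonneg (sq_nonneg _)]
      refine sq_le_sq.2 ?_
      rw [abs_of_pos hN, abs_le]
      constructor <;> linarith
  simp_rw [sum_sub_sq_eq]
  rw [integral_add ((h.integrable_comp hd hn hcont t).const_mul _) (hint.const_mul _),
    integral_const_mul, integral_const_mul, h.integral_spatialVariance hd hn,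
    h.integral_sum_sub_limitMass_sq hd hn hodd, mul_inv_cancel_left₀ hN.ne']

omit [NeZero n] in
lemma torusRep_injective : Function.Injective (torusRep : Torus d n → Fin d → ℤ) := by
  intro j k h
  funext l
  exact ZMod.injective_valMinAbs (congrFun h l)

/-- Second moment of the fluctuations of a random linear functional with uncorrelated weights. -/
theorem integral_weighted_sq (h : IsTorusSmoothing i P Y) (hd : 1 ≤ d) (hn : 3 ≤ n)
    (hodd : Odd n) (t : ℝ≥0) {m σ : ℝ} {X : (Fin d → ℤ) → Ω → ℝ} (hXm : ∀ j, Measurable (X j))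
    (hX2 : ∀ j, MemLp (X j) 2 P) (hmean : ∀ j, ∫ ω, X j ω ∂P = m)
    (hvar : ∀ j, variance (X j) P = σ ^ 2)
    (hcov : ∀ j k, j ≠ k → covariance (X j) (X k) P = 0)
    (hindep : IndepFun (fun ω => fun j => X j ω) (fun ω => fun t => Y t ω) P) :
    ∫ ω, (∑ j, X (torusRep j) ω * Y t ω j
        - limitMass Y ω * ∑ j : Torus d n, X (torusRep j) ω) ^ 2 ∂P =
      σ ^ 2 * (flowVariance (meanPower P Y) t + ((n : ℝ) ^ d)⁻¹ * flowEnergy (meanPower P Y) t) +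
        m ^ 2 * flowEnergy (meanPower P Y) t := by
  obtain ⟨G, hG, hGY⟩ := h.exists_measurable_limitMass hd hn hodd
  set a : Torus d n → Ω → ℝ := fun j ω => Y t ω j - G fun t => Y t ω with ha
  have hYm : Measurable fun ω => fun t => Y t ω := measurable_pi_iff.2 h.measurable
  have hFm : ∀ j k : Torus d n, Measurable fun y : ℝ≥0 → Torus d n → ℝ =>
      (y t j - G y) * (y t k - G y) := by
    intro j k
    fun_prop
  have haint : ∀ j k, Integrable (fun ω => a j ω * a k ω) P := by
    intro j k
    refine Integrable.of_bound (C := 1) ((hFm j k).comp hYm).aestronglyMeasurable ?_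
    filter_upwards [h.ae_mem_unitCube hd hn, h.ae_limitMass_mem hd hn hodd, hGY] with ω hω hL hLG
    have h1 : ∀ j, |a j ω| ≤ 1 := by
      intro j
      simp only [ha, ← hLG]
      rw [abs_le]
      constructor <;> linarith [(hω t j).1, (hω t j).2, hL.1, hL.2]
    rw [Real.norm_eq_abs, abs_mul]
    exact mul_le_one₀ (h1 j) (abs_nonneg _) (h1 k)
  have hXX : ∀ j k : Torus d n, Integrable (fun ω => X (torusRep j) ω * X (torusRep k) ω) P :=
    fun j k => (hX2 _).integrable_mul (hX2 _)
  have hind : ∀ j k : Torus d n, IndepFun (fun ω => X (torusRep j) ω * X (torusRep k) ω)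
      (fun ω => a j ω * a k ω) P := by
    intro j k
    exact hindep.comp (φ := fun x => x (torusRep j) * x (torusRep k)) (by fun_prop) (hFm j k)
  -- The constant `m²` multiplies the square of the summed deviations, which is the energy; the
  -- diagonal `σ²` multiplies the sum of their squares.
  have hEX : ∀ j k : Torus d n, ∫ ω, X (torusRep j) ω * X (torusRep k) ω ∂P =
      m ^ 2 + if j = k then σ ^ 2 else 0 := by
    intro j k
    have h1 := covariance_eq_sub (hX2 (torusRep j)) (hX2 (torusRep k))
    rw [hmean, hmean] at h1
    simp only [Pi.mul_apply] at h1
    split_ifs with hjk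
    · subst hjk
      rw [covariance_self (hXm _).aemeasurable, hvar] at h1
      linarith
    · rw [hcov _ _ (torusRep_injective.ne hjk)] at h1
      linarith
  have hprod : ∀ j k : Torus d n, Integrable (fun ω =>
      X (torusRep j) ω * X (torusRep k) ω * (a j ω * a k ω)) P := fun j k =>
    (hind j k).integrable_mul (hXX j k) (haint j k)
  have hexp : ∀ᵐ ω ∂P, (∑ j, X (torusRep j) ω * Y t ω j
        - limitMass Y ω * ∑ j : Torus d n, X (torusRep j) ω) ^ 2 =
      ∑ j : Torus d n, ∑ k : Torus d n,
        X (torusRep j) ω * X (torusRep k) ω * (a j ω * a k ω) := by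
    filter_upwards [hGY] with ω hω
    have h1 : ∑ j, X (torusRep j) ω * Y t ω j - limitMass Y ω * ∑ j : Torus d n, X (torusRep j) ω =
        ∑ j : Torus d n, X (torusRep j) ω * a j ω := by
      rw [Finset.mul_sum, ← Finset.sum_sub_distrib]
      refine Finset.sum_congr rfl fun j _ => ?_
      simp only [ha, ← hω]
      ring
    rw [h1, sq, Finset.sum_mul_sum]
    refine Finset.sum_congr rfl fun j _ => Finset.sum_congr rfl fun k _ => ?_
    ring
  have hsum : ∫ ω, ∑ j : Torus d n, ∑ k : Torus d n, a j ω * a k ω ∂P =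
      flowEnergy (meanPower P Y) t := by
    rw [← h.integral_sum_sub_limitMass_sq hd hn hodd t]
    refine integral_congr_ae ?_
    filter_upwards [hGY] with ω hω
    rw [← Finset.sum_mul_sum, ← sq]
    simp only [ha, ← hω]
    rw [Finset.sum_sub_distrib, Finset.sum_const, Finset.card_univ, nsmul_eq_mul, card_torus]
  have hdiag : ∫ ω, ∑ j : Torus d n, a j ω * a j ω ∂P =
      flowVariance (meanPower P Y) t + ((n : ℝ) ^ d)⁻¹ * flowEnergy (meanPower P Y) t := by
    rw [← h.integral_sum_sub_sq hd hn hodd t]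
    refine integral_congr_ae ?_
    filter_upwards [hGY] with ω hω
    simp only [ha, ← hω, sq]
  rw [integral_congr_ae hexp, integral_finsetSum _ fun j _ => integrable_finsetSum _ fun k _ =>
    hprod j k, ← hdiag, ← hsum, integral_finsetSum _ fun j _ => integrable_finsetSum _ fun k _ =>
    haint j k, integral_finsetSum _ fun j _ => haint j j, Finset.mul_sum, Finset.mul_sum,
    ← Finset.sum_add_distrib]
  refine Finset.sum_congr rfl fun j _ => ?_
  rw [integral_finsetSum _ fun k _ => hprod j k, integral_finsetSum _ fun k _ => haint j k]
  have hterm : ∀ k : Torus d n, ∫ ω, X (torusRep j) ω * X (torusRep k) ω * (a j ω * a k ω) ∂P =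
      m ^ 2 * ∫ ω, a j ω * a k ω ∂P + if j = k then σ ^ 2 * ∫ ω, a j ω * a k ω ∂P else 0 := by
    intro k
    rw [(hind j k).integral_fun_mul_eq_mul_integral (hXX j k).aestronglyMeasurable
      (haint j k).aestronglyMeasurable, hEX]
    split_ifs <;> ring
  simp_rw [hterm]
  rw [Finset.sum_add_distrib, Finset.sum_ite_eq, if_pos (Finset.mem_univ j), ← Finset.mul_sum]
  ring

end IsTorusSmoothing

end TorusSmoothing

/-! ### Assembling the two-sided bounds. -/

/-- The decay profile in additive form is at most twice its form as an inverse minimum. -/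
lemma rpow_neg_add_inv_le {q t M : ℝ} (hq : 0 ≤ q) (ht : 0 < t) (hM : 0 < M) :
    (1 + t) ^ (-q) + M⁻¹ ≤ 2 / min (t ^ q) M := by
  have htq : 0 < t ^ q := Real.rpow_pos_of_pos ht q
  have hmin : 0 < min (t ^ q) M := lt_min htq hM
  have h1 : (1 + t) ^ (-q) ≤ (min (t ^ q) M)⁻¹ := by
    rw [Real.rpow_neg (by linarith)]
    exact inv_anti₀ hmin
      ((min_le_left _ _).trans (Real.rpow_le_rpow ht.le (by linarith) hq))
  have h2 : M⁻¹ ≤ (min (t ^ q) M)⁻¹ := inv_anti₀ hmin (min_le_right _ _)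
  rw [div_eq_mul_inv]
  linarith

/-- Two-sided bounds on the energy and the variance of the mean powers. -/
lemma exists_energy_variance_bounds (d : ℕ) (hd : 1 ≤ d) : ∃ α₁ α₂ α₃ : ℝ, 0 < α₁ ∧ 0 < α₂ ∧
    0 < α₃ ∧ ∃ n₀ : ℕ, 3 ≤ n₀ ∧ ∀ (n : ℕ) [NeZero n], n₀ ≤ n → Odd n →
    ∀ a : Torus d n → ℝ → ℝ, IsPowerFlow a → ∀ t : ℝ, 16 ≤ t →
      (α₁ / min (t ^ ((d : ℝ) / 2 + 1)) ((n : ℝ) ^ (d + 2)) *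
          Real.exp (-(2 * gapOne n / d) * t) ≤ flowEnergy a t) ∧
      (flowEnergy a t ≤ α₂ / min (t ^ ((d : ℝ) / 2 + 1)) ((n : ℝ) ^ (d + 2)) *
          Real.exp (-(2 * gapOne n / d - α₃ / (n : ℝ) ^ (d + 4)) * t)) ∧
      (α₁ / min (t ^ ((d : ℝ) / 2)) ((n : ℝ) ^ d) *
          Real.exp (-(2 * gapOne n / d + α₃ / (n : ℝ) ^ (d + 4)) * t) ≤ flowVariance a t) ∧
      (flowVariance a t ≤ α₂ / min (t ^ ((d : ℝ) / 2)) ((n : ℝ) ^ d) *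
          Real.exp (-(2 * gapOne n / d - α₃ / (n : ℝ) ^ (d + 4)) * t)) := by
  obtain ⟨c, hc, hlow⟩ := IsPowerFlow.exists_le_energy_variance d hd
  obtain ⟨C, hC, n₀, hn₀, hup⟩ := exists_energy_variance_le d hd
  refine ⟨c, 2 * C, 102400, hc, by positivity, by norm_num, n₀, hn₀, ?_⟩
  intro n _ hn hodd a ha t ht
  have hn0 : (0 : ℝ) < n := Nat.cast_pos.2 (NeZero.pos n)
  have ht0 : 0 < t := by linarith
  obtain ⟨hl₁, hl₂⟩ := hlow n (hn₀.trans hn) a ha t ht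
  obtain ⟨hu₁, hu₂⟩ := hup n hn hodd a ha t ht0.le
  rw [← mul_div_assoc] at hl₁ hl₂ hu₁ hu₂
  rw [← neg_mul] at hu₁ hu₂
  have hupper : ∀ {v q M : ℝ}, 0 ≤ q → 0 < M →
      v ≤ C * (Real.exp (-(2 * gapOne n / d - 102400 / (n : ℝ) ^ (d + 4)) * t) *
        ((1 + t) ^ (-q) + M⁻¹)) →
      v ≤ 2 * C / min (t ^ q) M *
        Real.exp (-(2 * gapOne n / d - 102400 / (n : ℝ) ^ (d + 4)) * t) := by
    intro v q M hq hM hv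
    refine hv.trans ?_
    calc _ ≤ C * (Real.exp (-(2 * gapOne n / d - 102400 / (n : ℝ) ^ (d + 4)) * t) *
          (2 / min (t ^ q) M)) := by
          have := rpow_neg_add_inv_le hq ht0 hM
          gcongr
      _ = _ := by ring
  refine ⟨hl₁, hupper (by positivity) (by positivity) hu₁, le_trans ?_ hl₂,
    hupper (by positivity) (by positivity) hu₂⟩
  -- The lower bound on the variance holds without the correction `α₃`, which only shrinks the
  -- exponential.
  gcongr
  have : 0 ≤ 102400 / (n : ℝ) ^ (d + 4) := by positivity
  linarith

theorem theorem4p9 (d : ℕ) (hd : 1 ≤ d) :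
    -- each site converges almost surely to the equilibrium mass
    (∀ (n : ℕ) [NeZero n], 3 ≤ n → Odd n → ∀ (i : Torus d n)
        (Ω : Type u) [MeasurableSpace Ω] (P : Measure Ω) [IsProbabilityMeasure P]
        (Y : ℝ≥0 → Ω → Torus d n → ℝ), IsTorusSmoothing i P Y →
        ∀ᵐ ω ∂P, ∀ j, Tendsto (fun t => Y t ω j) atTop (𝓝 (limitMass Y ω))) ∧
    ∃ α₁ α₂ α₃ : ℝ, 0 < α₁ ∧ 0 < α₂ ∧ 0 < α₃ ∧
    -- the constants are those of the energy and variance bounds, which they satisfy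
    (∃ n₀ : ℕ, 3 ≤ n₀ ∧ ∃ t₀ : ℝ≥0, 0 < t₀ ∧
      ∀ (n : ℕ) [NeZero n], n₀ ≤ n → Odd n → ∀ t : ℝ≥0, t₀ ≤ t → ∀
        (Ω : Type u) [MeasurableSpace Ω] (P : Measure Ω) [IsProbabilityMeasure P]
        (Y : ℝ≥0 → Ω → Torus d n → ℝ), IsTorusSmoothing 0 P Y →
        (α₁ * ((n : ℝ) ^ d)⁻¹ / min ((t : ℝ) ^ ((d : ℝ) / 2 + 1)) ((n : ℝ) ^ (d + 2)) *
            Real.exp (-(2 * gapOne n / d) * t)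
          ≤ ∫ ω, spatialEnergy (Y t ω) ∂P) ∧
        (∫ ω, spatialEnergy (Y t ω) ∂P
          ≤ α₂ * ((n : ℝ) ^ d)⁻¹ / min ((t : ℝ) ^ ((d : ℝ) / 2 + 1)) ((n : ℝ) ^ (d + 2)) *
            Real.exp (-(2 * gapOne n / d - α₃ / (n : ℝ) ^ (d + 4)) * t)) ∧
        (α₁ * ((n : ℝ) ^ d)⁻¹ / min ((t : ℝ) ^ ((d : ℝ) / 2)) ((n : ℝ) ^ d) *
            Real.exp (-(2 * gapOne n / d + α₃ / (n : ℝ) ^ (d + 4)) * t)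
          ≤ ∫ ω, spatialVariance (Y t ω) ∂P) ∧
        (∫ ω, spatialVariance (Y t ω) ∂P
          ≤ α₂ * ((n : ℝ) ^ d)⁻¹ / min ((t : ℝ) ^ ((d : ℝ) / 2)) ((n : ℝ) ^ d) *
            Real.exp (-(2 * gapOne n / d - α₃ / (n : ℝ) ^ (d + 4)) * t))) ∧
    -- (i)
    (∃ n₀ : ℕ, 3 ≤ n₀ ∧ ∃ t₀ : ℝ≥0, 0 < t₀ ∧
      ∀ (n : ℕ) [NeZero n], n₀ ≤ n → Odd n → ∀ t : ℝ≥0, t₀ ≤ t → ∀ (i : Torus d n)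
        (Ω : Type u) [MeasurableSpace Ω] (P : Measure Ω) [IsProbabilityMeasure P]
        (Y : ℝ≥0 → Ω → Torus d n → ℝ), IsTorusSmoothing i P Y →
        (α₁ / min ((t : ℝ) ^ ((d : ℝ) / 2 + 1)) ((n : ℝ) ^ (d + 2)) *
            Real.exp (-(2 * gapOne n / d) * t)
          ≤ ∫ ω, (∑ j, Y t ω j - (n : ℝ) ^ d * limitMass Y ω) ^ 2 ∂P) ∧
        (∫ ω, (∑ j, Y t ω j - (n : ℝ) ^ d * limitMass Y ω) ^ 2 ∂P
          ≤ α₂ / min ((t : ℝ) ^ ((d : ℝ) / 2 + 1)) ((n : ℝ) ^ (d + 2)) *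
            Real.exp (-(2 * gapOne n / d - α₃ / (n : ℝ) ^ (d + 4)) * t))) ∧
    -- (ii)
    (∃ n₀' : ℕ, 3 ≤ n₀' ∧ ∃ t₀' : ℝ≥0, 0 < t₀' ∧ ∀ m σ : ℝ, 0 < σ →
      ∃ η₁ η₂ : ℝ, 0 < η₁ ∧ 0 < η₂ ∧
      ∀ (n : ℕ) [NeZero n], n₀' ≤ n → Odd n → ∀ t : ℝ≥0, t₀' ≤ t → ∀ (i : Torus d n)
        (Ω : Type u) [MeasurableSpace Ω] (P : Measure Ω) [IsProbabilityMeasure P]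
        (Y : ℝ≥0 → Ω → Torus d n → ℝ), IsTorusSmoothing i P Y →
        ∀ X : (Fin d → ℤ) → Ω → ℝ,
        (∀ j, Measurable (X j)) →
        (∀ j, ∀ᵐ ω ∂P, 0 ≤ X j ω) →
        (∀ j, MemLp (X j) 2 P) →
        (∀ j, ∫ ω, X j ω ∂P = m) →
        (∀ j, variance (X j) P = σ ^ 2) →
        (∀ j k, j ≠ k → covariance (X j) (X k) P = 0) →
        IndepFun (fun ω => fun j => X j ω) (fun ω => fun t => Y t ω) P →
        (η₁ / min ((t : ℝ) ^ ((d : ℝ) / 2)) ((n : ℝ) ^ d) *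
            Real.exp (-(2 * gapOne n / d + α₃ / (n : ℝ) ^ (d + 4)) * t)
          ≤ ∫ ω, (∑ j, X (torusRep j) ω * Y t ω j
              - limitMass Y ω * ∑ j : Torus d n, X (torusRep j) ω) ^ 2 ∂P) ∧
        (∫ ω, (∑ j, X (torusRep j) ω * Y t ω j
              - limitMass Y ω * ∑ j : Torus d n, X (torusRep j) ω) ^ 2 ∂P
          ≤ η₂ / min ((t : ℝ) ^ ((d : ℝ) / 2)) ((n : ℝ) ^ d) *
            Real.exp (-(2 * gapOne n / d - α₃ / (n : ℝ) ^ (d + 4)) * t))) := by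
  refine ⟨fun n _ hn hodd i Ω _ P _ Y h => h.ae_tendsto_limitMass hd hn hodd, ?_⟩
  obtain ⟨α₁, α₂, α₃, h₁, h₂, h₃, n₀, hn₀, hbound⟩ := exists_energy_variance_bounds d hd
  refine ⟨α₁, α₂, α₃, h₁, h₂, h₃, ⟨n₀, hn₀, 16, by norm_num, ?_⟩,
    ⟨n₀, hn₀, 16, by norm_num, ?_⟩, ⟨n₀, hn₀, 16, by norm_num, ?_⟩⟩
  · intro n _ hn hodd t ht Ω _ P _ Y h
    have hn3 := hn₀.trans hn
    obtain ⟨b₁, b₂, b₃, b₄⟩ :=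
      hbound n hn hodd _ (h.isPowerFlow hd hn3) t (by exact_mod_cast ht)
    have hN : (0 : ℝ) ≤ ((n : ℝ) ^ d)⁻¹ := by positivity
    rw [h.integral_spatialEnergy hd hn3, h.integral_spatialVariance hd hn3]
    have hcomm : ∀ α e f : ℝ, α * ((n : ℝ) ^ d)⁻¹ / e * f = ((n : ℝ) ^ d)⁻¹ * (α / e * f) :=
      fun α e f => by ring
    simp only [hcomm]
    exact ⟨mul_le_mul_of_nonneg_left b₁ hN, mul_le_mul_of_nonneg_left b₂ hN,
      mul_le_mul_of_nonneg_left b₃ hN, mul_le_mul_of_nonneg_left b₄ hN⟩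
  · intro n _ hn hodd t ht i Ω _ P _ Y h
    have hn3 := hn₀.trans hn
    obtain ⟨b₁, b₂, -, -⟩ := hbound n hn hodd _ (h.isPowerFlow hd hn3) t (by exact_mod_cast ht)
    rw [h.integral_sum_sub_limitMass_sq hd hn3 hodd]
    exact ⟨b₁, b₂⟩
  · intro m σ hσ
    -- Below, only `σ² V` is kept. Above, `E ≤ 2 V` and `n^{-d} ≤ 1` give `σ² (V + E) + m² E ≤ (3 σ²
    -- + 2 m²) V`.
    refine ⟨σ ^ 2 * α₁, (3 * σ ^ 2 + 2 * m ^ 2) * α₂, by positivity, by positivity, ?_⟩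
    intro n _ hn hodd t ht i Ω _ P _ Y h X hXm _ hX2 hmean hvar hcov hindep
    have hn3 := hn₀.trans hn
    have hflow := h.isPowerFlow hd hn3
    obtain ⟨-, -, b₃, b₄⟩ := hbound n hn hodd _ hflow t (by exact_mod_cast ht)
    rw [h.integral_weighted_sq hd hn3 hodd t hXm hX2 hmean hvar hcov hindep]
    have hE := hflow.energy_nonneg t.coe_nonneg
    have hEV := hflow.energy_le_two_mul_variance hd hodd t.coe_nonneg
    have hN : (0 : ℝ) ≤ ((n : ℝ) ^ d)⁻¹ := by positivity
    have hN1 : ((n : ℝ) ^ d)⁻¹ ≤ 1 :=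
      inv_le_one_of_one_le₀ (one_le_pow₀ (by exact_mod_cast NeZero.one_le))
    set E := flowEnergy (meanPower P Y) t
    set V := flowVariance (meanPower P Y) t
    have hNE : ((n : ℝ) ^ d)⁻¹ * E ≤ E := mul_le_of_le_one_left hE hN1
    have hNE0 : 0 ≤ ((n : ℝ) ^ d)⁻¹ * E := mul_nonneg hN hE
    have hσ2 := sq_nonneg σ
    have hm2 := sq_nonneg m
    simp only [mul_div_assoc, mul_assoc] at b₃ b₄ ⊢
    constructor
    · calc _ ≤ σ ^ 2 * V := mul_le_mul_of_nonneg_left b₃ hσ2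
        _ ≤ _ := by nlinarith [mul_nonneg hm2 hE, mul_nonneg hσ2 hNE0]
    · calc _ ≤ (3 * σ ^ 2 + 2 * m ^ 2) * V := by
            have k₁ : σ ^ 2 * (V + ((n : ℝ) ^ d)⁻¹ * E) ≤ σ ^ 2 * (3 * V) :=
              mul_le_mul_of_nonneg_left (by linarith) hσ2
            have k₂ : m ^ 2 * E ≤ m ^ 2 * (2 * V) := mul_le_mul_of_nonneg_left hEV hm2
            linarith
        _ ≤ _ := mul_le_mul_of_nonneg_left b₄ (by positivity)
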